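/- **Setting.** A (CNF) formula $\varphi$ on variables $x_1,\dots,x_n$ is a finite set of clauses, a clause being a finite set of literals. Its hypergraph $\mathcal H_\varphi$ has as vertices the $2n$ literals $x_i,\neg x_i$ and as edges the sets $\{\neg\ell:\ell\in K\}$ for the clauses $K$ of $\varphi$. For an assignment $\alpha$ let $I_\alpha$ be the set of the $n$ literals that are true under $\alpha$. For a finite hypergraph $\mathcal H$ and $p>0$, the $p$-weight is $w_p(\mathcal H)=\sum_{E\in\mathcal H}p^{|E|}$, the average $p$-weight is $\bar w_p(\mathcal H)=w_p(\mathcal H)/|V(\mathcal H)|$, and the maximal $p$-codegree is $\Delta_{i,p}(\mathcal H)=\max_{|L|=i}\sum_{E\supseteq L}p^{|E|}$. $\mathcal H[C]$ consists of the edges of $\mathcal H$ contained in $C$. $\mathcal H$ is a $(\lambda,p)_k$-structure if all its edges have size at most $k$, $\bar w_p(\mathcal H)\ge p$, $\Delta_{1,p}(\mathcal H)\le\lambda\bar w_p(\mathcal H)$ and $\Delta_{2,p}(\mathcal H)\le\lambda\bar w_p(\mathcal H)p^k$. Let $H(x)=-x\log_2x-(1-x)\log_2(1-x)$. Algorithms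 are programs in a first-order functional language on binary trees with unit-cost steps (each a bounded number of steps of a random access machine). The input is $n$ (in unary) and the list of clauses. The real numbers $p,\delta$ are accessible only through exact comparisons of the form $\sum_s a_sp^s\le b\,\delta$ with natural numbers $a_s,b$ written in unary, where a comparison costs the size of the question. **Theorem.** Let $k$ be a natural number, $\lambda>1$ and $0<\delta<1/4$. There are $p'>0$, an algorithm and a constant $c$, all depending only on $k,\lambda,\delta$, such that the following holds for every real $0<p<p'$. If $\varphi$ is a formula on $n$ variables for which $\mathcal H_\varphi$ is a $(\lambda,p)_k$-structure, then on input $\varphi$ (with its clauses, and the literals in them, listed without repetition in any order) the algorithm outputs, in at most $c\,(n+1)^c\,2^{2H(2k^2p/\delta)n}$ steps (that is, in time $O^*(2^{2H(2k^2p/\delta)n})$), a list of a family $\mathcal S$ (fingerprints) and a list of a family $\mathcal C$ (containers) of subsets of $V(\mathcal H_\varphi)$, where $\mathcal C=\{g(S):S\in\mathcal S\}$ for some map $g$, with the following properties. 1. For every satisfying assignment $\alpha$ of $\varphi$ there is $S\in\mathcal S$ with $S\subseteq I_\alpha\subseteq g(S)$; in particular $I_\alpha\subseteq C$ for some $C\in\mathcal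 C$. 2. Every $S\in\mathcal S$ has $|S|\le 4k^2pn/\delta$; and $|\mathcal C|\le 2^{2H(2k^2p/\delta)n}$. 3. $C\cap\{x_i,\neg x_i\}\ne\emptyset$ for every $C\in\mathcal C$ and every $i\in\{1,\dots,n\}$. 4. Every $C\in\mathcal C$ has $|C|\le(2-1/\lambda)n$ and $w_p(\mathcal H_\varphi[C])\le\delta\,w_p(\mathcal H_\varphi)$. -/

import Mathlib

namespace SatContainer

/-! ### Hypergraphs and `p`-weights -/

section Hypergraphs

variable {V : Type*} [Fintype V] [DecidableEq V]

/-- A hypergraph whose vertex set is the finite type `V`, given by its finite set of edges (as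
finite sets, since edge sizes and finite sums over edges are all that is used). -/
abbrev HGraph (V : Type*) := Finset (Finset V)

/-- The `p`-weight of a hypergraph: an edge `E` has weight `p ^ |E|`. -/
def weight (p : ℝ) (H : HGraph V) : ℝ := ∑ E ∈ H, p ^ E.card

/-- The maximal `p`-codegree of `i`-sets. -/
noncomputable def codegree (i : ℕ) (p : ℝ) (H : HGraph V) : ℝ :=
  ⨆ L : {L : Finset V // L.card = i}, weight p (H.filter fun E => L.1 ⊆ E)

/-- The average `p`-weight of a hypergraph. -/
noncomputable def avgWeight (p : ℝ) (H : HGraph V) : ℝ := weight p H / Fintype.card V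

/-- The subhypergraph `H[C]` induced by a set `C` of vertices. -/
def inducedOn (H : HGraph V) (C : Finset V) : HGraph V := H.filter fun E => E ⊆ C

/-- `(lam, p)_k`-structures. -/
structure IsSpread (lam p : ℝ) (k : ℕ) (H : HGraph V) : Prop where
  bounded : ∀ E ∈ H, E.card ≤ k
  avg : p ≤ avgWeight p H
  codegree_one : codegree 1 p H ≤ lam * avgWeight p H
  codegree_two : codegree 2 p H ≤ lam * avgWeight p H * p ^ k

end Hypergraphs

/-! ### SAT formulas -/

/-- Literals over `x_0, …, x_{n-1}`: `(i, true)` is `x_i` and `(i, false)` is `¬ x_i`. -/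
abbrev Literal (n : ℕ) := Fin n × Bool

/-- Negation of a literal. -/
def Literal.neg {n : ℕ} (l : Literal n) : Literal n := (l.1, !l.2)

/-- A formula in conjunctive normal form: a finite set of clauses, each a finite set of literals. -/
abbrev Formula (n : ℕ) := Finset (Finset (Literal n))

/-- The hypergraph on the `2n` literals whose edges are `{¬ l | l ∈ K}` for the clauses `K`. -/
def Formula.hypergraph {n : ℕ} (φ : Formula n) : HGraph (Literal n) :=
  φ.image fun K => K.image Literal.neg

/-- The assignment `α` satisfies `φ`: every clause has a true literal. -/
def Formula.SatisfiedBy {n : ℕ} (φ : Formula n) (α : Fin n → Bool) : Prop :=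
  ∀ K ∈ φ, ∃ l ∈ K, α l.1 = l.2

/-- The set `I_α` of the literals that are true under `α`. -/
def trueLiterals {n : ℕ} (α : Fin n → Bool) : Finset (Literal n) :=
  Finset.univ.filter fun l => α l.1 = l.2

/-- The binary entropy function, with logarithms to base `2`. -/
noncomputable def entropy (x : ℝ) : ℝ :=
  -x * Real.logb 2 x - (1 - x) * Real.logb 2 (1 - x)

/-! ### The model of computation

Algorithms are programs in a first-order functional language over binary trees, evaluated call by
value. A program is a finite list of function bodies, and function calls may be recursive. Trees
are immutable, so that they can be kept as pointers to shared cells, and for a fixed program every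
evaluation step is a bounded number of elementary steps of a random access machine.

A program may ask yes/no questions about the tree that it has just built; this is how the real
parameters of a problem, which are not finite objects, are made available to it. A question costs
the size of the tree that is asked about. -/

/-- Binary trees, the data that programs work on. -/
inductive Data : Type
  | nil : Data
  | node : Data → Data → Data

/-- The number of vertices of a tree. -/
def Data.size : Data → ℕ
  | .nil => 1
  | .node x y => x.size + y.size + 1

/-- Expressions; variables are positions in the environment. -/
inductive Expr : Type
  /-- the `i`-th entry of the environment -/
  | var (i : ℕ) : Expr
  /-- the tree `nil` -/
  | nil : Expr
  /-- build a node from two trees -/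
  | cons (a b : Expr) : Expr
  /-- if `e` is `nil` then `a`, and if `e` is a node then `b`, with the two subtrees of the node
  put in front of the environment -/
  | split (e a b : Expr) : Expr
  /-- `b`, with the value of `e` put in front of the environment -/
  | bind (e b : Expr) : Expr
  /-- call the `f`-th function of the program with argument `e` -/
  | call (f : ℕ) (e : Expr) : Expr
  /-- ask about the value of `e`; the answer is `node nil nil` for yes and `nil` for no -/
  | ask (e : Expr) : Expr

/-- A program: the finite list of its function bodies. Function `0` is the main function. -/
abbrev Program := List Expr

/-- `Eval O P env e v t`: in the program `P`, with questions answered according to `O`, the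
expression `e` evaluates in the environment `env` to the value `v`, and this takes `t` steps. -/
inductive Eval (O : Data → Prop) (P : Program) : List Data → Expr → Data → ℕ → Prop
  | var {env : List Data} {i : ℕ} {v : Data} (h : env[i]? = some v) :
      Eval O P env (.var i) v 1
  | nil {env : List Data} : Eval O P env .nil .nil 1
  | cons {env : List Data} {a b : Expr} {u v : Data} {s t : ℕ}
      (ha : Eval O P env a u s) (hb : Eval O P env b v t) :
      Eval O P env (.cons a b) (.node u v) (s + t + 1)
  | split_nil {env : List Data} {e a b : Expr} {v : Data} {s t : ℕ}
      (he : Eval O P env e .nil s) (ha : Eval O P env a v t) :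
      Eval O P env (.split e a b) v (s + t + 1)
  | split_node {env : List Data} {e a b : Expr} {x y v : Data} {s t : ℕ}
      (he : Eval O P env e (.node x y) s) (hb : Eval O P (x :: y :: env) b v t) :
      Eval O P env (.split e a b) v (s + t + 1)
  | bind {env : List Data} {e b : Expr} {u v : Data} {s t : ℕ}
      (he : Eval O P env e u s) (hb : Eval O P (u :: env) b v t) :
      Eval O P env (.bind e b) v (s + t + 1)
  | call {env : List Data} {f : ℕ} {e b : Expr} {u v : Data} {s t : ℕ}
      (hf : P[f]? = some b) (he : Eval O P env e u s) (hb : Eval O P [u] b v t) :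
      Eval O P env (.call f e) v (s + t + 1)
  | ask_yes {env : List Data} {e : Expr} {u : Data} {s : ℕ}
      (he : Eval O P env e u s) (hu : O u) :
      Eval O P env (.ask e) (.node .nil .nil) (s + u.size + 1)
  | ask_no {env : List Data} {e : Expr} {u : Data} {s : ℕ}
      (he : Eval O P env e u s) (hu : ¬ O u) :
      Eval O P env (.ask e) .nil (s + u.size + 1)

/-- On input `x`, the main function of the program `P` returns `y` after `t` steps. -/
def Program.Runs (O : Data → Prop) (P : Program) (x y : Data) (t : ℕ) : Prop :=
  ∃ main, P[0]? = some main ∧ Eval O P [x] main y t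

/-! ### Encodings -/

/-- Natural numbers are written in unary. -/
def encNat : ℕ → Data
  | 0 => .nil
  | m + 1 => .node .nil (encNat m)

/-- Truth values. -/
def encBool : Bool → Data
  | false => .nil
  | true => .node .nil .nil

/-- Lists. -/
def encList {A : Type*} (enc : A → Data) : List A → Data
  | [] => .nil
  | a :: l => .node (enc a) (encList enc l)

/-- A literal is written as its variable and its sign. -/
def encLiteral {n : ℕ} (l : Literal n) : Data := .node (encNat l.1) (encBool l.2)

/-- A family of sets of literals, written as a list of lists. -/
def encFamily {n : ℕ} (L : List (List (Literal n))) : Data := encList (encList encLiteral) L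

/-- The family of sets that is listed by `L`. -/
def familyOf {n : ℕ} (L : List (List (Literal n))) : Finset (Finset (Literal n)) :=
  (L.map List.toFinset).toFinset

/-- `L` writes down the formula `φ`: it lists every clause once, in some order, and in each clause
every literal once, in some order. -/
def Writes {n : ℕ} (L : List (List (Literal n))) (φ : Formula n) : Prop :=
  (∀ K ∈ L, K.Nodup) ∧ (L.map List.toFinset).Nodup ∧ familyOf L = φ

/-- The input of the algorithm: the number of variables, and the clauses. -/
def encInput {n : ℕ} (L : List (List (Literal n))) : Data := .node (encNat n) (encFamily L)

/-- The exact comparison of `p`-weights with multiples of `δ`: about the natural numbers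
`a_0, …, a_{m-1}` and `b`, written in unary, it tells whether `∑ s, a_s * p ^ s ≤ b * δ`. -/
def weightOracle (p δ : ℝ) (q : Data) : Prop :=
  ∃ (a : List ℕ) (b : ℕ), q = .node (encList encNat a) (encNat b) ∧
    ∑ s : Fin a.length, (a.get s : ℝ) * p ^ (s : ℕ) ≤ b * δ

end SatContainer

open SatContainer

/-! If `α` satisfies `φ`, every edge of the hypergraph contains the negation of a true literal, so
the set of true literals contains no edge. The theorem is therefore a container theorem for
independent sets `s`, made algorithmic: a deterministic procedure reconstructs a container of `s`
from a small fingerprint `S ⊆ s`, and the program runs it on every small set of literals.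

A pass scans the vertices and builds a list of derived sets. The vertex `v` is marked if the members
of the current list `Q` through `v`, whose other elements still have small derived degree, have mass
more than `W / l`. If `v` is also in `s`, these members with `v` removed join the derived list. No
derived set lies inside `s`, because only elements of `s` are removed. Afterwards marked vertices
outside `s` and vertices forming singletons of `Q` are discarded; neither step loses an element of
`s`. After `k - 1` passes all surviving derived sets are singletons, and these are discarded too.

Three estimates carry the analysis. Derived degrees stay below `M (t + 1) = W / (R * l t)`, because
a vertex stops receiving sets once it is saturated and one link contributes at most a codegree
divided by `p`, which is negligible for small `p` (`Controlled.of_pass`). Each selected marked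
vertex adds at least `W / (l t * p)` to the derived mass, which is at most `N * M (t + 1)`; so a
pass selects at most `p * N / R` vertices (`card_selected_pass_le`). Finally, if few vertices are
discarded, little mass survives: a set inside the container meets a selected marked vertex, meets a
saturated vertex, or lies in a light open link, and downward induction on the uniformity bounds the
number of saturated vertices (`mass_within_levels_lt`).

Hence a round of `k - 1` passes leaves little mass or discards a constant fraction of the vertices,
and `R` rounds suffice. The factor `R` in the degree bound pays for the number of rounds, so the
fingerprint has at most `(k - 1) * p * N` elements. Since `s` is consulted only at marked vertices,
the selected marked vertices determine the run (`rounds_congr`). This gives `exists_fingerprint`.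

The reals `p` and `δ` enter only through oracle questions. Instead of the total weight `w`, the
program uses an integer `b` with `w / 2 ≤ b * δ ≤ w`, found by search, and `W = b * δ / (2 * n)`. It
keeps a container only after checking that it has small weight and meets every complementary pair,
so those properties need no analysis; the size bound on containers follows from the degree bound
(`IsSpread.card_le`). The number of candidate fingerprints, and with it the running time up to a
polynomial factor, is bounded by the entropy estimate `numSubsets_le`. A small calculus of
polynomial-time functions shows that the work per candidate is polynomial. -/

namespace SatContainer

/-! ### Masses of lists of sets -/

section Mass

variable {α : Type*}

/-- The total weight of a list of sets, each set given by a list of its elements. -/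
def mass (μ : List α → ℝ) (Q : List (List α)) : ℝ := (Q.map μ).sum

variable {μ : List α → ℝ}

@[simp] theorem mass_nil : mass μ [] = 0 := rfl

@[simp] theorem mass_cons (A : List α) (Q : List (List α)) :
    mass μ (A :: Q) = μ A + mass μ Q := by
  simp [mass]

@[simp] theorem mass_append (Q Q' : List (List α)) : mass μ (Q ++ Q') = mass μ Q + mass μ Q' := by
  simp [mass]

theorem mass_nonneg (h0 : ∀ A, 0 ≤ μ A) (Q : List (List α)) : 0 ≤ mass μ Q := by
  induction Q with
  | nil => simp
  | cons A Q ih => rw [mass_cons]; exact add_nonneg (h0 A) ih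

theorem mass_filter_le (h0 : ∀ A, 0 ≤ μ A) {q q' : List α → Bool} {Q : List (List α)}
    (h : ∀ A ∈ Q, q A = true → q' A = true) : mass μ (Q.filter q) ≤ mass μ (Q.filter q') := by
  induction Q with
  | nil => simp
  | cons A Q ih =>
    have ih := ih fun B hB => h B (List.mem_cons_of_mem _ hB)
    have hA := h A List.mem_cons_self
    have := h0 A
    by_cases h1 : q A = true
    · simp [h1, hA h1, ih]
    · by_cases h2 : q' A = true
      · simp only [List.filter_cons, h1, h2, if_true, mass_cons]
        simp only [Bool.false_eq_true, if_false]
        linarith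
      · simp [h1, h2, ih]

theorem mass_le_of_suffix (h0 : ∀ A, 0 ≤ μ A) {Q Q' : List (List α)} (h : Q <:+ Q') :
    mass μ Q ≤ mass μ Q' := by
  obtain ⟨R, rfl⟩ := h
  rw [mass_append]
  linarith [mass_nonneg h0 R]

theorem sum_map_le_length_mul {X : List α} {f : α → ℝ} {c : ℝ} (h : ∀ u ∈ X, f u ≤ c) :
    (X.map f).sum ≤ X.length * c := by
  have := List.sum_le_card_nsmul (X.map f) c (by simpa using h)
  simpa using this

/-- Members of `Q` avoiding a property can be covered by the stars of some points. -/
theorem mass_filter_le_sum_through (h0 : ∀ A, 0 ≤ μ A) {X : List α} {q : List α → Bool}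
    {Q : List (List α)} (f : α → List α → Bool)
    (hQ : ∀ A ∈ Q, q A = true → ∃ u ∈ X, f u A = true) :
    mass μ (Q.filter q) ≤ (X.map fun u => mass μ (Q.filter (f u))).sum := by
  induction X generalizing q with
  | nil =>
    have : Q.filter q = [] := by
      rw [List.filter_eq_nil_iff]
      intro A hA h
      obtain ⟨u, hu, -⟩ := hQ A hA h
      simp at hu
    simp [this]
  | cons u X ih =>
    -- The members outside the star of `u` must be covered by the remaining points.
    have h1 := ih (q := fun A => q A && !f u A) (by
      intro A hA h
      simp only [Bool.and_eq_true, Bool.not_eq_true'] at h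
      obtain ⟨w, hw, hwA⟩ := hQ A hA h.1
      rcases List.mem_cons.1 hw with rfl | hw
      · simp [h.2] at hwA
      · exact ⟨w, hw, hwA⟩)
    have h2 : mass μ (Q.filter q)
        ≤ mass μ (Q.filter (f u)) + mass μ (Q.filter fun A => q A && !f u A) := by
      clear hQ h1 ih
      induction Q with
      | nil => simp
      | cons A Q ihQ =>
        have := h0 A
        by_cases h3 : q A = true <;> by_cases h4 : f u A = true <;>
          simp [h3, h4] <;> linarith
    simp only [List.map_cons, List.sum_cons]
    linarith

theorem mass_le_add_add (h0 : ∀ A, 0 ≤ μ A) {Q : List (List α)} {q₁ q₂ q₃ : List α → Bool}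
    (h : ∀ A ∈ Q, q₁ A = true ∨ q₂ A = true ∨ q₃ A = true) :
    mass μ Q ≤ mass μ (Q.filter q₁) + mass μ (Q.filter q₂) + mass μ (Q.filter q₃) := by
  induction Q with
  | nil => simp
  | cons A Q ih =>
    have ih := ih fun B hB => h B (List.mem_cons_of_mem _ hB)
    have hA := h A List.mem_cons_self
    have := h0 A
    by_cases h1 : q₁ A = true <;> by_cases h2 : q₂ A = true <;> by_cases h3 : q₃ A = true <;>
      simp [h1, h2, h3] at hA ⊢ <;> linarith

variable [DecidableEq α]

/-- The members of `Q` that contain `u`. -/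
def through (u : α) (Q : List (List α)) : List (List α) := Q.filter fun A => decide (u ∈ A)

/-- The members of `Q` that are contained in `C`. -/
def within (C : List α) (Q : List (List α)) : List (List α) :=
  Q.filter fun A => A.all fun u => decide (u ∈ C)

/-- The list `A` without `v`. -/
def remove (v : α) (A : List α) : List α := A.filter fun u => !decide (u = v)

theorem mem_through {u : α} {Q : List (List α)} {A : List α} :
    A ∈ through u Q ↔ A ∈ Q ∧ u ∈ A := by
  simp [through]

theorem mem_within {C : List α} {Q : List (List α)} {A : List α} :
    A ∈ within C Q ↔ A ∈ Q ∧ ∀ u ∈ A, u ∈ C := by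
  simp [within]

theorem mem_remove {u v : α} {A : List α} : u ∈ remove v A ↔ u ∈ A ∧ u ≠ v := by
  simp [remove]

theorem length_remove {v : α} {A : List α} (hA : A.Nodup) (hv : v ∈ A) :
    (remove v A).length + 1 = A.length := by
  have : remove v A = A.erase v := by
    rw [hA.erase_eq_filter]
    simp only [remove]
    congr 1
  rw [this, List.length_erase_of_mem hv]
  have := List.length_pos_of_mem hv
  omega

theorem through_suffix {Q Q' : List (List α)} (h : Q <:+ Q') (u : α) :
    through u Q <:+ through u Q' := h.filter _

@[simp] theorem through_append (u : α) (Q Q' : List (List α)) :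
    through u (Q ++ Q') = through u Q ++ through u Q' := by
  simp [through]

theorem mass_through_cons (u : α) (A : List α) (Q : List (List α)) :
    mass μ (through u (A :: Q)) = (if u ∈ A then μ A else 0) + mass μ (through u Q) := by
  by_cases h : u ∈ A <;> simp [through, h]

/-- Double counting of incident pairs. -/
theorem sum_mass_through_cons (X A : List α) (Q : List (List α)) :
    (X.map fun u => mass μ (through u (A :: Q))).sum
      = (X.countP fun u => decide (u ∈ A)) * μ A + (X.map fun u => mass μ (through u Q)).sum := by
  induction X with
  | nil => simp
  | cons u X ih =>
    rw [List.map_cons, List.sum_cons, ih, mass_through_cons]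
    by_cases h : u ∈ A <;> simp [h] <;> ring

theorem countP_mem_le {X A : List α} (hX : X.Nodup) :
    (X.countP fun u => decide (u ∈ A)) ≤ A.length := by
  rw [List.countP_eq_length_filter]
  refine (List.subperm_of_subset (hX.filter _) ?_).length_le
  intro u hu
  simpa using (List.mem_filter.1 hu).2

/-- In the sum over stars a member `A` is counted once for each of its elements in `X`, hence at
most `k` times. -/
theorem sum_mass_through_le (h0 : ∀ A, 0 ≤ μ A) {k : ℕ} {X : List α} (hX : X.Nodup)
    {Q : List (List α)} (hQ : ∀ A ∈ Q, A.length ≤ k) :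
    (X.map fun u => mass μ (through u Q)).sum ≤ k * mass μ Q := by
  induction Q with
  | nil => simp [through]
  | cons A Q ih =>
    rw [sum_mass_through_cons, mass_cons, mul_add]
    have h1 : ((X.countP fun u => decide (u ∈ A) : ℕ) : ℝ) ≤ k := by
      exact_mod_cast (countP_mem_le hX).trans (hQ A List.mem_cons_self)
    exact add_le_add (mul_le_mul_of_nonneg_right h1 (h0 A))
      (ih fun B hB => hQ B (List.mem_cons_of_mem _ hB))

/-- Every member is counted at least once in the sum over stars. -/
theorem mass_le_sum_through (h0 : ∀ A, 0 ≤ μ A) {X : List α} {Q : List (List α)}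
    (hQ : ∀ A ∈ Q, ∃ u ∈ A, u ∈ X) :
    mass μ Q ≤ (X.map fun u => mass μ (through u Q)).sum := by
  induction Q with
  | nil => simp [through]
  | cons A Q ih =>
    rw [sum_mass_through_cons, mass_cons]
    have h1 : (1 : ℝ) ≤ (X.countP fun u => decide (u ∈ A) : ℕ) := by
      obtain ⟨u, hu, huX⟩ := hQ A List.mem_cons_self
      have : 0 < X.countP fun u => decide (u ∈ A) :=
        List.countP_pos_iff.2 ⟨u, huX, by simpa using hu⟩
      exact_mod_cast this
    have := ih fun B hB => hQ B (List.mem_cons_of_mem _ hB)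
    nlinarith [h0 A]

end Mass

/-! ### The container algorithm -/

section Algorithm

variable {α : Type*} [DecidableEq α]

/-- The members of `Q` through `v` whose other elements all satisfy `calm`. -/
def openLink (calm : α → Bool) (v : α) (Q : List (List α)) : List (List α) :=
  Q.filter fun A => decide (v ∈ A) && A.all fun u => decide (u = v) || calm u

/-- One step of a pass: `v` is marked if it has a heavy open link, and if it is moreover selected,
then its open link is added to the list of derived sets. -/
def passStep (light : ℕ → List (List α) → Bool) (s : α → Bool) (l r : ℕ) (Q : List (List α))
    (v : α) (acc : List α × List (List α)) : List α × List (List α) :=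
  if light l (openLink (fun u => light r (through u acc.2)) v Q) then acc
  else (v :: acc.1,
    if s v then
      (openLink (fun u => light r (through u acc.2)) v Q).map (remove v) ++ acc.2
    else acc.2)

/-- A pass through the vertices `X`; it returns the marked vertices and the derived sets. -/
def pass (light : ℕ → List (List α) → Bool) (s : α → Bool) (l r : ℕ) (Q : List (List α))
    (X : List α) : List α × List (List α) :=
  X.foldr (passStep light s l r Q) ([], [])

/-- The vertices of `X` that survive a pass with marked vertices `M`. -/
def survivors (s : α → Bool) (Q : List (List α)) (M X : List α) : List α :=
  X.filter fun u => !decide ([u] ∈ Q) && (s u || !decide (u ∈ M))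

/-- Successive passes, with thresholds `l t` and `2 * R * l t`. -/
def levels (light : ℕ → List (List α) → Bool) (s : α → Bool) (l : ℕ → ℕ) (R : ℕ) :
    ℕ → ℕ → List (List α) → List α → List α
  | 0, _, Q, X => X.filter fun u => !decide ([u] ∈ Q)
  | j + 1, t, Q, X =>
    levels light s l R j (t + 1) (pass light s (l t) (2 * R * l t) Q X).2
      (survivors s Q (pass light s (l t) (2 * R * l t) Q X).1 X)

/-- The vertices that are marked in the course of `levels`. -/
def levelMarks (light : ℕ → List (List α) → Bool) (s : α → Bool) (l : ℕ → ℕ) (R : ℕ) :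
    ℕ → ℕ → List (List α) → List α → List α
  | 0, _, _, _ => []
  | j + 1, t, Q, X =>
    (pass light s (l t) (2 * R * l t) Q X).1 ++
    levelMarks light s l R j (t + 1) (pass light s (l t) (2 * R * l t) Q X).2
      (survivors s Q (pass light s (l t) (2 * R * l t) Q X).1 X)

/-- Successive applications of `levels` to the sets of `H` within the current container. -/
def rounds (light : ℕ → List (List α) → Bool) (s : α → Bool) (l : ℕ → ℕ) (R j : ℕ)
    (H : List (List α)) : ℕ → List α → List α
  | 0, X => X
  | i + 1, X => rounds light s l R j H i (levels light s l R j 0 (within X H) X)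

/-- The vertices that are marked in the course of `rounds`. -/
def roundMarks (light : ℕ → List (List α) → Bool) (s : α → Bool) (l : ℕ → ℕ) (R j : ℕ)
    (H : List (List α)) : ℕ → List α → List α
  | 0, _ => []
  | i + 1, X => levelMarks light s l R j 0 (within X H) X ++
      roundMarks light s l R j H i (levels light s l R j 0 (within X H) X)

/-! ### Dependence of a run on the selection -/

variable {light : ℕ → List (List α) → Bool} {s s' : α → Bool} {l r : ℕ} {Q : List (List α)}

theorem pass_cons (v : α) (X : List α) :
    pass light s l r Q (v :: X) = passStep light s l r Q v (pass light s l r Q X) := rfl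

theorem pass_fst_sublist (X : List α) : (pass light s l r Q X).1.Sublist X := by
  induction X with
  | nil => simp [pass]
  | cons v X ih =>
    rw [pass_cons, passStep]
    split
    · exact ih.cons v
    · exact ih.cons_cons v

/-- Whether a vertex is marked depends only on the sets derived so far, and the selection is
consulted only once the vertex has been marked. This is why the selected marked vertices alone
suffice to repeat the run. -/
theorem pass_congr {X : List α} (h : ∀ v ∈ (pass light s l r Q X).1, s v = s' v) :
    pass light s' l r Q X = pass light s l r Q X := by
  induction X with
  | nil => rfl
  | cons v X ih =>
    rw [pass_cons] at h
    rw [pass_cons, pass_cons]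
    have hX : pass light s' l r Q X = pass light s l r Q X := by
      apply ih
      intro w hw
      apply h
      rw [passStep]
      split
      · exact hw
      · exact List.mem_cons_of_mem _ hw
    rw [hX, passStep, passStep]
    rw [passStep] at h
    split
    · rfl
    · rename_i hl
      rw [if_neg hl] at h
      rw [h v List.mem_cons_self]

theorem levels_congr {l : ℕ → ℕ} {R : ℕ} (j t : ℕ) (Q : List (List α)) (X : List α)
    (h : ∀ v ∈ levelMarks light s l R j t Q X, s v = s' v) :
    levels light s' l R j t Q X = levels light s l R j t Q X ∧
      levelMarks light s' l R j t Q X = levelMarks light s l R j t Q X := by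
  induction j generalizing t Q X with
  | zero => exact ⟨rfl, rfl⟩
  | succ j ih =>
    rw [levelMarks] at h
    have hp : pass light s' (l t) (2 * R * l t) Q X = pass light s (l t) (2 * R * l t) Q X :=
      pass_congr fun v hv => h v (List.mem_append_left _ hv)
    have hs : survivors s' Q (pass light s (l t) (2 * R * l t) Q X).1 X
        = survivors s Q (pass light s (l t) (2 * R * l t) Q X).1 X := by
      apply List.filter_congr
      intro u _
      -- For an unmarked vertex the survival test does not depend on the selection.
      by_cases hu : u ∈ (pass light s (l t) (2 * R * l t) Q X).1
      · rw [h u (List.mem_append_left _ hu)]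
      · simp [hu]
    have := ih (t + 1) _ _ fun v hv => h v (List.mem_append_right _ hv)
    simp only [levels, levelMarks, hp, hs, this, and_self]

theorem rounds_congr {l : ℕ → ℕ} {R j : ℕ} {H : List (List α)} (i : ℕ) (X : List α)
    (h : ∀ v ∈ roundMarks light s l R j H i X, s v = s' v) :
    rounds light s' l R j H i X = rounds light s l R j H i X := by
  induction i generalizing X with
  | zero => rfl
  | succ i ih =>
    rw [roundMarks] at h
    have h1 := levels_congr _ _ _ _ fun v hv => h v (List.mem_append_left _ hv)
    rw [rounds, rounds, h1.1]
    exact ih _ fun v hv => h v (List.mem_append_right _ hv)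

theorem levels_sublist {l : ℕ → ℕ} {R : ℕ} (j t : ℕ) (Q : List (List α)) (X : List α) :
    (levels light s l R j t Q X).Sublist X := by
  induction j generalizing t Q X with
  | zero => exact List.filter_sublist
  | succ j ih => exact (ih _ _ _).trans List.filter_sublist

theorem rounds_sublist {l : ℕ → ℕ} {R j : ℕ} {H : List (List α)} (i : ℕ) (X : List α) :
    (rounds light s l R j H i X).Sublist X := by
  induction i generalizing X with
  | zero => exact List.Sublist.refl _
  | succ i ih => exact (ih _).trans (levels_sublist _ _ _ _)

theorem levelMarks_subset {l : ℕ → ℕ} {R : ℕ} (j t : ℕ) (Q : List (List α)) (X : List α) :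
    levelMarks light s l R j t Q X ⊆ X := by
  induction j generalizing t Q X with
  | zero => simp [levelMarks]
  | succ j ih =>
    rw [levelMarks]
    exact List.append_subset.2 ⟨(pass_fst_sublist X).subset,
      List.Subset.trans (ih _ _ _) List.filter_sublist.subset⟩

theorem roundMarks_subset {l : ℕ → ℕ} {R j : ℕ} {H : List (List α)} (i : ℕ) (X : List α) :
    roundMarks light s l R j H i X ⊆ X := by
  induction i generalizing X with
  | zero => simp [roundMarks]
  | succ i ih =>
    rw [roundMarks]
    exact List.append_subset.2 ⟨levelMarks_subset _ _ _ _,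
      List.Subset.trans (ih _) (levels_sublist _ _ _ _).subset⟩

end Algorithm

/-! ### Analysis of a single pass -/

section Pass

variable {α : Type*} [DecidableEq α] {light : ℕ → List (List α) → Bool} {s : α → Bool} {l r k : ℕ}
  {Q : List (List α)} {μ : List α → ℝ} {p W : ℝ}

theorem mem_openLink {calm : α → Bool} {v : α} {A : List α} :
    A ∈ openLink calm v Q ↔ A ∈ Q ∧ v ∈ A ∧ ∀ u ∈ A, u ≠ v → calm u = true := by
  simp only [openLink, List.mem_filter, Bool.and_eq_true, decide_eq_true_eq, List.all_eq_true,
    Bool.or_eq_true]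
  refine and_congr_right fun _ => and_congr_right fun _ => forall₂_congr fun u _ => ?_
  tauto

/-- Lists count repetitions, so sets that arise in several ways are not merged and no injectivity of
`remove v` is needed. -/
theorem mass_map_remove (hμ : ∀ (A : List α) (v : α), A.Nodup → A.length ≤ k → v ∈ A →
      p * μ (remove v A) = μ A) {v : α} {F : List (List α)}
    (hF : ∀ A ∈ F, A.Nodup ∧ A.length ≤ k ∧ v ∈ A) :
    p * mass μ (F.map (remove v)) = mass μ F := by
  induction F with
  | nil => simp
  | cons A F ih =>
    obtain ⟨h1, h2, h3⟩ := hF A List.mem_cons_self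
    rw [List.map_cons, mass_cons, mass_cons, mul_add, hμ A v h1 h2 h3,
      ih fun B hB => hF B (List.mem_cons_of_mem _ hB)]

theorem passStep_suffix (v : α) (acc : List α × List (List α)) :
    acc.2 <:+ (passStep light s l r Q v acc).2 := by
  rw [passStep]
  split
  · exact List.suffix_refl _
  · split
    · exact List.suffix_append _ _
    · exact List.suffix_refl _

theorem mem_pass_snd {X : List α} {B : List α} (hB : B ∈ (pass light s l r Q X).2) :
    ∃ A ∈ Q, ∃ v ∈ X, s v = true ∧ v ∈ A ∧ B = remove v A := by
  induction X with
  | nil => simp [pass] at hB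
  | cons v X ih =>
    have key : B ∈ (pass light s l r Q X).2 →
        ∃ A ∈ Q, ∃ w ∈ v :: X, s w = true ∧ w ∈ A ∧ B = remove w A := by
      intro h
      obtain ⟨A, hA, w, hw, h⟩ := ih h
      exact ⟨A, hA, w, List.mem_cons_of_mem _ hw, h⟩
    rw [pass_cons, passStep] at hB
    split at hB
    · exact key hB
    · split at hB
      · rename_i hv
        rcases List.mem_append.1 hB with hB | hB
        · obtain ⟨A, hA, rfl⟩ := List.mem_map.1 hB
          rw [mem_openLink] at hA
          exact ⟨A, hA.1, v, List.mem_cons_self, hv, hA.2.1, rfl⟩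
        · exact key hB
      · exact key hB

theorem through_map_remove {u v : α} {F : List (List α)} :
    through u (F.map (remove v)) = (F.filter fun A => decide (u ∈ remove v A)).map (remove v) := by
  rw [through, List.filter_map]
  rfl

/-- A vertex enters a new link only while it is calm, that is, while its derived degree is at most
`W / r`. One link raises the degree by at most the codegree bound divided by `p`, so this is the
only possible overshoot. -/
theorem mass_through_pass_le (h0 : ∀ A, 0 ≤ μ A) (hp : 0 < p)
    (hμ : ∀ (A : List α) (v : α), A.Nodup → A.length ≤ k → v ∈ A → p * μ (remove v A) = μ A)
    (hlight : ∀ c L, light c L = true ↔ c * mass μ L ≤ W) (hW : 0 ≤ W)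
    (hQ : ∀ A ∈ Q, A.Nodup ∧ A.length ≤ k) {Γ : ℝ} (hΓ : 0 ≤ Γ)
    (hco : ∀ u v, u ≠ v → mass μ (through u (through v Q)) ≤ Γ) (X : List α) (u : α) :
    r * mass μ (through u (pass light s l r Q X).2) ≤ W + r * (Γ / p) := by
  have hr : (0 : ℝ) ≤ r * (Γ / p) := by positivity
  induction X with
  | nil =>
    simp only [pass, List.foldr_nil, through, List.filter_nil, mass_nil]
    linarith
  | cons v X ih =>
    rw [pass_cons, passStep]
    split
    · exact ih
    · split
      · set acc := pass light s l r Q X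
        set F := openLink (fun u => light r (through u acc.2)) v Q with hF
        simp only [through_append, mass_append]
        -- Either the new link contains `u`, and then a member of it testifies that `u` was calm
        -- before this step, or the degree of `u` does not change.
        by_cases hu : ∃ A ∈ F, u ∈ remove v A
        · obtain ⟨A, hA, huA⟩ := hu
          rw [mem_remove] at huA
          have hcalm := (mem_openLink.1 hA).2.2 u huA.1 huA.2
          rw [hlight] at hcalm
          have h1 : p * mass μ (through u (F.map (remove v))) ≤ Γ := by
            rw [through_map_remove, mass_map_remove hμ]
            · refine le_trans ?_ (hco u v huA.2)
              have : through u (through v Q)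
                  = Q.filter fun A => decide (u ∈ A) && decide (v ∈ A) := by
                rw [through, through, List.filter_filter]
              rw [this, hF, openLink, List.filter_filter]
              apply mass_filter_le h0
              intro B _ hB
              simp only [Bool.and_eq_true, decide_eq_true_eq, mem_remove] at hB ⊢
              exact ⟨hB.1.1, hB.2.1⟩
            · intro B hB
              have hB := List.mem_of_mem_filter hB
              rw [mem_openLink] at hB
              exact ⟨(hQ B hB.1).1, (hQ B hB.1).2, hB.2.1⟩
          have h2 : mass μ (through u (F.map (remove v))) ≤ Γ / p := by
            rw [le_div_iff₀ hp]; linarith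
          have : (r : ℝ) * mass μ (through u (F.map (remove v))) ≤ r * (Γ / p) :=
            mul_le_mul_of_nonneg_left h2 (Nat.cast_nonneg r)
          rw [mul_add]
          linarith
        · have : through u (F.map (remove v)) = [] := by
            rw [through, List.filter_eq_nil_iff]
            intro B hB huB
            obtain ⟨A, hA, rfl⟩ := List.mem_map.1 hB
            exact hu ⟨A, hA, by simpa using huB⟩
          rw [this, mass_nil, zero_add]
          exact ih
      · exact ih

/-- A derived set through `u` and `w` comes from a member of `Q` through both. Such a member is used
at most once for each of its at most `k` elements, and removing an element divides the weight by
`p`; so codegrees grow at most by the factor `k / p`. -/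
theorem mass_through_through_pass_le (h0 : ∀ A, 0 ≤ μ A)
    (hμ : ∀ (A : List α) (v : α), A.Nodup → A.length ≤ k → v ∈ A → p * μ (remove v A) = μ A)
    (hQ : ∀ A ∈ Q, A.Nodup ∧ A.length ≤ k) {X : List α} (hX : X.Nodup) (u w : α) :
    p * mass μ (through u (through w (pass light s l r Q X).2))
      ≤ k * mass μ (through u (through w Q)) := by
  refine le_trans ?_ (sum_mass_through_le h0 hX (Q := through u (through w Q)) (k := k) ?_)
  · clear hX
    induction X with
    | nil => simp [pass, through]
    | cons v X ih =>
      have hpos := mass_nonneg h0 (through v (through u (through w Q)))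
      rw [pass_cons, passStep]
      simp only [List.map_cons, List.sum_cons]
      split
      · linarith
      · split
        · set acc := pass light s l r Q X
          set F := openLink (fun u => light r (through u acc.2)) v Q with hF
          simp only [through_append, mass_append]
          have h1 : p * mass μ (through u (through w (F.map (remove v))))
              ≤ mass μ (through v (through u (through w Q))) := by
            have h2 : through u (through w (F.map (remove v)))
                = (F.filter fun A => decide (u ∈ remove v A) && decide (w ∈ remove v A)).map
                  (remove v) := by
              rw [through, through, List.filter_filter, List.filter_map]
              rfl
            rw [h2, mass_map_remove hμ]
            · have : through v (through u (through w Q))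
                  = Q.filter fun A => decide (v ∈ A) && (decide (u ∈ A) && decide (w ∈ A)) := by
                rw [through, through, through, List.filter_filter, List.filter_filter]
                simp only [Bool.and_assoc]
              rw [this, hF, openLink, List.filter_filter]
              apply mass_filter_le h0
              intro B _ hB
              simp only [Bool.and_eq_true, decide_eq_true_eq, mem_remove] at hB ⊢
              exact ⟨hB.2.1, hB.1.1.1, hB.1.2.1⟩
            · intro B hB
              have hB := List.mem_of_mem_filter hB
              rw [mem_openLink] at hB
              exact ⟨(hQ B hB.1).1, (hQ B hB.1).2, hB.2.1⟩
          rw [mul_add]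
          linarith
        · linarith
  · intro A hA
    rw [mem_through, mem_through] at hA
    exact (hQ A hA.1.1).2

/-- Every marked and selected vertex contributes to the mass of the derived sets. -/
theorem card_selected_le
    (hμ : ∀ (A : List α) (v : α), A.Nodup → A.length ≤ k → v ∈ A → p * μ (remove v A) = μ A)
    (hlight : ∀ c L, light c L = true ↔ c * mass μ L ≤ W)
    (hQ : ∀ A ∈ Q, A.Nodup ∧ A.length ≤ k) (X : List α) :
    (((pass light s l r Q X).1.filter s).length : ℝ) * W
      ≤ l * (p * mass μ (pass light s l r Q X).2) := by
  induction X with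
  | nil => simp [pass]
  | cons v X ih =>
    rw [pass_cons, passStep]
    split
    · exact ih
    · rename_i hl
      split
      · rename_i hv
        -- Being marked means that the open link has mass more than `W / l`; removing `v` turns this
        -- into the same amount of `p` times the derived mass.
        rw [hlight, not_le] at hl
        simp only [List.filter_cons, hv, if_true, List.length_cons, mass_append]
        rw [mul_add p, mass_map_remove hμ]
        · push_cast
          rw [add_mul, mul_add]
          linarith
        · intro B hB
          rw [mem_openLink] at hB
          exact ⟨(hQ B hB.1).1, (hQ B hB.1).2, hB.2.1⟩
      · rename_i hv
        simpa [List.filter_cons, hv] using ih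

/-- The open link of an unmarked vertex is light, even if it is computed with respect to all the
derived sets. -/
theorem light_of_unmarked (h0 : ∀ A, 0 ≤ μ A)
    (hlight : ∀ c L, light c L = true ↔ c * mass μ L ≤ W) {X : List α} {v : α} (hv : v ∈ X)
    (hv' : v ∉ (pass light s l r Q X).1) :
    l * mass μ (openLink (fun u => light r (through u (pass light s l r Q X).2)) v Q) ≤ W := by
  -- Derived sets only accumulate, so fewer vertices are calm later and open links shrink. The test
  -- made when `v` was scanned thus also bounds the final open link.
  have mono : ∀ {L L' : List (List α)}, L <:+ L' → ∀ v,
      mass μ (openLink (fun u => light r (through u L')) v Q)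
        ≤ mass μ (openLink (fun u => light r (through u L)) v Q) := by
    intro L L' h v
    apply mass_filter_le h0
    intro A _ hA
    simp only [Bool.and_eq_true, decide_eq_true_eq, List.all_eq_true, Bool.or_eq_true] at hA ⊢
    refine ⟨hA.1, fun u hu => (hA.2 u hu).imp_right fun h1 => ?_⟩
    rw [hlight] at h1 ⊢
    refine le_trans (mul_le_mul_of_nonneg_left ?_ (Nat.cast_nonneg r)) h1
    exact mass_le_of_suffix h0 (through_suffix h u)
  induction X with
  | nil => simp at hv
  | cons w X ih =>
    have hsuf := passStep_suffix (light := light) (s := s) (l := l) (r := r) (Q := Q) w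
      (pass light s l r Q X)
    rw [← pass_cons] at hsuf
    refine le_trans (mul_le_mul_of_nonneg_left (mono hsuf v) (Nat.cast_nonneg l)) ?_
    rw [pass_cons, passStep] at hv'
    split at hv'
    · rename_i hl
      rcases List.mem_cons.1 hv with rfl | hv
      · exact (hlight _ _).1 hl
      · exact ih hv hv'
    · rcases List.mem_cons.1 hv with rfl | hv
      · exact absurd List.mem_cons_self hv'
      · exact ih hv fun h => hv' (List.mem_cons_of_mem _ h)

/-- The counting that drives the analysis: if the derived sets have little mass within `C`, then
`Q` has little mass within `C`. -/
theorem mass_within_le (h0 : ∀ A, 0 ≤ μ A)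
    (hlight : ∀ c L, light c L = true ↔ c * mass μ L ≤ W) (hW : 0 ≤ W) {X C : List α}
    (hCX : C ⊆ X) {M : ℝ} (hM : ∀ u, mass μ (through u Q) ≤ M) (hne : ∀ A ∈ Q, A ≠ [])
    (hC : ∀ v ∈ C, v ∈ (pass light s l r Q X).1 → s v = true) :
    l * mass μ (within C Q) ≤ X.length * W
      + l * (((pass light s l r Q X).1.filter s).length * M)
      + l * ((C.filter fun u => !light r (through u (pass light s l r Q X).2)).length * M) := by
  set P := pass light s l r Q X with hP
  have hl : (0 : ℝ) ≤ l := Nat.cast_nonneg l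
  -- members of `Q` within `C` through one of the selected or saturated vertices
  have h1 : mass μ ((within C Q).filter fun A => decide (∃ u ∈ A, u ∈ P.1.filter s))
      ≤ (P.1.filter s).length * M := by
    refine le_trans (mass_filter_le_sum_through h0 (X := P.1.filter s)
      (fun u A => decide (u ∈ A)) ?_) ?_
    · intro A _ hA
      obtain ⟨u, hu, hu'⟩ := of_decide_eq_true hA
      exact ⟨u, hu', by simpa using hu⟩
    · refine sum_map_le_length_mul fun u _ => le_trans ?_ (hM u)
      rw [within, List.filter_filter]
      exact mass_filter_le h0 fun A _ hA => by
        rw [Bool.and_eq_true] at hA; exact hA.1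
  have h2 : mass μ ((within C Q).filter fun A =>
        decide (∃ u ∈ A, u ∈ C.filter fun u => !light r (through u P.2)))
      ≤ (C.filter fun u => !light r (through u P.2)).length * M := by
    refine le_trans (mass_filter_le_sum_through h0
      (X := C.filter fun u => !light r (through u P.2)) (fun u A => decide (u ∈ A)) ?_) ?_
    · intro A _ hA
      obtain ⟨u, hu, hu'⟩ := of_decide_eq_true hA
      exact ⟨u, hu', by simpa using hu⟩
    · refine sum_map_le_length_mul fun u _ => le_trans ?_ (hM u)
      rw [within, List.filter_filter]
      exact mass_filter_le h0 fun A _ hA => by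
        rw [Bool.and_eq_true] at hA; exact hA.1
  -- the others lie in open links of unmarked vertices
  have h3 : l * mass μ ((within C Q).filter fun A => decide (∃ v ∈ X, v ∉ P.1 ∧
      A ∈ openLink (fun u => light r (through u P.2)) v Q)) ≤ X.length * W := by
    have h4 : mass μ ((within C Q).filter fun A => decide (∃ v ∈ X, v ∉ P.1 ∧
        A ∈ openLink (fun u => light r (through u P.2)) v Q))
        ≤ ((X.filter fun v => decide (v ∉ P.1)).map fun v => mass μ ((within C Q).filter fun A =>
          decide (v ∈ A) && A.all fun u => decide (u = v) || light r (through u P.2))).sum := by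
      refine mass_filter_le_sum_through h0 (fun v A =>
        decide (v ∈ A) && A.all fun u => decide (u = v) || light r (through u P.2)) ?_
      intro A _ hA
      obtain ⟨v, hv, hv', hA⟩ := of_decide_eq_true hA
      exact ⟨v, by simp [hv, hv'], (List.mem_filter.1 hA).2⟩
    refine le_trans (mul_le_mul_of_nonneg_left h4 hl) ?_
    rw [← List.sum_map_mul_left]
    refine le_trans (sum_map_le_length_mul (c := W) fun v hv => ?_) ?_
    · rw [List.mem_filter, decide_eq_true_eq] at hv
      refine le_trans (mul_le_mul_of_nonneg_left ?_ hl) (light_of_unmarked h0 hlight hv.1 hv.2)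
      rw [within, List.filter_filter]
      exact mass_filter_le h0 fun A _ hA => by
        rw [Bool.and_eq_true] at hA; exact hA.1
    · refine mul_le_mul_of_nonneg_right ?_ hW
      exact_mod_cast List.length_filter_le _ _
  have h4 := mass_le_add_add h0 (Q := within C Q)
    (q₁ := fun A => decide (∃ u ∈ A, u ∈ P.1.filter s))
    (q₂ := fun A => decide (∃ u ∈ A, u ∈ C.filter fun u => !light r (through u P.2)))
    (q₃ := fun A => decide (∃ v ∈ X, v ∉ P.1 ∧
        A ∈ openLink (fun u => light r (through u P.2)) v Q)) (by
      intro A hA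
      rw [mem_within] at hA
      simp only [decide_eq_true_eq]
      -- A member within `C` that avoids the selected marked and the saturated vertices has an
      -- element `v`. It is unmarked, since marked vertices of `C` are selected, and all other
      -- elements are calm; so the member lies in the open link of `v`.
      by_contra! hcon
      obtain ⟨v, hv⟩ := List.exists_mem_of_ne_nil A (hne A hA.1)
      have hvC := hA.2 v hv
      have hvP : v ∉ P.1 := fun h => hcon.1 v hv (List.mem_filter.2 ⟨h, hC v hvC h⟩)
      refine hcon.2.2 v (hCX hvC) hvP (mem_openLink.2 ⟨hA.1, hv, fun u hu _ => ?_⟩)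
      by_contra h
      exact hcon.2.1 u hu (List.mem_filter.2 ⟨hA.2 u hu, by simpa using h⟩))
  have h5 := mul_le_mul_of_nonneg_left h1 hl
  have h6 := mul_le_mul_of_nonneg_left h2 hl
  have h7 := mul_le_mul_of_nonneg_left h4 hl
  rw [mul_add, mul_add] at h7
  linarith

end Pass

/-! ### Analysis of the algorithm -/

section Rounds

variable {α : Type*} [DecidableEq α] {light : ℕ → List (List α) → Bool} {s : α → Bool}
  {k R : ℕ} {l : ℕ → ℕ} {μ : List α → ℝ} {p W G N : ℝ} {M : ℕ → ℝ} {ρ : ℕ → ℕ} {X₀ : List α}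

/-- The assumptions on weights, thresholds and degree bounds under which the algorithm works. -/
structure Calibrated (light : ℕ → List (List α) → Bool) (k R : ℕ) (l : ℕ → ℕ) (μ : List α → ℝ)
    (p W G N : ℝ) (M : ℕ → ℝ) (ρ : ℕ → ℕ) : Prop where
  nonneg : ∀ A, 0 ≤ μ A
  pos : 0 < p
  remove : ∀ (A : List α) (v : α), A.Nodup → A.length ≤ k → v ∈ A → p * μ (remove v A) = μ A
  light_iff : ∀ c L, light c L = true ↔ c * mass μ L ≤ W
  W_pos : 0 < W
  G_nonneg : 0 ≤ G
  N_pos : 0 < N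
  k_pos : 0 < k
  R_pos : 0 < R
  l_pos : ∀ t, 0 < l t
  M_pos : ∀ t, 0 < M t
  -- The degree bound is `W / (R * l t)`: the factor `R` later compensates for the number of rounds.
  -- The next condition keeps the overshoot caused by a single link below the calm threshold.
  M_succ : ∀ t, M (t + 1) * (R * l t) = W
  small : ∀ t, t + 2 ≤ k → (2 * R * l t : ℝ) * ((k / p) ^ t * G / p) ≤ W
  ρ_pos : ∀ t, 0 < ρ t
  ρ_succ : ∀ t, ρ (t + 1) = 8 * k * ρ t
  -- This and the next condition limit the light links and the stars of selected marked vertices to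
  -- a quarter each of the mass allowed at level `t`.
  threshold : ∀ t, 4 * ρ t * W ≤ l t * M t
  few : ∀ t, t ≤ k → 4 * p * ρ t ≤ R

/-- Sets derived from sets that are not contained in `s` by removing `t` elements of `s`, with
bounded degrees and codegrees. -/
structure Controlled (s : α → Bool) (k : ℕ) (μ : List α → ℝ) (p G : ℝ) (M : ℕ → ℝ) (X₀ : List α)
    (t : ℕ) (Q : List (List α)) : Prop where
  nodup : ∀ A ∈ Q, A.Nodup
  length : ∀ A ∈ Q, A.length + t ≤ k
  subset : ∀ A ∈ Q, ∀ u ∈ A, u ∈ X₀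
  not_subset : ∀ A ∈ Q, ∃ u ∈ A, s u = false
  degree : ∀ u, mass μ (through u Q) ≤ M t
  codegree : ∀ u v, u ≠ v → mass μ (through u (through v Q)) ≤ (k / p) ^ t * G

theorem Controlled.bounded {t : ℕ} {Q : List (List α)} (hQ : Controlled s k μ p G M X₀ t Q) :
    ∀ A ∈ Q, A.Nodup ∧ A.length ≤ k :=
  fun A hA => ⟨hQ.nodup A hA, by have := hQ.length A hA; omega⟩

/-- With `r = 2 * R * l t`, calm degrees and the overshoot each account for at most `W / r`, and
together for `2 * W / r = M (t + 1)`. Only elements of `s` are removed, so an element outside `s`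
remains in every derived set. -/
theorem Controlled.of_pass (hc : Calibrated light k R l μ p W G N M ρ) {t : ℕ}
    {Q : List (List α)} (hQ : Controlled s k μ p G M X₀ t Q) (ht : t + 2 ≤ k) {X : List α}
    (hX : X.Nodup) :
    Controlled s k μ p G M X₀ (t + 1) (pass light s (l t) (2 * R * l t) Q X).2 := by
  have hp := hc.pos
  have hG := hc.G_nonneg
  refine ⟨?_, ?_, ?_, ?_, ?_, ?_⟩
  · intro B hB
    obtain ⟨A, hA, v, -, -, -, rfl⟩ := mem_pass_snd hB
    exact (hQ.nodup A hA).filter _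
  · intro B hB
    obtain ⟨A, hA, v, -, -, hv, rfl⟩ := mem_pass_snd hB
    have := length_remove (hQ.nodup A hA) hv
    have := hQ.length A hA
    omega
  · intro B hB u hu
    obtain ⟨A, hA, v, -, -, hv, rfl⟩ := mem_pass_snd hB
    exact hQ.subset A hA u (mem_remove.1 hu).1
  · intro B hB
    obtain ⟨A, hA, v, -, hsv, hv, rfl⟩ := mem_pass_snd hB
    obtain ⟨u, hu, hsu⟩ := hQ.not_subset A hA
    refine ⟨u, mem_remove.2 ⟨hu, ?_⟩, hsu⟩
    rintro rfl
    simp [hsv] at hsu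
  · intro u
    have h1 := mass_through_pass_le (s := s) (l := l t) (r := 2 * R * l t) hc.nonneg hp hc.remove
      hc.light_iff hc.W_pos.le hQ.bounded (by positivity) hQ.codegree X u
    have h2 := hc.small t ht
    have h3 := hc.M_succ t
    have hR : (0 : ℝ) < R := by exact_mod_cast hc.R_pos
    have hl : (0 : ℝ) < l t := by exact_mod_cast hc.l_pos t
    push_cast at h1
    have h4 : (2 * R * l t : ℝ) * mass μ (through u (pass light s (l t) (2 * R * l t) Q X).2)
        ≤ (2 * R * l t) * M (t + 1) := by nlinarith
    exact le_of_mul_le_mul_left h4 (by positivity)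
  · intro u v huv
    have h1 := mass_through_through_pass_le (light := light) (s := s) (l := l t)
      (r := 2 * R * l t) hc.nonneg hc.remove hQ.bounded hX u v
    have h2 : (k : ℝ) * mass μ (through u (through v Q)) ≤ k * ((k / p) ^ t * G) :=
      mul_le_mul_of_nonneg_left (hQ.codegree u v huv) (Nat.cast_nonneg k)
    have h3 : (k / p : ℝ) ^ (t + 1) * G = k * ((k / p) ^ t * G) / p := by
      rw [pow_succ]; ring
    rw [h3, le_div_iff₀ hp]
    linarith

/-- Each selected marked vertex consumes at least `W / l t` of `p` times the derived mass, of which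
there is at most `p * N * M (t + 1) = p * N * W / (R * l t)`. Every derived set is nonempty, so its
mass is controlled by the degrees. -/
theorem card_selected_pass_le (hc : Calibrated light k R l μ p W G N M ρ) {t : ℕ}
    {Q : List (List α)} (hQ : Controlled s k μ p G M X₀ t Q) (ht : t + 2 ≤ k) {X : List α}
    (hX : X.Nodup) (hN : (X₀.length : ℝ) ≤ N) :
    (((pass light s (l t) (2 * R * l t) Q X).1.filter s).length : ℝ) * R ≤ p * N := by
  have hQ' := hQ.of_pass hc ht hX
  have hp := hc.pos
  have h1 := card_selected_le (s := s) (l := l t) (r := 2 * R * l t) hc.remove hc.light_iff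
    hQ.bounded X
  have h2 := mass_le_sum_through hc.nonneg (X := X₀)
    (Q := (pass light s (l t) (2 * R * l t) Q X).2) (fun A hA => by
      obtain ⟨u, hu, -⟩ := hQ'.not_subset A hA
      exact ⟨u, hu, hQ'.subset A hA u hu⟩)
  have h3 := h2.trans (sum_map_le_length_mul (c := M (t + 1)) fun u _ => hQ'.degree u)
  have h4 : mass μ (pass light s (l t) (2 * R * l t) Q X).2 ≤ N * M (t + 1) :=
    h3.trans (mul_le_mul_of_nonneg_right hN (hc.M_pos _).le)
  have hl : (0 : ℝ) < l t := by exact_mod_cast hc.l_pos t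
  have hR : (0 : ℝ) < R := by exact_mod_cast hc.R_pos
  have h5 : (l t : ℝ) * (p * mass μ (pass light s (l t) (2 * R * l t) Q X).2)
      ≤ l t * (p * (N * M (t + 1))) := by gcongr
  have h6 := hc.M_succ t
  have h7 := h1.trans h5
  have h8 : (((pass light s (l t) (2 * R * l t) Q X).1.filter s).length * R : ℝ) * W
      ≤ (p * N) * W := by
    calc _ = R * ((((pass light s (l t) (2 * R * l t) Q X).1.filter s).length : ℝ) * W) := by ring
      _ ≤ R * (l t * (p * (N * M (t + 1)))) := by gcongr
      _ = (p * N) * (M (t + 1) * (R * l t)) := by ring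
      _ = _ := by rw [h6]
  exact le_of_mul_le_mul_right h8 hc.W_pos

theorem ρ_le (hc : Calibrated light k R l μ p W G N M ρ) {t t' : ℕ} (h : t ≤ t') :
    ρ t ≤ ρ t' := by
  have : Monotone ρ := monotone_nat_of_le_succ fun t => by
    rw [hc.ρ_succ]
    have := hc.k_pos
    nlinarith [hc.ρ_pos t]
  exact this h

theorem survivors_sublist {Q : List (List α)} {Mk X : List α} :
    (survivors s Q Mk X).Sublist X := List.filter_sublist

/-- If few vertices are discarded, then there is little mass left. -/
theorem mass_within_levels_lt (hc : Calibrated light k R l μ p W G N M ρ) (hX₀ : X₀.Nodup)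
    (hN : (X₀.length : ℝ) ≤ N) (j t : ℕ) (hjt : j + t + 1 = k) {Q : List (List α)}
    (hQ : Controlled s k μ p G M X₀ t Q) {X : List α} (hX : X.Sublist X₀)
    (hfew : ((X₀.filter fun u => decide (u ∉ levels light s l R j t Q X)).length : ℝ)
      * (8 * k * ρ k) ≤ N) :
    ρ t * mass μ (within (levels light s l R j t Q X) Q) < M t * N := by
  induction j generalizing t Q X with
  | zero =>
    -- At the last level members have at most one element, and at least one because they are not
    -- inside `s`. Their vertices have just been discarded.
    have : within (levels light s l R 0 t Q X) Q = [] := by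
      rw [List.eq_nil_iff_forall_not_mem]
      intro A hA
      rw [mem_within] at hA
      have hlen := hQ.length A hA.1
      obtain ⟨u, hu, -⟩ := hQ.not_subset A hA.1
      obtain ⟨w, rfl⟩ : ∃ w, A = [w] := by
        rw [← List.length_eq_one_iff]
        have := List.length_pos_of_mem hu
        omega
      have := hA.2 w List.mem_cons_self
      simp only [levels, List.mem_filter, Bool.not_eq_true', decide_eq_false_iff_not] at this
      exact this.2 hA.1
    rw [this, mass_nil, mul_zero]
    exact mul_pos (hc.M_pos t) hc.N_pos
  | succ j ih =>
    have hXn := hX₀.sublist hX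
    have ht : t + 2 ≤ k := by omega
    have hQ' := hQ.of_pass hc ht hXn
    have hY := card_selected_pass_le hc hQ ht hXn hN
    have hsuc := ih (t + 1) (by omega) hQ' (survivors_sublist.trans hX) hfew
    rw [← levels] at hsuc
    set P := pass light s (l t) (2 * R * l t) Q X with hP
    set C := levels light s l R (j + 1) t Q X with hC
    have hCs : C.Sublist (survivors s Q P.1 X) := by
      rw [hC, levels]
      exact levels_sublist _ _ _ _
    have hCX₀ : C.Sublist X₀ := (hCs.trans survivors_sublist).trans hX
    -- The saturated vertices, whose derived degree exceeds `W / (2 * R * l t)`.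
    set Z := C.filter fun u => !light (2 * R * l t) (through u P.2) with hZ
    have hmain := mass_within_le (s := s) (l := l t) (r := 2 * R * l t) (X := X) (C := C)
      hc.nonneg hc.light_iff hc.W_pos.le (hCs.trans survivors_sublist).subset hQ.degree
      (fun A hA h => by
        obtain ⟨u, hu, -⟩ := hQ.not_subset A hA
        simp [h] at hu)
      (fun v hv hv' => by
        have := hCs.subset hv
        rw [survivors, List.mem_filter] at this
        rcases (by simpa using this.2 : _ ∧ (_ ∨ _)).2 with h | h
        · exact h
        · exact absurd hv' h)
    rw [← hP, ← hZ] at hmain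
    -- the mass of the derived sets
    have h2 : mass μ P.2 ≤ mass μ (within C P.2)
        + (X₀.filter fun u => decide (u ∉ C)).length * M (t + 1) := by
      have h3 := mass_le_add_add hc.nonneg (Q := P.2)
        (q₁ := fun A => A.all fun u => decide (u ∈ C))
        (q₂ := fun A => !(A.all fun u => decide (u ∈ C))) (q₃ := fun _ => false) (by
          intro A _
          cases A.all fun u => decide (u ∈ C) <;> simp)
      have h4 := mass_filter_le_sum_through hc.nonneg (Q := P.2)
        (q := fun A => !(A.all fun u => decide (u ∈ C)))
        (X := X₀.filter fun u => decide (u ∉ C)) (fun u A => decide (u ∈ A)) (by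
          intro A hA h
          simp only [Bool.not_eq_true', List.all_eq_false, decide_eq_true_eq] at h
          obtain ⟨u, hu, huC⟩ := h
          exact ⟨u, by simp [hQ'.subset A hA u hu, huC], by simpa using hu⟩)
      have h5 := h4.trans (sum_map_le_length_mul (c := M (t + 1)) fun u _ => hQ'.degree u)
      simp only [List.filter_false, mass_nil, add_zero] at h3
      exact h3.trans (by rw [within]; linarith)
    have hl : (0 : ℝ) < l t := by exact_mod_cast hc.l_pos t
    have hR : (0 : ℝ) < R := by exact_mod_cast hc.R_pos
    have hk : (0 : ℝ) < k := by exact_mod_cast hc.k_pos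
    have hρ : (0 : ℝ) < ρ t := by exact_mod_cast hc.ρ_pos t
    have hW := hc.W_pos
    have hD := hc.M_pos (t + 1)
    have hMt := hc.M_pos t
    have hMs := hc.M_succ t
    -- The derived degrees sum to at most `k` times the derived mass, which bounds the number of
    -- saturated vertices.
    have h1 : (Z.length : ℝ) * W ≤ (2 * R * l t) * (k * mass μ P.2) := by
      have h3 := sum_mass_through_le (μ := μ) hc.nonneg (X := Z) (Q := P.2) (k := k)
        ((hX₀.sublist hCX₀).filter _) (fun A hA => (hQ'.bounded A hA).2)
      have h4 : (Z.length : ℝ) * W ≤ (2 * R * l t) * (Z.map fun u => mass μ (through u P.2)).sum := by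
        rw [← List.sum_map_mul_left]
        have := List.card_nsmul_le_sum
          (Z.map fun u => (2 * R * l t : ℝ) * mass μ (through u P.2)) W (by
            intro x hx
            obtain ⟨u, hu, rfl⟩ := List.mem_map.1 hx
            have := (List.mem_filter.1 hu).2
            rw [Bool.not_eq_true', ← Bool.not_eq_true, hc.light_iff, not_le] at this
            push_cast at this
            exact this.le)
        simpa using this
      exact h4.trans (by gcongr)
    set a : ℝ := ((X₀.filter fun u => decide (u ∉ C)).length : ℝ) with ha
    have ha0 : 0 ≤ a := Nat.cast_nonneg _
    have h4 : a * (8 * k * ρ t) ≤ N := by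
      refine le_trans ?_ hfew
      have : (ρ t : ℝ) ≤ ρ k := by exact_mod_cast ρ_le hc (by omega)
      gcongr
    have h3 : (8 * k * ρ t : ℝ) * mass μ (within C P.2) < M (t + 1) * N := by
      rw [hc.ρ_succ] at hsuc
      push_cast at hsuc
      exact hsuc
    -- One half of the bound is the mass inside `C`, from the induction hypothesis; the other half
    -- is the mass touching one of the few discarded vertices.
    have h5 : (8 * k * ρ t : ℝ) * mass μ P.2 < 2 * M (t + 1) * N := by
      have h6 := mul_le_mul_of_nonneg_left h2 (by positivity : (0 : ℝ) ≤ 8 * k * ρ t)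
      have h7 := mul_le_mul_of_nonneg_right h4 hD.le
      nlinarith
    have h6 : 2 * (Z.length : ℝ) * ρ t < N := by
      have h7 := mul_le_mul_of_nonneg_left h1 (by positivity : (0 : ℝ) ≤ 4 * ρ t)
      have h8 := mul_lt_mul_of_pos_left h5 (by positivity : (0 : ℝ) < R * l t)
      have h9 : (2 * (Z.length : ℝ) * ρ t) * (2 * W) < N * (2 * W) := by
        calc (2 * (Z.length : ℝ) * ρ t) * (2 * W) = 4 * ρ t * (Z.length * W) := by ring
          _ ≤ 4 * ρ t * ((2 * R * l t) * (k * mass μ P.2)) := h7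
          _ = R * l t * (8 * k * ρ t * mass μ P.2) := by ring
          _ < R * l t * (2 * M (t + 1) * N) := h8
          _ = N * (2 * (M (t + 1) * (R * l t))) := by ring
          _ = _ := by rw [hMs]
      exact lt_of_mul_lt_mul_right h9 (by positivity)
    have h7 : 4 * ((P.1.filter s).length * ρ t : ℝ) ≤ N := by
      have h8 := hc.few t (by omega)
      have h9 := mul_le_mul_of_nonneg_right hY (by positivity : (0 : ℝ) ≤ 4 * ρ t)
      have h10 := mul_le_mul_of_nonneg_right h8 hc.N_pos.le
      have h11 : (4 * ((P.1.filter s).length * ρ t : ℝ)) * R ≤ N * R := by linarith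
      exact le_of_mul_le_mul_right h11 hR
    have hXN : (X.length : ℝ) ≤ N := le_trans (by exact_mod_cast hX.length_le) hN
    have h8 := mul_le_mul_of_nonneg_left hmain hρ.le
    have h9 := hc.threshold t
    have h10 : (ρ t : ℝ) * (X.length * W) ≤ N * (l t * M t / 4) := by
      calc (ρ t : ℝ) * (X.length * W) = X.length * (ρ t * W) := by ring
        _ ≤ N * (l t * M t / 4) := by
          apply mul_le_mul hXN _ (by positivity) hc.N_pos.le
          linarith
    -- Light links and selected vertices contribute at most a quarter each of `l t * M t * N`, and
    -- saturated vertices less than a half.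
    have h11 : (l t : ℝ) * (ρ t * mass μ (within C Q)) < l t * (M t * N) := by
      have hlM : (0 : ℝ) < l t * M t := by positivity
      have h12 := mul_le_mul_of_nonneg_left h7 hlM.le
      have h13 := mul_lt_mul_of_pos_left h6 hlM
      nlinarith
    exact lt_of_mul_lt_mul_left h11 hl.le

/-- Marking never removes a vertex of `s`, and the singleton of such a vertex cannot be a member,
because members are not contained in `s`. -/
theorem mem_levels (hc : Calibrated light k R l μ p W G N M ρ) (hX₀ : X₀.Nodup) (j t : ℕ)
    (hjt : j + t + 1 = k) {Q : List (List α)} (hQ : Controlled s k μ p G M X₀ t Q) {X : List α}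
    (hX : X.Sublist X₀) {v : α} (hv : v ∈ X) (hsv : s v = true) :
    v ∈ levels light s l R j t Q X := by
  have hsingle : ∀ {t Q}, Controlled s k μ p G M X₀ t Q → [v] ∉ Q := by
    intro t Q hQ h
    obtain ⟨u, hu, hsu⟩ := hQ.not_subset _ h
    rw [List.mem_singleton] at hu
    simp [hu, hsv] at hsu
  induction j generalizing t Q X with
  | zero => simp [levels, hv, hsingle hQ]
  | succ j ih =>
    refine ih (t + 1) (by omega) (hQ.of_pass hc (by omega) (hX₀.sublist hX))
      (survivors_sublist.trans hX) ?_
    simp [survivors, hv, hsv, hsingle hQ]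

theorem card_levelMarks_le (hc : Calibrated light k R l μ p W G N M ρ) (hX₀ : X₀.Nodup)
    (hN : (X₀.length : ℝ) ≤ N) (j t : ℕ) (hjt : j + t + 1 = k) {Q : List (List α)}
    (hQ : Controlled s k μ p G M X₀ t Q) {X : List α} (hX : X.Sublist X₀) :
    (((levelMarks light s l R j t Q X).filter s).length : ℝ) * R ≤ j * (p * N) := by
  induction j generalizing t Q X with
  | zero => simp [levelMarks]
  | succ j ih =>
    have h1 := ih (t + 1) (by omega) (hQ.of_pass hc (by omega) (hX₀.sublist hX))
      (X := survivors s Q (pass light s (l t) (2 * R * l t) Q X).1 X) (survivors_sublist.trans hX)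
    have h2 := card_selected_pass_le hc hQ (by omega) (hX₀.sublist hX) hN
    rw [levelMarks, List.filter_append, List.length_append]
    push_cast
    linarith

/-- Each round starts again from the original edges inside the current container, with that
container as the new ground set. -/
theorem Controlled.within {H : List (List α)} (h0 : ∀ A, 0 ≤ μ A)
    (hH : Controlled s k μ p G M X₀ 0 H) {X : List α} :
    Controlled s k μ p G M X 0 (within X H) := by
  refine ⟨fun A hA => hH.nodup A (mem_within.1 hA).1, fun A hA => hH.length A (mem_within.1 hA).1,
    fun A hA => (mem_within.1 hA).2, fun A hA => hH.not_subset A (mem_within.1 hA).1,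
    fun u => le_trans ?_ (hH.degree u), fun u v huv => le_trans ?_ (hH.codegree u v huv)⟩
  · rw [through, SatContainer.within, List.filter_filter]
    exact mass_filter_le h0 fun A _ hA => by rw [Bool.and_eq_true] at hA; exact hA.1
  · rw [through, through, through, through, SatContainer.within, List.filter_filter,
      List.filter_filter, List.filter_filter]
    exact mass_filter_le h0 fun A _ hA => by simp at hA ⊢; exact hA.1

theorem within_within {C X : List α} (h : C ⊆ X) (H : List (List α)) :
    within C (within X H) = within C H := by
  rw [within, within, within, List.filter_filter]
  refine List.filter_congr fun A _ => ?_
  rw [Bool.eq_iff_iff]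
  simp only [Bool.and_eq_true, List.all_eq_true, decide_eq_true_eq]
  exact ⟨fun h' => h'.1, fun h' => ⟨h', fun u hu => h (h' u hu)⟩⟩

theorem card_discarded {X C : List α} (hX : X.Nodup) (hC : C.Sublist X) :
    (X.filter fun u => decide (u ∉ C)).length + C.length = X.length := by
  have h1 : (X.filter fun u => decide (u ∈ C)).length = C.length := by
    apply List.Perm.length_eq
    rw [List.perm_ext_iff_of_nodup (hX.filter _) (hX.sublist hC)]
    intro u
    simp only [List.mem_filter, decide_eq_true_eq]
    exact ⟨fun h => h.2, fun h => ⟨hC.subset h, h⟩⟩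
  have h2 := List.length_eq_length_filter_add (l := X) fun u => decide (u ∈ C)
  have h3 : (fun u => !decide (u ∈ C)) = fun u => decide (u ∉ C) := by
    ext u; simp
  rw [h3] at h2
  omega

/-- Mass inside the container only decreases, so a large final mass was large in every round. By
`mass_within_levels_lt` each round then discarded more than `N / (8 * k * ρ k)` vertices. -/
theorem mass_within_rounds (hc : Calibrated light k R l μ p W G N M ρ) {H : List (List α)}
    {j : ℕ} (hj : j + 1 = k) (hH : Controlled s k μ p G M X₀ 0 H) (i : ℕ) {X : List α}
    (hX : X.Nodup) (hN : (X.length : ℝ) ≤ N)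
    (hbig : M 0 * N ≤ ρ 0 * mass μ (within (rounds light s l R j H i X) H)) :
    i * N ≤ (8 * k * ρ k) * (X.length - (rounds light s l R j H i X).length : ℝ) := by
  induction i generalizing X with
  | zero => simp [rounds]
  | succ i ih =>
    rw [rounds] at hbig ⊢
    set C := levels light s l R j 0 (within X H) X with hC
    have hCX : C.Sublist X := levels_sublist _ _ _ _
    have h1 := ih (hX.sublist hCX) (le_trans (by exact_mod_cast hCX.length_le) hN) hbig
    have h2 := mt (mass_within_levels_lt (X₀ := X) hc hX hN j 0 (by omega)
      (hH.within hc.nonneg) (List.Sublist.refl X)) (by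
        rw [not_lt, ← hC, within_within hCX.subset]
        refine hbig.trans (mul_le_mul_of_nonneg_left ?_ (Nat.cast_nonneg _))
        refine mass_filter_le hc.nonneg fun A _ hA => ?_
        simp only [List.all_eq_true, decide_eq_true_eq] at hA ⊢
        exact fun u hu => (rounds_sublist _ _).subset (hA u hu))
    rw [not_le, ← hC] at h2
    have h3 := card_discarded hX hCX
    have h4 : ((X.filter fun u => decide (u ∉ C)).length : ℝ) = X.length - C.length := by
      rw [← h3]; push_cast; ring
    rw [h4] at h2
    push_cast
    nlinarith

theorem mem_rounds (hc : Calibrated light k R l μ p W G N M ρ) {H : List (List α)}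
    {j : ℕ} (hj : j + 1 = k) (hH : Controlled s k μ p G M X₀ 0 H) (i : ℕ) {X : List α}
    (hX : X.Nodup) {v : α} (hv : v ∈ X) (hsv : s v = true) :
    v ∈ rounds light s l R j H i X := by
  induction i generalizing X with
  | zero => exact hv
  | succ i ih =>
    exact ih (hX.sublist (levels_sublist _ _ _ _))
      (mem_levels hc hX j 0 (by omega) (hH.within hc.nonneg) (List.Sublist.refl X) hv hsv)

theorem card_roundMarks_le (hc : Calibrated light k R l μ p W G N M ρ) {H : List (List α)}
    {j : ℕ} (hj : j + 1 = k) (hH : Controlled s k μ p G M X₀ 0 H) (i : ℕ) {X : List α}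
    (hX : X.Nodup) (hN : (X.length : ℝ) ≤ N) :
    (((roundMarks light s l R j H i X).filter s).length : ℝ) * R ≤ i * (j * (p * N)) := by
  induction i generalizing X with
  | zero => simp [roundMarks]
  | succ i ih =>
    have hCX : (levels light s l R j 0 (within X H) X).Sublist X := levels_sublist _ _ _ _
    have h1 := ih (hX.sublist hCX) (le_trans (by exact_mod_cast hCX.length_le) hN)
    have h2 := card_levelMarks_le hc hX hN j 0 (by omega) (hH.within hc.nonneg)
      (List.Sublist.refl X)
    rw [roundMarks, List.filter_append, List.length_append]
    push_cast
    linarith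

/-- The container theorem for the algorithm: every set `s` that contains no member of `H` has a
small fingerprint. -/
theorem exists_fingerprint (hc : Calibrated light k R l μ p W G N M ρ) {H : List (List α)}
    {j : ℕ} (hj : j + 1 = k) (hX₀ : X₀.Nodup) (hH : Controlled s k μ p G M X₀ 0 H)
    (hN : (X₀.length : ℝ) = N) (hR : R = 8 * k * ρ k + 1) :
    ∃ S : List α, S.Sublist X₀ ∧ (∀ v ∈ S, s v = true) ∧ (S.length : ℝ) ≤ j * (p * N) ∧
      (∀ v ∈ X₀, s v = true → v ∈ rounds light (fun v => decide (v ∈ S)) l R j H R X₀) ∧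
      ρ 0 * mass μ (within (rounds light (fun v => decide (v ∈ S)) l R j H R X₀) H) ≤ M 0 * N := by
  -- The fingerprint consists of the vertices of `s` that are ever marked, in the order of `X₀`, so
  -- that it occurs among the enumerated sublists.
  set S := X₀.filter fun v => s v && decide (v ∈ roundMarks light s l R j H R X₀) with hS
  have hrun : rounds light (fun v => decide (v ∈ S)) l R j H R X₀
      = rounds light s l R j H R X₀ := by
    apply rounds_congr
    intro v hv
    have := roundMarks_subset _ _ hv
    by_cases hsv : s v = true <;> simp [hS, hv, this, hsv]
  refine ⟨S, List.filter_sublist, fun v hv => ?_, ?_, ?_, ?_⟩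
  · have := (List.mem_filter.1 hv).2
    rw [Bool.and_eq_true] at this
    exact this.1
  -- There are `R` rounds and each pass selects at most `p * N / R` vertices, so `R` cancels.
  · have h1 := card_roundMarks_le hc hj hH R hX₀ hN.le
    have h2 : S.length ≤ ((roundMarks light s l R j H R X₀).filter s).length := by
      refine (List.subperm_of_subset (hX₀.filter _) fun v hv => ?_).length_le
      have := (List.mem_filter.1 hv).2
      simp only [Bool.and_eq_true, decide_eq_true_eq] at this
      exact List.mem_filter.2 ⟨this.2, this.1⟩
    have h3 : (0 : ℝ) < R := by exact_mod_cast hc.R_pos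
    have h4 : (S.length : ℝ) ≤ ((roundMarks light s l R j H R X₀).filter s).length := by
      exact_mod_cast h2
    nlinarith
  · intro v hv hsv
    rw [hrun]
    exact mem_rounds hc hj hH R hX₀ hv hsv
  · rw [hrun]
    -- Since `R > 8 * k * ρ k`, large mass throughout would discard more than `N` vertices.
    by_contra hbig
    have h1 := mass_within_rounds hc hj hH R hX₀ hN.le (not_le.1 hbig).le
    have h2 : (0 : ℝ) ≤ 8 * k * ρ k := by positivity
    have h3 : (0 : ℝ) ≤ (rounds light s l R j H R X₀).length := Nat.cast_nonneg _
    have h4 : (R : ℝ) = 8 * k * ρ k + 1 := by rw [hR]; push_cast; ring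
    rw [hN, h4] at h1
    nlinarith [hc.N_pos, mul_nonneg h2 h3]

end Rounds

/-! ### Polynomial growth -/

/-- Monotone functions that are bounded by a polynomial. -/
def PolyGrowth (T : ℕ → ℕ) : Prop := Monotone T ∧ ∃ c, ∀ n, T n ≤ (n + 2) ^ c

namespace PolyGrowth

variable {T T' : ℕ → ℕ}

theorem id : PolyGrowth fun n => n := ⟨monotone_id, 1, fun n => by simp⟩

theorem const (m : ℕ) : PolyGrowth fun _ => m := by
  refine ⟨monotone_const, m, fun n => ?_⟩
  exact (Nat.lt_two_pow_self.le).trans (Nat.pow_le_pow_left (by omega) m)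

theorem add (h : PolyGrowth T) (h' : PolyGrowth T') : PolyGrowth fun n => T n + T' n := by
  obtain ⟨hm, c, hc⟩ := h
  obtain ⟨hm', c', hc'⟩ := h'
  refine ⟨hm.add hm', c + c' + 1, fun n => ?_⟩
  have h1 : (n + 2) ^ c ≤ (n + 2) ^ (c + c') := Nat.pow_le_pow_right (by omega) (by omega)
  have h2 : (n + 2) ^ c' ≤ (n + 2) ^ (c + c') := Nat.pow_le_pow_right (by omega) (by omega)
  have := hc n
  have := hc' n
  rw [pow_succ]
  nlinarith

theorem mul (h : PolyGrowth T) (h' : PolyGrowth T') : PolyGrowth fun n => T n * T' n := by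
  obtain ⟨hm, c, hc⟩ := h
  obtain ⟨hm', c', hc'⟩ := h'
  refine ⟨hm.mul' hm', c + c', fun n => ?_⟩
  rw [pow_add]
  exact Nat.mul_le_mul (hc n) (hc' n)

theorem comp (h : PolyGrowth T) (h' : PolyGrowth T') : PolyGrowth fun n => T (T' n) := by
  obtain ⟨hm, c, hc⟩ := h
  obtain ⟨hm', c', hc'⟩ := h'
  refine ⟨hm.comp hm', (c' + 2) * c, fun n => (hc _).trans ?_⟩
  rw [pow_mul]
  refine Nat.pow_le_pow_left ?_ c
  have h1 := hc' n
  have h2 : 1 ≤ (n + 2) ^ c' := Nat.one_le_pow _ _ (by omega)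
  have h3 : 4 ≤ (n + 2) ^ 2 := Nat.pow_le_pow_left (by omega : 2 ≤ n + 2) 2
  rw [pow_add]
  nlinarith

end PolyGrowth

/-! ### Functions computable in polynomial time -/

/-- An oracle answers the questions of a program. -/
abbrev Oracle := Data → Prop

open Classical in
/-- The answer to a question. -/
noncomputable def Oracle.answer (O : Oracle) (q : Data) : Bool := decide (O q)

theorem Oracle.answer_iff {O : Oracle} {q : Data} : O.answer q = true ↔ O q := by
  simp [Oracle.answer]

/-- Types whose elements are written as trees. -/
class Coded (A : Type) where
  /-- the tree that represents an element -/
  code : A → Data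

open Coded

instance : Coded Data := ⟨fun x => x⟩
instance : Coded ℕ := ⟨encNat⟩
instance : Coded Bool := ⟨encBool⟩
instance {A : Type} [Coded A] : Coded (List A) := ⟨encList code⟩
instance {A B : Type} [Coded A] [Coded B] : Coded (A × B) := ⟨fun q => .node (code q.1) (code q.2)⟩

/-- The size of the representation of an element. -/
def csize {A : Type} [Coded A] (a : A) : ℕ := (code a).size

theorem Data.size_pos (x : Data) : 0 < x.size := by cases x <;> simp [Data.size]

section Size

variable {A B : Type} [Coded A] [Coded B]

theorem code_prod (q : A × B) : code q = .node (code q.1) (code q.2) := rfl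
theorem code_cons (a : A) (l : List A) : code (a :: l) = .node (code a) (code l) := rfl

theorem csize_pos (a : A) : 0 < csize a := Data.size_pos _

@[simp] theorem csize_prod (q : A × B) : csize q = csize q.1 + csize q.2 + 1 := rfl
@[simp] theorem csize_nil : csize ([] : List A) = 1 := rfl
@[simp] theorem csize_cons (a : A) (l : List A) : csize (a :: l) = csize a + csize l + 1 := rfl

theorem csize_bool (b : Bool) : csize b ≤ 3 := by
  cases b <;> simp [csize, code, encBool, Data.size]

theorem csize_nat (n : ℕ) : csize n = 2 * n + 1 := by
  induction n with
  | zero => rfl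
  | succ n ih =>
    simp only [csize, code, encNat, Data.size] at ih ⊢
    omega

theorem csize_append (l l' : List A) : csize (l ++ l') + 1 = csize l + csize l' := by
  induction l with
  | nil => simp; omega
  | cons a l ih => simp only [List.cons_append, csize_cons]; omega

theorem csize_le_of_suffix {l l' : List A} (h : l <:+ l') : csize l ≤ csize l' := by
  obtain ⟨m, rfl⟩ := h
  have := csize_append m l
  have := csize_pos m
  omega

theorem csize_le_of_sublist {l l' : List A} (h : l.Sublist l') : csize l ≤ csize l' := by
  induction h with
  | slnil => exact le_rfl
  | cons a _ ih => simp only [csize_cons]; omega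
  | cons_cons a _ ih => simp only [csize_cons]; omega

theorem csize_le_of_mem {a : A} {l : List A} (h : a ∈ l) : csize a ≤ csize l := by
  induction l with
  | nil => simp at h
  | cons b l ih =>
    rw [csize_cons]
    rcases List.mem_cons.1 h with rfl | h
    · omega
    · have := ih h; omega

theorem length_le_csize (l : List A) : l.length ≤ csize l := by
  induction l with
  | nil => simp
  | cons b l ih => rw [csize_cons, List.length_cons]; omega

theorem csize_le_mul {l : List A} {m : ℕ} (h : ∀ a ∈ l, csize a ≤ m) :
    csize l ≤ l.length * (m + 1) + 1 := by
  induction l with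
  | nil => simp
  | cons b l ih =>
    have h1 := h b List.mem_cons_self
    have h2 := ih fun a ha => h a (List.mem_cons_of_mem _ ha)
    rw [csize_cons, List.length_cons, Nat.succ_mul]
    omega

end Size

/-- In every extension of the functions `Q`, the expression `e` computes `f`, with time and size
bounded by `T`. -/
def Realizes {A B : Type} [Coded A] [Coded B] (Q : Program) (e : Expr) (T : ℕ → ℕ)
    (f : Oracle → A → B) : Prop :=
  -- Extensions allow further functions to be appended without changing call indices. Slot 0 is kept
  -- for a main function that is chosen last, and the rest of the environment is arbitrary so that
  -- `e` may be used below binders.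
  ∀ P : Program, Q <+: P → ∀ (main : Expr) (O : Oracle) (a : A) (env : List Data),
    ∃ t, Eval O (main :: P) (code a :: env) e (code (f O a)) t ∧ t ≤ T (csize a) ∧
      csize (f O a) ≤ T (csize a)

/-- Functions that are computable in polynomial time, uniformly in the oracle. -/
def PolyTime {A B : Type} [Coded A] [Coded B] (f : Oracle → A → B) : Prop :=
  ∀ Q₀ : Program, ∃ Q, Q₀ <+: Q ∧ ∃ e T, PolyGrowth T ∧ Realizes Q e T f

/-! ### Composition, branching and recursion -/

namespace PolyTime

variable {A B C X : Type} [Coded A] [Coded B] [Coded C] [Coded X]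

/-- A program sees only trees, so computability passes between types whose elements have the same
codes; for instance a nonempty list is coded like a pair, and a number like a list of units. -/
theorem of_code_eq {A' B' : Type} [Coded A'] [Coded B'] {f : Oracle → A → B} (hf : PolyTime f)
    {f' : Oracle → A' → B'} (i : A' → A) (hi : ∀ a, code (i a) = code a)
    (h : ∀ O a, code (f' O a) = code (f O (i a))) : PolyTime f' := by
  intro Q₀
  obtain ⟨Q, hQ, e, T, hT, he⟩ := hf Q₀
  refine ⟨Q, hQ, e, T, hT, fun P hP main O a env => ?_⟩
  obtain ⟨t, h1, h2, h3⟩ := he P hP main O (i a) env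
  have hs : csize (i a) = csize a := by rw [csize, csize, hi]
  have hs' : csize (f' O a) = csize (f O (i a)) := by rw [csize, csize, h]
  refine ⟨t, ?_, ?_, ?_⟩
  · rw [h, ← hi]; exact h1
  · rw [← hs]; exact h2
  · rw [hs', ← hs]; exact h3

theorem id : PolyTime fun _ (a : A) => a := by
  intro Q₀
  refine ⟨Q₀, List.prefix_refl _, .var 0, fun n => n, PolyGrowth.id, fun P _ main O a env =>
    ⟨1, .var rfl, csize_pos a, le_rfl⟩⟩

/-- The expression that builds a given tree. -/
def quote : Data → Expr
  | .nil => .nil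
  | .node x y => .cons (quote x) (quote y)

theorem eval_quote (O : Oracle) (P : Program) (env : List Data) (x : Data) :
    Eval O P env (quote x) x x.size := by
  induction x with
  | nil => exact .nil
  | node x y hx hy => exact .cons hx hy

theorem const (b : B) : PolyTime fun _ (_ : A) => b := by
  intro Q₀
  exact ⟨Q₀, List.prefix_refl _, quote (code b), fun _ => csize b, PolyGrowth.const _,
    fun P _ main O a env => ⟨_, eval_quote _ _ _ _, le_rfl, le_rfl⟩⟩

theorem comp {g : Oracle → B → C} {f : Oracle → A → B} (hg : PolyTime g) (hf : PolyTime f) :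
    PolyTime fun O a => g O (f O a) := by
  intro Q₀
  obtain ⟨Q₁, h₁, e₁, T₁, hT₁, H₁⟩ := hf Q₀
  obtain ⟨Q₂, h₂, e₂, T₂, hT₂, H₂⟩ := hg Q₁
  refine ⟨Q₂, h₁.trans h₂, .bind e₁ e₂, fun n => T₁ n + T₂ (T₁ n) + 1,
    (hT₁.add (hT₂.comp hT₁)).add (.const 1), fun P hP main O a env => ?_⟩
  beta_reduce
  obtain ⟨t₁, E₁, ht₁, hs₁⟩ := H₁ P (h₂.trans hP) main O a env
  obtain ⟨t₂, E₂, ht₂, hs₂⟩ := H₂ P hP main O (f O a) (code a :: env)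
  have := hT₂.1 hs₁
  exact ⟨_, .bind E₁ E₂, by omega, by omega⟩

theorem prodMk {f : Oracle → A → B} {g : Oracle → A → C} (hf : PolyTime f) (hg : PolyTime g) :
    PolyTime fun O a => (f O a, g O a) := by
  intro Q₀
  obtain ⟨Q₁, h₁, e₁, T₁, hT₁, H₁⟩ := hf Q₀
  obtain ⟨Q₂, h₂, e₂, T₂, hT₂, H₂⟩ := hg Q₁
  refine ⟨Q₂, h₁.trans h₂, .cons e₁ e₂, fun n => T₁ n + T₂ n + 1,
    (hT₁.add hT₂).add (.const 1), fun P hP main O a env => ?_⟩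
  beta_reduce
  obtain ⟨t₁, E₁, ht₁, hs₁⟩ := H₁ P (h₂.trans hP) main O a env
  obtain ⟨t₂, E₂, ht₂, hs₂⟩ := H₂ P hP main O a env
  exact ⟨_, .cons E₁ E₂, by omega, by
    rw [csize_prod]; dsimp only; omega⟩

theorem fst {f : Oracle → A → B × C} (hf : PolyTime f) : PolyTime fun O a => (f O a).1 := by
  refine comp (g := fun _ (q : B × C) => q.1) (fun Q₀ => ?_) hf
  refine ⟨Q₀, List.prefix_refl _, .split (.var 0) .nil (.var 0), fun n => n + 3,
    PolyGrowth.id.add (.const 3), fun P _ main O a env =>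
    ⟨_, .split_node (x := code a.1) (y := code a.2) (.var rfl) (.var rfl), ?_, ?_⟩⟩
  · beta_reduce; omega
  · beta_reduce; rw [csize_prod]; omega

theorem snd {f : Oracle → A → B × C} (hf : PolyTime f) : PolyTime fun O a => (f O a).2 := by
  refine comp (g := fun _ (q : B × C) => q.2) (fun Q₀ => ?_) hf
  refine ⟨Q₀, List.prefix_refl _, .split (.var 0) .nil (.var 1), fun n => n + 3,
    PolyGrowth.id.add (.const 3), fun P _ main O a env =>
    ⟨_, .split_node (x := code a.1) (y := code a.2) (.var rfl) (.var rfl), ?_, ?_⟩⟩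
  · beta_reduce; omega
  · beta_reduce; rw [csize_prod]; omega

theorem cons {f : Oracle → A → B} {g : Oracle → A → List B} (hf : PolyTime f) (hg : PolyTime g) :
    PolyTime fun O a => f O a :: g O a :=
  (prodMk hf hg).of_code_eq (fun a => a) (fun _ => rfl) fun _ _ => rfl

theorem succ {f : Oracle → A → ℕ} (hf : PolyTime f) : PolyTime fun O a => f O a + 1 :=
  (prodMk (const Data.nil) hf).of_code_eq (fun a => a) (fun _ => rfl) fun _ _ => rfl

theorem node {f g : Oracle → A → Data} (hf : PolyTime f) (hg : PolyTime g) :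
    PolyTime fun O a => Data.node (f O a) (g O a) :=
  (prodMk hf hg).of_code_eq (fun a => a) (fun _ => rfl) fun _ _ => rfl

theorem ite {c : Oracle → A → Bool} {f g : Oracle → A → B} (hc : PolyTime c) (hf : PolyTime f)
    (hg : PolyTime g) : PolyTime fun O a => if c O a = true then f O a else g O a := by
  intro Q₀
  obtain ⟨Q₁, h₁, e₁, T₁, hT₁, H₁⟩ := hc Q₀
  obtain ⟨Q₂, h₂, e₂, T₂, hT₂, H₂⟩ := hf Q₁
  obtain ⟨Q₃, h₃, e₃, T₃, hT₃, H₃⟩ := hg Q₂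
  -- In the node case `split` pushes two subtrees, so the argument sits at position 2 and is bound
  -- again to position 0.
  refine ⟨Q₃, (h₁.trans h₂).trans h₃, .split e₁ e₃ (.bind (.var 2) e₂),
    fun n => T₁ n + T₂ n + T₃ n + 3, ((hT₁.add hT₂).add hT₃).add (.const 3),
    fun P hP main O a env => ?_⟩
  beta_reduce
  obtain ⟨t₁, E₁, ht₁, hs₁⟩ := H₁ P ((h₂.trans h₃).trans hP) main O a env
  obtain ⟨t₂, E₂, ht₂, hs₂⟩ := H₂ P (h₃.trans hP) main O a (.nil :: .nil :: code a :: env)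
  obtain ⟨t₃, E₃, ht₃, hs₃⟩ := H₃ P hP main O a env
  cases hb : c O a
  · rw [hb] at E₁
    rw [if_neg Bool.false_ne_true]
    exact ⟨_, .split_nil E₁ E₃, by omega, by omega⟩
  · rw [hb] at E₁
    rw [if_pos rfl]
    exact ⟨_, .split_node E₁ (.bind (.var rfl) E₂), by omega, by omega⟩

theorem list_cases {l : Oracle → A → List X} {f : Oracle → A → B} {g : Oracle → A × X × List X → B}
    {F : Oracle → A → B} (hl : PolyTime l) (hf : PolyTime f) (hg : PolyTime g)
    (hnil : ∀ O a, l O a = [] → F O a = f O a)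
    (hcons : ∀ O a x xs, l O a = x :: xs → F O a = g O (a, x, xs)) : PolyTime F := by
  intro Q₀
  obtain ⟨Q₁, h₁, e₁, T₁, hT₁, H₁⟩ := hl Q₀
  obtain ⟨Q₂, h₂, e₂, T₂, hT₂, H₂⟩ := hf Q₁
  obtain ⟨Q₃, h₃, e₃, T₃, hT₃, H₃⟩ := hg Q₂
  refine ⟨Q₃, (h₁.trans h₂).trans h₃,
    .split e₁ e₂ (.bind (.cons (.var 2) (.cons (.var 0) (.var 1))) e₃),
    fun n => T₁ n + T₂ n + T₃ (n + T₁ n + 1) + 10,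
    ((hT₁.add hT₂).add (hT₃.comp ((PolyGrowth.id.add hT₁).add (.const 1)))).add (.const 10),
    fun P hP main O a env => ?_⟩
  beta_reduce
  obtain ⟨t₁, E₁, ht₁, hs₁⟩ := H₁ P ((h₂.trans h₃).trans hP) main O a env
  obtain ⟨t₂, E₂, ht₂, hs₂⟩ := H₂ P (h₃.trans hP) main O a env
  cases hb : l O a with
  | nil =>
    rw [hb] at E₁
    rw [hnil O a hb]
    exact ⟨_, .split_nil E₁ E₂, by omega, by omega⟩
  | cons x xs =>
    rw [hb] at E₁ hs₁
    rw [hcons O a x xs hb]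
    obtain ⟨t₃, E₃, ht₃, hs₃⟩ := H₃ P hP main O (a, x, xs) (code x :: code xs :: code a :: env)
    have h4 : T₃ (csize (a, x, xs)) ≤ T₃ (csize a + T₁ (csize a) + 1) := hT₃.1 (by
      simp only [csize_prod, csize_cons] at hs₁ ⊢; omega)
    exact ⟨_, .split_node E₁ (.bind (.cons (.var rfl) (.cons (.var rfl) (.var rfl))) E₃),
      by omega, by omega⟩

theorem ask {q : Oracle → A → Data} (hq : PolyTime q) : PolyTime fun O a => O.answer (q O a) := by
  intro Q₀
  obtain ⟨Q₁, h₁, e₁, T₁, hT₁, H₁⟩ := hq Q₀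
  refine ⟨Q₁, h₁, .ask e₁, fun n => T₁ n + T₁ n + 3, (hT₁.add hT₁).add (.const 3),
    fun P hP main O a env => ?_⟩
  beta_reduce
  obtain ⟨t₁, E₁, ht₁, hs₁⟩ := H₁ P hP main O a env
  have hs : csize (q O a) = (q O a).size := rfl
  have hb := csize_bool (O.answer (q O a))
  by_cases h : O (q O a)
  · have : O.answer (q O a) = true := by simp [Oracle.answer, h]
    rw [this] at hb ⊢
    exact ⟨_, .ask_yes E₁ h, by show t₁ + (q O a).size + 1 ≤ _; omega, by omega⟩
  · have : O.answer (q O a) = false := by simp [Oracle.answer, h]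
    rw [this] at hb ⊢
    exact ⟨_, .ask_no E₁ h, by show t₁ + (q O a).size + 1 ≤ _; omega, by omega⟩

theorem getElem?_cons_of_prefix {Q P : Program} {b : Expr} (h : Q ++ [b] <+: P) (main : Expr) :
    (main :: P)[Q.length + 1]? = some b := by
  obtain ⟨R, rfl⟩ := h
  simp

/-- Recursion along a list, if the intermediate results are of polynomial size. -/
theorem foldr {l : Oracle → A → List X} {b : Oracle → A → B} {step : Oracle → A → X → B → B}
    (hl : PolyTime l) (hb : PolyTime b)
    (hs : PolyTime fun O (q : A × X × B) => step O q.1 q.2.1 q.2.2)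
    {S : ℕ → ℕ} (hS : PolyGrowth S)
    (hsize : ∀ O a l', l' <:+ l O a → csize (l'.foldr (step O a) (b O a)) ≤ S (csize a)) :
    PolyTime fun O a => (l O a).foldr (step O a) (b O a) := by
  intro Q₀
  obtain ⟨Q₁, h₁, e₁, T₁, hT₁, H₁⟩ := hl Q₀
  obtain ⟨Q₂, h₂, e₂, T₂, hT₂, H₂⟩ := hb Q₁
  obtain ⟨Q₃, h₃, e₃, T₃, hT₃, H₃⟩ := hs Q₂
  -- The function takes the pair of the argument and the remaining list. Inside the second split,
  -- positions 0, 1, 2 hold the head, the tail and the argument. Its own index is shifted by one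
  -- because of the main function.
  let body : Expr := .split (.var 0) .nil (.split (.var 1) e₂ (.bind (.cons (.var 2)
    (.cons (.var 0) (.call (Q₃.length + 1) (.cons (.var 2) (.var 1))))) e₃))
  have h₄ : Q₃ <+: Q₃ ++ [body] := List.prefix_append _ _
  let K : ℕ → ℕ := fun n => T₂ n + T₃ (n + T₁ n + S n + 2) + 20
  have hK : PolyGrowth K := (hT₂.add (hT₃.comp
    (((PolyGrowth.id.add hT₁).add hS).add (.const 2)))).add (.const 20)
  refine ⟨Q₃ ++ [body], ((h₁.trans h₂).trans h₃).trans h₄,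
    .call (Q₃.length + 1) (.cons (.var 0) e₁),
    fun n => T₁ n + (T₁ n + 1) * K n + S n + 10,
    ((hT₁.add ((hT₁.add (.const 1)).mul hK)).add hS).add (.const 10),
    fun P hP main O a env => ?_⟩
  beta_reduce
  have hbody := getElem?_cons_of_prefix hP main
  -- The recursive calls are made exactly on suffixes, which is where the size bound is assumed.
  have key : ∀ l', l' <:+ l O a → ∃ t, Eval O (main :: P) [.node (code a) (code l')] body
      (code (l'.foldr (step O a) (b O a))) t ∧ t ≤ (l'.length + 1) * K (csize a) := by
    intro l'
    induction l' with
    | nil =>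
      intro _
      obtain ⟨t₂, E₂, ht₂, -⟩ := H₂ P ((h₃.trans h₄).trans hP) main O a
        [code ([] : List X), .node (code a) (code ([] : List X))]
      refine ⟨_, .split_node (.var rfl) (.split_nil (.var rfl) E₂), ?_⟩
      simp only [List.length_nil, K]
      omega
    | cons x xs ih =>
      intro hsuf
      have hsuf' : xs <:+ l O a := (List.suffix_cons x xs).trans hsuf
      obtain ⟨t, E, ht⟩ := ih hsuf'
      obtain ⟨t₃, E₃, ht₃, -⟩ := H₃ P (h₄.trans hP) main O
        (a, x, xs.foldr (step O a) (b O a))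
        [code x, code xs, code a, code (x :: xs), .node (code a) (code (x :: xs))]
      refine ⟨_, .split_node (.var rfl) (.split_node (x := code x) (y := code xs) (.var rfl)
        (.bind (.cons (.var rfl) (.cons (.var rfl) (.call hbody (.cons (.var rfl) (.var rfl)) E)))
          E₃)), ?_⟩
      have h5 : csize x ≤ T₁ (csize a) := by
        obtain ⟨_, -, -, h6⟩ := H₁ P (((h₂.trans h₃).trans h₄).trans hP) main O a []
        exact (csize_le_of_mem (hsuf.subset List.mem_cons_self)).trans h6
      have h6 := hsize O a xs hsuf'
      have h7 : T₃ (csize (a, x, xs.foldr (step O a) (b O a)))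
          ≤ T₃ (csize a + T₁ (csize a) + S (csize a) + 2) := hT₃.1 (by
        simp only [csize_prod]; omega)
      rw [List.length_cons, Nat.succ_mul]
      simp only [K] at ht ⊢
      omega
  obtain ⟨t₁, E₁, ht₁, hs₁⟩ := H₁ P (((h₂.trans h₃).trans h₄).trans hP) main O a env
  obtain ⟨t, E, ht⟩ := key _ (List.suffix_refl _)
  refine ⟨_, .call hbody (.cons (.var rfl) E₁) E, ?_, ?_⟩
  · have h5 := (length_le_csize (l O a)).trans hs₁
    have h6 : ((l O a).length + 1) * K (csize a) ≤ (T₁ (csize a) + 1) * K (csize a) :=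
      Nat.mul_le_mul_right _ (by omega)
    omega
  · have := hsize O a _ (List.suffix_refl _)
    omega

noncomputable instance : DecidableEq Data := Classical.decEq _

/-- Equality of trees can be decided in polynomial time. -/
theorem data_eq {f g : Oracle → A → Data} (hf : PolyTime f) (hg : PolyTime g) :
    PolyTime fun O a => decide (f O a = g O a) := by
  refine comp (g := fun _ (q : Data × Data) => decide (q.1 = q.2)) (fun Q₀ => ?_)
    (prodMk hf hg)
  let yes : Expr := .cons .nil .nil
  let eq : ℕ := Q₀.length + 1
  let body : Expr := .split (.var 0) .nil (.split (.var 0)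
    (.split (.var 1) yes .nil)
    (.split (.var 3) .nil
      (.split (.call eq (.cons (.var 2) (.var 0))) .nil
        (.call eq (.cons (.var 5) (.var 3))))))
  -- Both trees are descended in parallel, so the time is charged to the nodes of the first one
  -- alone.
  have key : ∀ (P : Program) (main : Expr) (O : Oracle), Q₀ ++ [body] <+: P → ∀ x y : Data,
      ∃ t, Eval O (main :: P) [.node x y] body (encBool (decide (x = y))) t ∧
        t ≤ 20 * x.size := by
    intro P main O hP x
    have hbody := getElem?_cons_of_prefix hP main
    induction x with
    | nil =>
      intro y
      cases y with
      | nil =>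
        refine ⟨_, .split_node (.var rfl) (.split_nil (.var rfl) (.split_nil (t := 3) (.var rfl)
          ?_)), ?_⟩
        · simpa [encBool] using Eval.cons .nil .nil
        · simp [Data.size]
      | node y₁ y₂ =>
        refine ⟨_, .split_node (.var rfl) (.split_nil (.var rfl) (.split_node (t := 1)
          (.var rfl) ?_)), ?_⟩
        · simpa [encBool] using Eval.nil
        · simp [Data.size]
    | node x₁ x₂ ih₁ ih₂ =>
      intro y
      cases y with
      | nil =>
        refine ⟨_, .split_node (.var rfl) (.split_node (.var rfl) (.split_nil (t := 1)
          (.var rfl) ?_)), ?_⟩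
        · simpa [encBool] using Eval.nil
        · simp [Data.size]; omega
      | node y₁ y₂ =>
        obtain ⟨t₁, E₁, ht₁⟩ := ih₁ y₁
        obtain ⟨t₂, E₂, ht₂⟩ := ih₂ y₂
        by_cases h : x₁ = y₁
        · have h1 : encBool (decide (x₁ = y₁)) = .node .nil .nil := by simp [h, encBool]
          have h2 : decide (Data.node x₁ x₂ = .node y₁ y₂) = decide (x₂ = y₂) := by simp [h]
          rw [h1] at E₁
          rw [h2]
          refine ⟨_, .split_node (.var rfl) (.split_node (.var rfl) (.split_node (.var rfl)
            (.split_node (.call hbody (.cons (.var rfl) (.var rfl)) E₁)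
              (.call hbody (.cons (.var rfl) (.var rfl)) E₂)))), ?_⟩
          simp only [Data.size]; omega
        · have h1 : encBool (decide (x₁ = y₁)) = .nil := by simp [h, encBool]
          have h2 : decide (Data.node x₁ x₂ = .node y₁ y₂) = false := by simp [h]
          rw [h1] at E₁
          rw [h2]
          refine ⟨_, .split_node (.var rfl) (.split_node (.var rfl) (.split_node (.var rfl)
            (.split_nil (.call hbody (.cons (.var rfl) (.var rfl)) E₁) .nil))), ?_⟩
          simp only [Data.size]; omega
  refine ⟨Q₀ ++ [body], List.prefix_append _ _, .call eq (.var 0), fun n => 20 * n + 10,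
    ((PolyGrowth.const 20).mul .id).add (.const 10), fun P hP main O a env => ?_⟩
  beta_reduce
  obtain ⟨t, E, ht⟩ := key P main O hP a.1 a.2
  refine ⟨_, .call (getElem?_cons_of_prefix hP main) (.var rfl) E, ?_, ?_⟩
  · have : csize a = a.1.size + a.2.size + 1 := rfl
    omega
  · have := csize_bool (decide (a.1 = a.2))
    omega

end PolyTime

namespace PolyTime

variable {A B C X Y : Type} [Coded A] [Coded B] [Coded C] [Coded X] [Coded Y]

/-! ### Closure properties -/

theorem exists_csize_le {f : Oracle → A → B} (hf : PolyTime f) :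
    ∃ T, PolyGrowth T ∧ ∀ O a, csize (f O a) ≤ T (csize a) := by
  obtain ⟨Q, -, e, T, hT, H⟩ := hf []
  refine ⟨T, hT, fun O a => ?_⟩
  obtain ⟨_, -, -, h⟩ := H Q (List.prefix_refl _) .nil O a []
  exact h

theorem not {f : Oracle → A → Bool} (hf : PolyTime f) : PolyTime fun O a => !f O a :=
  (ite hf (const false) (const true)).of_code_eq (fun a => a) (fun _ => rfl)
    fun O a => by cases f O a <;> rfl

theorem and {f g : Oracle → A → Bool} (hf : PolyTime f) (hg : PolyTime g) :
    PolyTime fun O a => f O a && g O a :=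
  (ite hf hg (const false)).of_code_eq (fun a => a) (fun _ => rfl)
    fun O a => by cases f O a <;> rfl

theorem or {f g : Oracle → A → Bool} (hf : PolyTime f) (hg : PolyTime g) :
    PolyTime fun O a => f O a || g O a :=
  (ite hf (const true) hg).of_code_eq (fun a => a) (fun _ => rfl)
    fun O a => by cases f O a <;> rfl

theorem as_data {f : Oracle → A → B} (hf : PolyTime f) : PolyTime fun O a => code (f O a) :=
  hf.of_code_eq (fun a => a) (fun _ => rfl) fun _ _ => rfl

theorem eq [DecidableEq B] (hB : Function.Injective (code : B → Data)) {f g : Oracle → A → B}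
    (hf : PolyTime f) (hg : PolyTime g) : PolyTime fun O a => decide (f O a = g O a) :=
  (data_eq hf.as_data hg.as_data).of_code_eq (fun a => a) (fun _ => rfl)
    fun O a => by simp [hB.eq_iff]

theorem filter {l : Oracle → A → List X} {q : Oracle → A → X → Bool} (hl : PolyTime l)
    (hq : PolyTime fun O (z : A × X) => q O z.1 z.2) :
    PolyTime fun O a => (l O a).filter (q O a) := by
  have key : ∀ O a l', List.foldr (fun x acc => if q O a x = true then x :: acc else acc) [] l'
      = List.filter (q O a) l' := by
    intro O a l'
    induction l' with
    | nil => rfl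
    | cons x l' ih => rw [List.foldr_cons, ih, List.filter_cons]
  obtain ⟨T, hT, hTl⟩ := hl.exists_csize_le
  have h := foldr (b := fun _ _ => ([] : List X))
    (step := fun O a x acc => if q O a x = true then x :: acc else acc) hl (const _)
    (ite (hq.comp (prodMk id.fst id.snd.fst)) (cons id.snd.fst id.snd.snd) id.snd.snd) hT
    (fun O a l' hl' => by
      rw [key]
      exact ((csize_le_of_sublist List.filter_sublist).trans (csize_le_of_suffix hl')).trans
        (hTl O a))
  simpa only [key] using h

theorem map {l : Oracle → A → List X} {f : Oracle → A → X → Y} (hl : PolyTime l)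
    (hf : PolyTime fun O (z : A × X) => f O z.1 z.2) :
    PolyTime fun O a => (l O a).map (f O a) := by
  obtain ⟨T, hT, hTl⟩ := hl.exists_csize_le
  obtain ⟨T', hT', hTf⟩ := hf.exists_csize_le
  have h := foldr (b := fun _ _ => ([] : List Y)) (step := fun O a x acc => f O a x :: acc)
    hl (const _) (cons (hf.comp (prodMk id.fst id.snd.fst)) id.snd.snd)
    (S := fun n => T n * (T' (n + T n + 1) + 1) + 1)
    ((hT.mul ((hT'.comp ((PolyGrowth.id.add hT).add (.const 1))).add (.const 1))).add (.const 1))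
    (fun O a l' hl' => by
      have key : List.foldr (fun x acc => f O a x :: acc) [] l' = l'.map (f O a) := by
        induction l' with
        | nil => rfl
        | cons x l' ih => rw [List.foldr_cons, ih ((List.suffix_cons x l').trans hl')]; rfl
      rw [key]
      have hs := (csize_le_of_suffix hl').trans (hTl O a)
      refine (csize_le_mul (m := T' (csize a + T (csize a) + 1)) ?_).trans ?_
      · intro y hy
        obtain ⟨x, hx, rfl⟩ := List.mem_map.1 hy
        refine (hTf O (a, x)).trans (hT'.1 ?_)
        have := (csize_le_of_mem hx).trans hs
        rw [csize_prod]
        dsimp only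
        omega
      · have := (length_le_csize l').trans hs
        rw [List.length_map]
        gcongr)
  refine h.of_code_eq (fun a => a) (fun _ => rfl) fun O a => ?_
  congr 1
  induction l O a with
  | nil => rfl
  | cons x l ih => rw [List.map_cons, ih]; rfl

theorem all {l : Oracle → A → List X} {q : Oracle → A → X → Bool} (hl : PolyTime l)
    (hq : PolyTime fun O (z : A × X) => q O z.1 z.2) :
    PolyTime fun O a => (l O a).all (q O a) := by
  have h := foldr (b := fun _ _ => true) (step := fun O a x acc => q O a x && acc) hl (const _)
    (and (hq.comp (prodMk id.fst id.snd.fst)) id.snd.snd) (PolyGrowth.const 3)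
    (fun O a l' _ => csize_bool _)
  refine h.of_code_eq (fun a => a) (fun _ => rfl) fun O a => ?_
  congr 1
  induction l O a with
  | nil => rfl
  | cons x l ih => rw [List.all_cons, ih]; rfl

theorem mem [∀ (x : X) (l : List X), Decidable (x ∈ l)] (hX : Function.Injective (code : X → Data)) {x : Oracle → A → X}
    {l : Oracle → A → List X} (hx : PolyTime x) (hl : PolyTime l) :
    PolyTime fun O a => decide (x O a ∈ l O a) := by
  classical
  have h := not (all hl (q := fun O a y => !decide (x O a = y))
    (not (eq hX (hx.comp id.fst) id.snd)))
  refine h.of_code_eq (fun a => a) (fun _ => rfl) fun O a => ?_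
  congr 1
  rw [Bool.eq_iff_iff]
  simp

theorem append {l l' : Oracle → A → List X} (hl : PolyTime l) (hl' : PolyTime l') :
    PolyTime fun O a => l O a ++ l' O a := by
  obtain ⟨T, hT, hTl⟩ := hl.exists_csize_le
  obtain ⟨T', hT', hTl'⟩ := hl'.exists_csize_le
  have key : ∀ m m' : List X, m.foldr (fun x acc => x :: acc) m' = m ++ m' := by
    intro m m'
    induction m with
    | nil => rfl
    | cons x m ih => rw [List.foldr_cons, ih]; rfl
  have h := foldr (step := fun _ _ x acc => x :: acc) hl hl' (cons id.snd.fst id.snd.snd)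
    (hT.add hT') (fun O a m hm => by
      rw [key]
      have := csize_append m (l' O a)
      have := (csize_le_of_suffix hm).trans (hTl O a)
      have := hTl' O a
      omega)
  simpa only [key] using h

/-- The index list belongs to the program and not to the input, so the map is unrolled. -/
theorem map_const {ι : Type} (I : List ι) {f : ι → Oracle → A → B} (hf : ∀ i, PolyTime (f i)) :
    PolyTime fun O a => I.map fun i => f i O a := by
  induction I with
  | nil => exact const []
  | cons i I ih => exact cons (hf i) ih

instance : Coded Unit := ⟨fun _ => .nil⟩

/-- Unary numbers double as lists of units, so counting loops are recursions along lists. -/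
theorem code_replicate (n : ℕ) : code (List.replicate n ()) = code n := by
  induction n with
  | zero => rfl
  | succ n ih => rw [List.replicate_succ, code_cons, ih]; rfl

theorem replicate {m : Oracle → A → ℕ} (hm : PolyTime m) :
    PolyTime fun O a => List.replicate (m O a) () :=
  hm.of_code_eq (fun a => a) (fun _ => rfl) fun _ _ => code_replicate _

theorem length {l : Oracle → A → List X} (hl : PolyTime l) : PolyTime fun O a => (l O a).length := by
  obtain ⟨T, hT, hTl⟩ := hl.exists_csize_le
  have key : ∀ m : List X, m.foldr (fun _ acc => acc + 1) 0 = m.length := by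
    intro m
    induction m with
    | nil => rfl
    | cons x m ih => rw [List.foldr_cons, ih]; rfl
  have h := foldr (b := fun _ _ => 0) (step := fun _ _ _ acc => acc + 1) hl (const _)
    (succ id.snd.snd) (S := fun n => 2 * T n + 1)
    (((PolyGrowth.const 2).mul hT).add (.const 1)) (fun _ _ m hm => by
      rw [key, csize_nat]
      have := (length_le_csize m).trans ((csize_le_of_suffix hm).trans (hTl _ _))
      omega)
  simpa only [key] using h

theorem nat_add {m n : Oracle → A → ℕ} (hm : PolyTime m) (hn : PolyTime n) :
    PolyTime fun O a => m O a + n O a := by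
  have h := length (append (replicate hm) (replicate hn))
  simpa using h

theorem const_mul (c : ℕ) {n : Oracle → A → ℕ} (hn : PolyTime n) :
    PolyTime fun O a => c * n O a := by
  induction c with
  | zero => simpa using const (A := A) 0
  | succ c ih => simpa only [Nat.succ_mul] using nat_add ih hn

/-- The numbers `n - 1, …, 0`. -/
def countdown : ℕ → List ℕ
  | 0 => []
  | n + 1 => n :: countdown n

theorem mem_countdown {n i : ℕ} : i ∈ countdown n ↔ i < n := by
  induction n with
  | zero => simp [countdown]
  | succ n ih => rw [countdown, List.mem_cons, ih]; omega

theorem nodup_countdown (n : ℕ) : (countdown n).Nodup := by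
  induction n with
  | zero => exact List.nodup_nil
  | succ n ih => exact List.nodup_cons.2 ⟨by simp [mem_countdown], ih⟩

theorem length_countdown (n : ℕ) : (countdown n).length = n := by
  induction n with
  | zero => rfl
  | succ n ih => rw [countdown, List.length_cons, ih]

theorem polyTime_countdown {n : Oracle → A → ℕ} (hn : PolyTime n) :
    PolyTime fun O a => countdown (n O a) := by
  obtain ⟨T, hT, hTn⟩ := hn.exists_csize_le
  have key : ∀ m : List Unit, m.foldr (fun _ acc => acc.length :: acc) [] = countdown m.length := by
    intro m
    induction m with
    | nil => rfl
    | cons x m ih => rw [List.foldr_cons, ih, length_countdown]; rfl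
  have h := foldr (b := fun _ _ => ([] : List ℕ)) (step := fun _ _ _ acc => acc.length :: acc)
    (replicate hn) (const _) (cons (length id.snd.snd) id.snd.snd)
    (S := fun n => T n * (2 * T n + 1 + 1) + 1)
    ((hT.mul ((((PolyGrowth.const 2).mul hT).add (.const 1)).add (.const 1))).add (.const 1))
    (fun O a m hm => by
      rw [key]
      have h1 := hm.length_le
      rw [List.length_replicate] at h1
      have h2 := hTn O a
      rw [csize_nat] at h2
      refine (csize_le_mul (m := 2 * T (csize a) + 1) ?_).trans ?_
      · intro i hi
        rw [mem_countdown] at hi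
        rw [csize_nat]
        omega
      · rw [length_countdown]
        have : m.length ≤ T (csize a) := by omega
        gcongr)
  simpa only [key, List.length_replicate] using h

theorem length_eq_const (s : ℕ) : PolyTime fun _ (l : List X) => decide (l.length = s) := by
  induction s with
  | zero =>
    exact list_cases id (const true) (const false) (fun _ l hl => by simp_all)
      (fun _ l x xs hl => by simp_all)
  | succ s ih =>
    exact list_cases id (const false) (ih.comp id.snd.snd) (fun _ l hl => by simp_all)
      (fun _ l x xs hl => by simp_all)

end PolyTime

/-! ### Injectivity of encodings -/

theorem encNat_injective : Function.Injective encNat := by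
  intro m
  induction m with
  | zero => intro n h; cases n <;> simp_all [encNat]
  | succ m ih =>
    intro n h
    cases n with
    | zero => simp [encNat] at h
    | succ n => simp only [encNat, Data.node.injEq, true_and] at h; rw [ih h]

theorem encBool_injective : Function.Injective encBool := by
  intro a b h
  cases a <;> cases b <;> simp_all [encBool]

theorem encList_injective {A : Type*} {enc : A → Data} (h : Function.Injective enc) :
    Function.Injective (encList enc) := by
  intro l
  induction l with
  | nil => intro l' h; cases l' <;> simp_all [encList]
  | cons a l ih =>
    intro l' h'
    cases l' with
    | nil => simp [encList] at h'
    | cons b l' =>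
      simp only [encList, Data.node.injEq] at h'
      rw [h h'.1, ih h'.2]

theorem code_data_injective : Function.Injective (code : Data → Data) := Function.injective_id

theorem code_list_injective : Function.Injective (code : List Data → Data) :=
  encList_injective code_data_injective

/-! ### The container algorithm runs in polynomial time -/

namespace PolyTime

variable {A : Type} [Coded A] {light : Oracle → A → ℕ → List (List Data) → Bool}
  {s : Oracle → A → Data → Bool}

theorem mem_data {x : Oracle → A → Data} {l : Oracle → A → List Data} (hx : PolyTime x)
    (hl : PolyTime l) : PolyTime fun O a => decide (x O a ∈ l O a) :=
  mem code_data_injective hx hl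

theorem through {u : Oracle → A → Data} {Q : Oracle → A → List (List Data)} (hu : PolyTime u)
    (hQ : PolyTime Q) : PolyTime fun O a => SatContainer.through (u O a) (Q O a) :=
  filter hQ (mem_data (hu.comp id.fst) id.snd)

theorem within {C : Oracle → A → List Data} {Q : Oracle → A → List (List Data)} (hC : PolyTime C)
    (hQ : PolyTime Q) : PolyTime fun O a => SatContainer.within (C O a) (Q O a) :=
  filter hQ (all (q := fun O (z : A × List Data) u => decide (u ∈ C O z.1)) id.snd
    (mem_data id.snd (hC.comp id.fst.fst)))

theorem openLink {calm : Oracle → A → Data → Bool} {v : Oracle → A → Data}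
    {Q : Oracle → A → List (List Data)} (hcalm : PolyTime fun O (z : A × Data) => calm O z.1 z.2)
    (hv : PolyTime v) (hQ : PolyTime Q) :
    PolyTime fun O a => SatContainer.openLink (calm O a) (v O a) (Q O a) :=
  filter hQ (and (mem_data (hv.comp id.fst) id.snd)
    (all (q := fun O (z : A × List Data) u => decide (u = v O z.1) || calm O z.1 u) id.snd
      (or (data_eq id.snd (hv.comp id.fst.fst)) (hcalm.comp (prodMk id.fst.fst id.snd)))))

theorem csize_map_remove_le (v : Data) (F : List (List Data)) :
    csize (F.map (remove v)) ≤ csize F := by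
  induction F with
  | nil => exact le_rfl
  | cons A F ih =>
    have : csize (remove v A) ≤ csize A := csize_le_of_sublist List.filter_sublist
    rw [List.map_cons, csize_cons, csize_cons]
    omega

/-- Each vertex adds at most one link, no larger than `Q`. This keeps the intermediate results of
the recursion polynomial. -/
theorem csize_pass_snd_le (light : ℕ → List (List Data) → Bool) (s : Data → Bool) (l r : ℕ)
    (Q : List (List Data)) (X : List Data) :
    csize (SatContainer.pass light s l r Q X).2 ≤ X.length * csize Q + 1 := by
  induction X with
  | nil => simp [SatContainer.pass]
  | cons v X ih =>
    rw [pass_cons, passStep, List.length_cons, Nat.succ_mul]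
    split
    · omega
    · split
      · set F := SatContainer.openLink
          (fun u => light r (SatContainer.through u (SatContainer.pass light s l r Q X).2)) v Q
        have h1 : csize F ≤ csize Q := csize_le_of_sublist List.filter_sublist
        have h2 := csize_map_remove_le v F
        have h3 := csize_append (F.map (remove v)) (SatContainer.pass light s l r Q X).2
        dsimp only
        omega
      · dsimp only; omega

theorem passStep (hlight : ∀ c, PolyTime fun O (z : A × List (List Data)) => light O z.1 c z.2)
    (hs : PolyTime fun O (z : A × Data) => s O z.1 z.2) (l r : ℕ)
    {Q : Oracle → A → List (List Data)} (hQ : PolyTime Q) :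
    PolyTime fun O (z : A × Data × (List Data × List (List Data))) =>
      SatContainer.passStep (light O z.1) (s O z.1) l r (Q O z.1) z.2.1 z.2.2 := by
  have hF : PolyTime fun O (z : A × Data × (List Data × List (List Data))) =>
      SatContainer.openLink (fun u => light O z.1 r (SatContainer.through u z.2.2.2)) z.2.1
        (Q O z.1) :=
    openLink ((hlight r).comp (prodMk id.fst.fst (through id.snd id.fst.snd.snd.snd)))
      id.snd.fst (hQ.comp id.fst)
  exact ite ((hlight l).comp (prodMk id.fst hF)) id.snd.snd
    (prodMk (cons id.snd.fst id.snd.snd.fst)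
      (ite (hs.comp (prodMk id.fst id.snd.fst))
        (append (map hF (f := fun _ z A => remove z.2.1 A)
          (filter id.snd (not (data_eq id.snd id.fst.fst.snd.fst)))) id.snd.snd.snd)
        id.snd.snd.snd))

theorem pass (hlight : ∀ c, PolyTime fun O (z : A × List (List Data)) => light O z.1 c z.2)
    (hs : PolyTime fun O (z : A × Data) => s O z.1 z.2) (l r : ℕ)
    {Q : Oracle → A → List (List Data)} {X : Oracle → A → List Data} (hQ : PolyTime Q)
    (hX : PolyTime X) :
    PolyTime fun O a => SatContainer.pass (light O a) (s O a) l r (Q O a) (X O a) := by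
  obtain ⟨T, hT, hTQ⟩ := hQ.exists_csize_le
  obtain ⟨T', hT', hTX⟩ := hX.exists_csize_le
  refine foldr (b := fun _ _ => (([], []) : List Data × List (List Data)))
    (step := fun O a => SatContainer.passStep (light O a) (s O a) l r (Q O a)) hX (const _)
    (passStep hlight hs l r hQ) (S := fun n => T' n + (T' n * T n + 1) + 1)
    ((hT'.add ((hT'.mul hT).add (.const 1))).add (.const 1)) fun O a m hm => ?_
  have h0 := (csize_le_of_suffix hm).trans (hTX O a)
  have h1 := csize_le_of_sublist
    (pass_fst_sublist (light := light O a) (s := s O a) (l := l) (r := r) (Q := Q O a) m)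
  have h2 := csize_pass_snd_le (light O a) (s O a) l r (Q O a) m
  have h3 : m.length * csize (Q O a) ≤ T' (csize a) * T (csize a) :=
    Nat.mul_le_mul ((length_le_csize m).trans h0) (hTQ O a)
  rw [csize_prod]
  simp only [SatContainer.pass] at h1 h2
  omega

/-- The number of passes and the thresholds are constants of the program, so this is a fixed number
of compositions and the degree of the polynomial does not depend on the input. -/
theorem levels (hlight : ∀ c, PolyTime fun O (z : A × List (List Data)) => light O z.1 c z.2)
    (hs : PolyTime fun O (z : A × Data) => s O z.1 z.2) (l : ℕ → ℕ) (R j t : ℕ)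
    {Q : Oracle → A → List (List Data)} {X : Oracle → A → List Data} (hQ : PolyTime Q)
    (hX : PolyTime X) :
    PolyTime fun O a => SatContainer.levels (light O a) (s O a) l R j t (Q O a) (X O a) := by
  have hsingle : PolyTime fun O (z : A × Data) => decide ([z.2] ∈ Q O z.1) :=
    mem code_list_injective (cons id.snd (const [])) (hQ.comp id.fst)
  induction j generalizing t Q X with
  | zero => exact filter hX (not hsingle)
  | succ j ih =>
    have hP := pass hlight hs (l t) (2 * R * l t) hQ hX
    have hX' : PolyTime fun O a => survivors (s O a) (Q O a)
        (SatContainer.pass (light O a) (s O a) (l t) (2 * R * l t) (Q O a) (X O a)).1 (X O a) :=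
      filter hX (and (not hsingle) (or hs (not (mem_data id.snd (hP.fst.comp id.fst)))))
    exact ih (t + 1) hP.snd hX' (mem code_list_injective (cons id.snd (const []))
      (hP.snd.comp id.fst))

theorem rounds (hlight : ∀ c, PolyTime fun O (z : A × List (List Data)) => light O z.1 c z.2)
    (hs : PolyTime fun O (z : A × Data) => s O z.1 z.2) (l : ℕ → ℕ) (R j i : ℕ)
    {H : Oracle → A → List (List Data)} {X : Oracle → A → List Data} (hH : PolyTime H)
    (hX : PolyTime X) :
    PolyTime fun O a => SatContainer.rounds (light O a) (s O a) l R j (H O a) i (X O a) := by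
  induction i generalizing X with
  | zero => exact hX
  | succ i ih => exact ih (levels hlight hs l R j 0 (within hX hH) hX)

end PolyTime

/-! ### Enumeration of small subsets -/

/-- The number of subsets of size at most `m` of a set of size `n`. -/
def numSubsets : ℕ → ℕ → ℕ
  | 0, _ => 1
  | n + 1, 0 => numSubsets n 0
  | n + 1, m + 1 => numSubsets n (m + 1) + numSubsets n m

theorem numSubsets_pos (n m : ℕ) : 0 < numSubsets n m := by
  induction n generalizing m with
  | zero => simp [numSubsets]
  | succ n ih =>
    cases m with
    | zero => exact ih 0
    | succ m => exact Nat.add_pos_left (ih _) _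

section Enumerate

variable {X Y : Type}

/-- Run through the subsets of size at most `m` of a list (added to `S`), and collect the results of
`leaf` in two lists. -/
def enumerate (leaf : List X → List (Y × Y)) :
    List X → ℕ → List X → List Y × List Y → List Y × List Y
  | [], _, S, acc =>
    match leaf S with
    | [] => acc
    | q :: _ => (q.1 :: acc.1, q.2 :: acc.2)
  | _ :: l, 0, S, acc => enumerate leaf l 0 S acc
  | v :: l, m + 1, S, acc => enumerate leaf l m (v :: S) (enumerate leaf l (m + 1) S acc)

/-- The bound on the output follows the Pascal recursion of `numSubsets`. Chosen elements are pushed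
onto `S`, which is why leaves see the sublist reversed. -/
theorem enumerate_spec (leaf : List X → List (Y × Y)) (l : List X) (m : ℕ) (S : List X)
    (acc : List Y × List Y) :
    ∃ E : List (Y × Y), enumerate leaf l m S acc = (E.map Prod.fst ++ acc.1, E.map Prod.snd ++ acc.2) ∧
      E.length ≤ numSubsets l.length m ∧
      ∀ q, q ∈ E ↔ ∃ T : List X, T.Sublist l ∧ T.length ≤ m ∧
        (leaf (T.reverse ++ S)).head? = some q := by
  induction l generalizing m S acc with
  | nil =>
    cases h : leaf S with
    | nil =>
      refine ⟨[], by simp [enumerate, h], by simp, fun q => ?_⟩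
      simp [h]
    | cons q₀ Q =>
      refine ⟨[q₀], by simp [enumerate, h], by simp [numSubsets], fun q => ?_⟩
      simp [h, eq_comm]
  | cons v l ih =>
    cases m with
    | zero =>
      obtain ⟨E, h1, h2, h3⟩ := ih 0 S acc
      refine ⟨E, h1, h2, fun q => (h3 q).trans ⟨?_, ?_⟩⟩
      · rintro ⟨T, hT, hT', h⟩
        exact ⟨T, hT.cons v, hT', h⟩
      · rintro ⟨T, hT, hT', h⟩
        have : T = [] := List.length_eq_zero_iff.1 (by omega)
        subst this
        exact ⟨[], List.nil_sublist _, le_rfl, h⟩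
    | succ m =>
      obtain ⟨E₁, h1, h2, h3⟩ := ih (m + 1) S acc
      obtain ⟨E₂, h4, h5, h6⟩ := ih m (v :: S) (enumerate leaf l (m + 1) S acc)
      refine ⟨E₂ ++ E₁, ?_, ?_, fun q => ?_⟩
      · rw [enumerate, h4, h1]
        simp
      · rw [List.length_append, List.length_cons, numSubsets]
        omega
      · rw [List.mem_append, h3, h6]
        constructor
        · rintro (⟨T, hT, hT', h⟩ | ⟨T, hT, hT', h⟩)
          · exact ⟨v :: T, hT.cons_cons v, by simpa using hT', by simpa using h⟩
          · exact ⟨T, hT.cons v, hT', h⟩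
        · rintro ⟨T, hT, hT', h⟩
          cases hT with
          | cons _ hT => exact Or.inr ⟨T, hT, hT', h⟩
          | cons_cons _ hT => exact Or.inl ⟨_, hT, by simpa using hT', by simpa using h⟩

variable {A Z : Type} [Coded A] [Coded X] [Coded Y] [Coded Z]

/-- The body of the function that enumerates; `self` is its index, and `e` evaluates leaves. -/
def enumerateBody (self : ℕ) (e : Expr) : Expr :=
  .split (.var 0) .nil <| .split (.var 1) .nil <| .split (.var 1) .nil <| .split (.var 1) .nil <|
  -- After the four splits, position 0 holds `S`, 1 the accumulator, 2 the budget `m`, 4 the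
  -- remaining list and 6 the context.
  .split (.var 4)
    (.split (.bind (.cons (.var 6) (.var 0)) e) (.var 1)
      (.split (.var 0) .nil <| .split (.var 5) .nil <|
        .cons (.cons (.var 2) (.var 0)) (.cons (.var 3) (.var 1))))
    (.bind (.call self (.cons (.var 8) (.cons (.var 1) (.cons (.var 4) (.cons (.var 2) (.var 3))))))
      (.split (.var 5) (.var 0)
        (.call self (.cons (.var 11) (.cons (.var 4) (.cons (.var 1)
          (.cons (.cons (.var 3) (.var 5)) (.var 2))))))))

/-- Moving a vertex from `l` to `S` preserves the total size, so one bound `K` serves all leaves.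
The accumulator may be exponentially long, but it is only passed on and extended in front, so its
size does not enter the time. -/
theorem eval_enumerateBody {Q : Program} {e : Expr} {T : ℕ → ℕ}
    {leaf : Oracle → Z × List X → List (Y × Y)} (hT : PolyGrowth T) (he : Realizes Q e T leaf)
    {P : Program} (hP : Q ++ [enumerateBody (Q.length + 1) e] <+: P) (main : Expr) (O : Oracle)
    (z : Z) (K : ℕ) (l : List X) (m : ℕ) (S : List X) (acc : List Y × List Y)
    (hK : csize z + csize S + csize l ≤ K) :
    ∃ t, Eval O (main :: P) [code (z, l, m, S, acc)] (enumerateBody (Q.length + 1) e)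
      (code (enumerate (fun S => leaf O (z, S)) l m S acc)) t ∧
      t ≤ numSubsets l.length m * (T K + 100 * (l.length + 1)) := by
  have hbody := PolyTime.getElem?_cons_of_prefix hP main
  have hQP : Q <+: P := (List.prefix_append _ _).trans hP
  induction l generalizing m S acc with
  | nil =>
    obtain ⟨t, E, ht, -⟩ := he P hQP main O (z, S) [code S, code acc, code m, code (S, acc),
      .nil, code (m, S, acc), code z, code (([] : List X), m, S, acc),
      code (z, ([] : List X), m, S, acc)]
    have hle : T (csize (z, S)) ≤ T K := hT.1 (by
      simp only [csize_prod, csize_nil] at hK ⊢; omega)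
    cases h : leaf O (z, S) with
    | nil =>
      rw [h] at E
      refine ⟨_, .split_node (.var rfl) (.split_node (.var rfl) (.split_node (.var rfl)
        (.split_node (.var rfl) (.split_nil (.var rfl) (.split_nil
          (.bind (.cons (.var rfl) (.var rfl)) E) (.var ?_)))))), ?_⟩
      · simp [enumerate, h]
      · simp only [List.length_nil, numSubsets]
        omega
    | cons q R =>
      rw [h] at E
      refine ⟨_, .split_node (.var rfl) (.split_node (.var rfl) (.split_node (.var rfl)
        (.split_node (.var rfl) (.split_nil (.var rfl) (.split_node
          (.bind (.cons (.var rfl) (.var rfl)) E) (.split_node (x := code q.1) (y := code q.2)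
          (.var rfl) (.split_node (x := code acc.1) (y := code acc.2) (t := 7) (.var rfl)
            (v := code (enumerate (fun S => leaf O (z, S)) [] m S acc)) ?_))))))), ?_⟩
      · simp only [enumerate, h]
        exact .cons (.cons (.var rfl) (.var rfl)) (.cons (.var rfl) (.var rfl))
      · simp only [List.length_nil, numSubsets]
        omega
  | cons v l ih =>
    rw [csize_cons] at hK
    have hpos := numSubsets_pos l.length m
    obtain ⟨t₁, E₁, ht₁⟩ := ih m S acc (by omega)
    cases m with
    | zero =>
      refine ⟨_, .split_node (.var rfl) (.split_node (.var rfl) (.split_node (.var rfl)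
        (.split_node (.var rfl) (.split_node (x := code v) (y := code l) (.var rfl) (.bind
          (.call hbody (.cons (.var rfl) (.cons (.var rfl) (.cons (.var rfl) (.cons (.var rfl)
            (.var rfl))))) E₁) (.split_nil (.var rfl) (.var rfl))))))), ?_⟩
      rw [List.length_cons, numSubsets]
      nlinarith
    | succ m =>
      have hpos' := numSubsets_pos l.length m
      obtain ⟨t₂, E₂, ht₂⟩ := ih m (v :: S) (enumerate (fun S => leaf O (z, S)) l (m + 1) S acc)
        (by rw [csize_cons]; omega)
      refine ⟨_, .split_node (.var rfl) (.split_node (.var rfl) (.split_node (.var rfl)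
        (.split_node (.var rfl) (.split_node (x := code v) (y := code l) (.var rfl) (.bind
          (.call hbody (.cons (.var rfl) (.cons (.var rfl) (.cons (.var rfl) (.cons (.var rfl)
            (.var rfl))))) E₁) (.split_node (x := .nil) (y := code m) (.var rfl)
            (.call hbody (.cons (.var rfl) (.cons (.var rfl) (.cons (.var rfl) (.cons
              (.cons (.var rfl) (.var rfl)) (.var rfl))))) E₂))))))), ?_⟩
      rw [List.length_cons, numSubsets]
      nlinarith

/-- A program that enumerates small subsets after a polynomial time preparation. -/
theorem exists_program {prep : Oracle → A → Z × List X × ℕ}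
    {leaf : Oracle → Z × List X → List (Y × Y)} (hprep : PolyTime prep) (hleaf : PolyTime leaf) :
    ∃ (P : Program) (G : ℕ → ℕ), PolyGrowth G ∧ ∀ O a, ∃ t,
      P.Runs O (code a) (code (enumerate (fun S => leaf O ((prep O a).1, S)) (prep O a).2.1
        (prep O a).2.2 [] ([], []))) t ∧
      t ≤ numSubsets (prep O a).2.1.length (prep O a).2.2 * G (csize a) := by
  obtain ⟨Q₁, -, e₁, T₁, hT₁, H₁⟩ := hprep []
  obtain ⟨Q₂, h₂, e₂, T₂, hT₂, H₂⟩ := hleaf Q₁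
  let main : Expr := .bind e₁ <| .split (.var 0) .nil <| .split (.var 1) .nil <|
    .call (Q₂.length + 1) (.cons (.var 2) (.cons (.var 0) (.cons (.var 1)
      (.cons .nil (.cons .nil .nil)))))
  refine ⟨main :: (Q₂ ++ [enumerateBody (Q₂.length + 1) e₂]),
    fun n => T₁ n + (T₂ (T₁ n + 1) + 100 * (T₁ n + 1)) + 100,
    (hT₁.add ((hT₂.comp (hT₁.add (.const 1))).add
      ((PolyGrowth.const 100).mul (hT₁.add (.const 1))))).add (.const 100), fun O a => ?_⟩
  have hP : Q₂ ++ [enumerateBody (Q₂.length + 1) e₂]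
    <+: Q₂ ++ [enumerateBody (Q₂.length + 1) e₂] := List.prefix_refl _
  obtain ⟨t₁, E₁, ht₁, hs₁⟩ := H₁ _ ((h₂.trans (List.prefix_append _ _)).trans hP) main O a []
  obtain ⟨⟨z, X₀, m⟩, hz⟩ : ∃ q, prep O a = q := ⟨_, rfl⟩
  rw [hz] at E₁ hs₁
  simp only [csize_prod] at hs₁
  obtain ⟨t, E, ht⟩ := eval_enumerateBody hT₂ H₂ hP main O z (T₁ (csize a) + 1) X₀ m [] ([], [])
    (by rw [csize_nil]; have := csize_pos m; omega)
  rw [hz]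
  refine ⟨_, ⟨main, rfl, .bind E₁ (.split_node (x := code z) (y := code (X₀, m)) (.var rfl)
    (.split_node (x := code X₀) (y := code m) (.var rfl)
      (.call (PolyTime.getElem?_cons_of_prefix hP main) (.cons (.var rfl) (.cons (.var rfl)
        (.cons (.var rfl) (.cons .nil (.cons .nil .nil))))) E)))⟩, ?_⟩
  have hpos := numSubsets_pos X₀.length m
  have h1 := length_le_csize X₀
  have h2 : numSubsets X₀.length m * (T₂ (T₁ (csize a) + 1) + 100 * (X₀.length + 1))
      ≤ numSubsets X₀.length m * (T₂ (T₁ (csize a) + 1) + 100 * (T₁ (csize a) + 1)) := by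
    gcongr
    omega
  dsimp only
  have h3 : T₁ (csize a) + 100 ≤ numSubsets X₀.length m * (T₁ (csize a) + 100) :=
    Nat.le_mul_of_pos_left _ hpos
  have h4 : numSubsets X₀.length m * (T₁ (csize a)
      + (T₂ (T₁ (csize a) + 1) + 100 * (T₁ (csize a) + 1)) + 100)
      = numSubsets X₀.length m * (T₂ (T₁ (csize a) + 1) + 100 * (T₁ (csize a) + 1))
        + numSubsets X₀.length m * (T₁ (csize a) + 100) := by ring
  rw [h4]
  omega

end Enumerate

/-! ### Comparison of weights -/

/-- The number of members of `L` of size `s`, multiplied by `q`. -/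
def weightedCount {X : Type} (q s : ℕ) (L : List (List X)) : ℕ :=
  L.foldr (fun A acc => if decide (A.length = s) = true then q + acc else acc) 0

/-- The numbers of members of `L` of the sizes `0, …, k`, multiplied by `q`. -/
def profile {X : Type} (k q : ℕ) (L : List (List X)) : List ℕ :=
  (List.range (k + 1)).map fun s => weightedCount q s L

/-- The question whether the polynomial with coefficients `a` is at most `b`. -/
noncomputable def atMost (O : Oracle) (a : List ℕ) (b : ℕ) : Bool :=
  O.answer (.node (code a) (code b))

/-- The largest number, up to a bound, that is exceeded by the polynomial with coefficients `a`. -/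
noncomputable def search (O : Oracle) (a : List ℕ) (fuel : List Unit) : ℕ :=
  fuel.foldr (fun _ b => if atMost O a (b + 1) = true then b else b + 1) 0

theorem search_le (O : Oracle) (a : List ℕ) (fuel : List Unit) :
    search O a fuel ≤ fuel.length := by
  induction fuel with
  | nil => simp [search]
  | cons u fuel ih =>
    have : search O a (u :: fuel) = if atMost O a (search O a fuel + 1) = true
      then search O a fuel else search O a fuel + 1 := rfl
    rw [this, List.length_cons]
    split <;> omega

namespace PolyTime

variable {A X : Type} [Coded A] [Coded X]

theorem weightedCount (s : ℕ) {q : Oracle → A → ℕ} {L : Oracle → A → List (List X)}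
    (hq : PolyTime q) (hL : PolyTime L) :
    PolyTime fun O a => SatContainer.weightedCount (q O a) s (L O a) := by
  obtain ⟨T, hT, hTq⟩ := hq.exists_csize_le
  obtain ⟨T', hT', hTL⟩ := hL.exists_csize_le
  have key : ∀ q (L : List (List X)), SatContainer.weightedCount q s L ≤ L.length * q := by
    intro q L
    induction L with
    | nil => simp [SatContainer.weightedCount]
    | cons A L ih =>
      have : SatContainer.weightedCount q s (A :: L) = if decide (A.length = s) = true
        then q + SatContainer.weightedCount q s L else SatContainer.weightedCount q s L := rfl
      rw [this, List.length_cons, Nat.succ_mul]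
      split <;> omega
  refine foldr (b := fun _ _ => 0)
    (step := fun O a A acc => if decide (A.length = s) = true then q O a + acc else acc) hL (const _)
    (ite ((length_eq_const s).comp id.snd.fst) (nat_add (hq.comp id.fst) id.snd.snd) id.snd.snd)
    (S := fun n => 2 * (T' n * T n) + 1)
    (((PolyGrowth.const 2).mul (hT'.mul hT)).add (.const 1)) fun O a l' hl' => ?_
  have h1 := key (q O a) l'
  have h2 : l'.length * q O a ≤ T' (csize a) * T (csize a) := by
    refine Nat.mul_le_mul (((length_le_csize l').trans (csize_le_of_suffix hl')).trans (hTL O a)) ?_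
    have := hTq O a
    rw [csize_nat] at this
    omega
  rw [csize_nat]
  simp only [SatContainer.weightedCount] at h1
  omega

theorem profile (k : ℕ) {q : Oracle → A → ℕ} {L : Oracle → A → List (List X)} (hq : PolyTime q)
    (hL : PolyTime L) : PolyTime fun O a => SatContainer.profile k (q O a) (L O a) :=
  map_const (List.range (k + 1)) fun s => weightedCount s hq hL

theorem atMost {p : Oracle → A → List ℕ} {b : Oracle → A → ℕ} (hp : PolyTime p)
    (hb : PolyTime b) : PolyTime fun O a => SatContainer.atMost O (p O a) (b O a) :=
  ask (node hp.as_data hb.as_data)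

theorem search {p : Oracle → A → List ℕ} {f : Oracle → A → ℕ} (hp : PolyTime p)
    (hf : PolyTime f) :
    PolyTime fun O a => SatContainer.search O (p O a) (List.replicate (f O a) ()) := by
  obtain ⟨T, hT, hTf⟩ := hf.exists_csize_le
  refine foldr (b := fun _ _ => 0)
    (step := fun O a _ b => if SatContainer.atMost O (p O a) (b + 1) = true then b else b + 1)
    (replicate hf) (const _)
    (ite (atMost (hp.comp id.fst) (succ id.snd.snd)) id.snd.snd (succ id.snd.snd)) hT
    fun O a l' hl' => ?_
  have h1 := search_le O (p O a) l'
  have h2 := hTf O a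
  have h3 := hl'.length_le
  rw [List.length_replicate] at h3
  rw [csize_nat] at h2 ⊢
  simp only [SatContainer.search] at h1
  omega

end PolyTime

/-! ### The two parts of the program -/

/-- The literal with a given variable and sign. -/
def lit (b : Bool) (i : ℕ) : Data := .node (code i) (code b)

/-- The list of all literals. -/
def literals (n : ℕ) : List Data :=
  (PolyTime.countdown n).map (lit true) ++ (PolyTime.countdown n).map (lit false)

/-- A tree, as a list of trees. -/
def Data.toList : Data → List Data
  | .nil => []
  | .node x y => x :: y.toList

theorem code_toList (x : Data) : code x.toList = x := by
  induction x with
  | nil => rfl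
  | node x y _ ih => rw [Data.toList, code_cons, ih]; rfl

/-- Negation of written literals. -/
noncomputable def negate : List Data → Data
  | [] => .nil
  | i :: b => .node i (code (decide (b = [])))

/-- The context of a run: the vertices, the edges, a lower bound for the weight of all edges, and
the variables. -/
abbrev Context := List Data × List (List Data) × ℕ × List ℕ

/-- The test for light families of sets. -/
noncomputable def lightTest (k : ℕ) (O : Oracle) (z : Context) (c : ℕ) (L : List (List Data)) :
    Bool :=
  atMost O (profile k (c * z.1.length) L) z.2.2.1

/-- The container of the vertices selected by `s`. -/
noncomputable def container (k : ℕ) (l : ℕ → ℕ) (R : ℕ) (O : Oracle) (z : Context)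
    (s : Data → Bool) : List Data :=
  rounds (lightTest k O z) s l R (k - 1) z.2.1 R z.1

/-- The conditions under which a container is accepted. -/
noncomputable def accepted (k m : ℕ) (O : Oracle) (z : Context) (C : List Data) : Bool :=
  atMost O (profile k m (within C z.2.1)) z.2.2.1 &&
    z.2.2.2.all fun i => decide (lit true i ∈ C) || decide (lit false i ∈ C)

/-- The fingerprint and the container for `S`, if the container is accepted. -/
noncomputable def leafResult (k m : ℕ) (l : ℕ → ℕ) (R : ℕ) (O : Oracle) (z : Context × List Data) :
    List (List Data × List Data) :=
  if accepted k m O z.1 (container k l R O z.1 fun v => decide (v ∈ z.2)) = true then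
    [(z.2, container k l R O z.1 fun v => decide (v ∈ z.2))]
  else []

/-- The edges that belong to written clauses. -/
noncomputable def edgesOf (L : List (List Data)) : List (List Data) :=
  L.map fun K => K.map fun v => negate v.toList

/-- The preparation of the enumeration of fingerprints. -/
noncomputable def prepare (k m : ℕ) (O : Oracle) (a : ℕ × List (List Data)) :
    Context × List Data × ℕ :=
  ((literals a.1, edgesOf a.2, search O (profile k 1 (edgesOf a.2))
      (List.replicate (m * (edgesOf a.2).length) ()), PolyTime.countdown a.1),
    literals a.1, search O [0, 4 * k ^ 2 * a.1] (List.replicate (literals a.1).length ()))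

/-! ### Polynomial time for the preparation and for a single candidate -/

namespace PolyTime

variable {A : Type} [Coded A]

theorem lit (b : Bool) {i : Oracle → A → ℕ} (hi : PolyTime i) :
    PolyTime fun O a => SatContainer.lit b (i O a) :=
  node hi.as_data (const _)

theorem literals {n : Oracle → A → ℕ} (hn : PolyTime n) :
    PolyTime fun O a => SatContainer.literals (n O a) :=
  append (map (f := fun _ _ i => SatContainer.lit true i) (polyTime_countdown hn) (lit true id.snd))
    (map (f := fun _ _ i => SatContainer.lit false i) (polyTime_countdown hn) (lit false id.snd))

theorem negate {x : Oracle → A → List Data} (hx : PolyTime x) :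
    PolyTime fun O a => SatContainer.negate (x O a) := by
  refine list_cases (f := fun _ _ => Data.nil)
    (g := fun _ q => .node q.2.1 (code (decide (q.2.2 = [])))) hx (const _)
    (node id.snd.fst (eq code_list_injective id.snd.snd (const [])).as_data) ?_ ?_
  · intro O a h; rw [h]; rfl
  · intro O a x xs h; rw [h]; rfl

theorem toList {x : Oracle → A → Data} (hx : PolyTime x) :
    PolyTime fun O a => (x O a).toList :=
  hx.of_code_eq (fun a => a) (fun _ => rfl) fun _ _ => code_toList _

theorem edgesOf {L : Oracle → A → List (List Data)} (hL : PolyTime L) :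
    PolyTime fun O a => SatContainer.edgesOf (L O a) :=
  map (f := fun _ _ (K : List Data) => K.map fun (v : Data) => SatContainer.negate v.toList) hL
    (map (f := fun _ _ (v : Data) => SatContainer.negate v.toList) id.snd (negate (toList id.snd)))

theorem prepare (k m : ℕ) : PolyTime (SatContainer.prepare k m) := by
  have hX : PolyTime fun _ (a : ℕ × List (List Data)) => SatContainer.literals a.1 :=
    literals id.fst
  have hH : PolyTime fun _ (a : ℕ × List (List Data)) => SatContainer.edgesOf a.2 :=
    edgesOf id.snd
  exact prodMk (prodMk hX (prodMk hH (prodMk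
    (search (profile k (const 1) hH) (const_mul m (length hH))) (polyTime_countdown id.fst))))
    (prodMk hX (search (cons (const 0) (cons (const_mul _ id.fst) (const []))) (length hX)))

theorem lightTest (k c : ℕ) {z : Oracle → A → Context} {L : Oracle → A → List (List Data)}
    (hz : PolyTime z) (hL : PolyTime L) :
    PolyTime fun O a => SatContainer.lightTest k O (z O a) c (L O a) :=
  atMost (profile k (const_mul c (length hz.fst)) hL) hz.snd.snd.fst

theorem leafResult (k m : ℕ) (l : ℕ → ℕ) (R : ℕ) :
    PolyTime (SatContainer.leafResult k m l R) := by
  have hC : PolyTime fun O (z : Context × List Data) =>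
      container k l R O z.1 fun v => decide (v ∈ z.2) :=
    rounds (light := fun O (z : Context × List Data) => SatContainer.lightTest k O z.1)
      (s := fun _ (z : Context × List Data) v => decide (v ∈ z.2))
      (fun c => lightTest k c id.fst.fst id.snd) (mem_data id.snd id.fst.snd) l R (k - 1) R
      id.fst.snd.fst id.fst.fst
  have hacc : PolyTime fun O (z : Context × List Data) =>
      accepted k m O z.1 (container k l R O z.1 fun v => decide (v ∈ z.2)) :=
    and (atMost (profile k (const m) (within hC id.fst.snd.fst)) id.fst.snd.snd.fst)
      (all (q := fun O (z : Context × List Data) i =>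
          decide (SatContainer.lit true i ∈ container k l R O z.1 fun v => decide (v ∈ z.2)) ||
          decide (SatContainer.lit false i ∈ container k l R O z.1 fun v => decide (v ∈ z.2)))
        id.fst.snd.snd.snd (or (mem_data (lit true id.snd) (hC.comp id.fst))
          (mem_data (lit false id.snd) (hC.comp id.fst))))
  exact ite hacc (cons (prodMk id.snd hC) (const [])) (const [])

end PolyTime

/-! ### The answers of the weight oracle -/

/-- The `p`-weight of a set that is given by a list, if its size is at most `k`. -/
noncomputable def cappedPow (p : ℝ) (k : ℕ) {X : Type} (A : List X) : ℝ :=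
  if A.length ≤ k then p ^ A.length else 0

theorem atMost_iff {p δ : ℝ} (a : List ℕ) (b : ℕ) :
    atMost (weightOracle p δ) a b = true ↔
      ∑ s : Fin a.length, (a.get s : ℝ) * p ^ (s : ℕ) ≤ b * δ := by
  rw [atMost, Oracle.answer_iff, weightOracle]
  constructor
  · rintro ⟨a', b', h, hle⟩
    rw [Data.node.injEq] at h
    obtain rfl : a = a' := encList_injective encNat_injective h.1
    obtain rfl : b = b' := encNat_injective h.2
    exact hle
  · intro h
    exact ⟨a, b, rfl, h⟩

/-- Sorting the members by size turns a mass into a polynomial in `p`. Sizes above `k` are not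
recorded, which is why the weight is capped. -/
theorem sum_range_weightedCount (p : ℝ) {X : Type} (k q : ℕ) (L : List (List X)) :
    ∑ s ∈ Finset.range (k + 1), (weightedCount q s L : ℝ) * p ^ s
      = q * mass (cappedPow p k) L := by
  induction L with
  | nil => simp [weightedCount]
  | cons A L ih =>
    have h : ∀ s, (weightedCount q s (A :: L) : ℝ)
        = (if A.length = s then (q : ℝ) else 0) + weightedCount q s L := by
      intro s
      have : weightedCount q s (A :: L) = if decide (A.length = s) = true
        then q + weightedCount q s L else weightedCount q s L := rfl
      rw [this]
      by_cases h : A.length = s <;> simp [h]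
    simp only [h, add_mul, Finset.sum_add_distrib, ih, mass_cons, mul_add, ite_mul, zero_mul,
      Finset.sum_ite_eq, Finset.mem_range, Order.lt_add_one_iff, cappedPow, mul_ite, mul_zero]

theorem sum_profile (p : ℝ) {X : Type} (k q : ℕ) (L : List (List X)) :
    ∑ s : Fin (profile k q L).length, ((profile k q L).get s : ℝ) * p ^ (s : ℕ)
      = q * mass (cappedPow p k) L := by
  have hlen : (profile k q L).length = k + 1 := by simp [profile]
  rw [← sum_range_weightedCount, ← hlen,
    ← Fin.sum_univ_eq_sum_range (fun s => (weightedCount q s L : ℝ) * p ^ s)]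
  refine Finset.sum_congr rfl fun s _ => ?_
  rw [List.get_eq_getElem]
  simp [profile]

theorem atMost_profile {p δ : ℝ} {X : Type} (k q : ℕ) (L : List (List X)) (b : ℕ) :
    atMost (weightOracle p δ) (profile k q L) b = true ↔ q * mass (cappedPow p k) L ≤ b * δ := by
  rw [atMost_iff, sum_profile]

/-- The counter advances only after a negative answer and stays put once the answer is positive; the
two alternatives cover a counter that never moved and a search that ran out of fuel. -/
theorem search_spec {p δ : ℝ} (a : List ℕ) (fuel : List Unit) :
    (search (weightOracle p δ) a fuel = 0 ∨ search (weightOracle p δ) a fuel * δ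
        < ∑ s : Fin a.length, (a.get s : ℝ) * p ^ (s : ℕ)) ∧
      (search (weightOracle p δ) a fuel = fuel.length ∨
        ∑ s : Fin a.length, (a.get s : ℝ) * p ^ (s : ℕ)
          ≤ (search (weightOracle p δ) a fuel + 1) * δ) := by
  induction fuel with
  | nil => simp [search]
  | cons u fuel ih =>
    have : search (weightOracle p δ) a (u :: fuel)
      = if atMost (weightOracle p δ) a (search (weightOracle p δ) a fuel + 1) = true
        then search (weightOracle p δ) a fuel else search (weightOracle p δ) a fuel + 1 := rfl
    rw [this]
    split
    · rename_i h
      rw [atMost_iff] at h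
      push_cast at h
      exact ⟨ih.1, Or.inr h⟩
    · rename_i h
      rw [atMost_iff, not_le] at h
      refine ⟨Or.inr h, ?_⟩
      rcases ih.2 with h' | h'
      · left; rw [h', List.length_cons]
      · push_cast at h; exact absurd h' (not_le.2 h)

/-- The number of vertices is multiplied into the coefficients, so the program can compare with `W =
b * δ / |V|` without dividing. -/
theorem lightTest_iff {p δ : ℝ} {k : ℕ} {z : Context} (hz : 0 < z.1.length) (c : ℕ)
    (L : List (List Data)) :
    lightTest k (weightOracle p δ) z c L = true ↔
      c * mass (cappedPow p k) L ≤ z.2.2.1 * δ / z.1.length := by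
  rw [lightTest, atMost_profile, le_div_iff₀ (by exact_mod_cast hz)]
  push_cast
  rw [mul_right_comm]

/-! ### Counting small subsets -/

/-- By Pascal's recursion the left side for `(n + 1, m + 1)` is the average, with weights `1 - x`
and `x`, of those for `(n, m + 1)` and `(n, m)`. The condition `x ≤ 1 / 2` is needed for `n = 0`. -/
theorem numSubsets_mul_le {x : ℝ} (h0 : 0 < x) (h1 : x ≤ 1 / 2) (n m : ℕ) :
    numSubsets n m * ((x / (1 - x)) ^ m * (1 - x) ^ n) ≤ 1 := by
  have hx : 0 < 1 - x := by linarith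
  induction n generalizing m with
  | zero =>
    simp only [numSubsets, Nat.cast_one, pow_zero, mul_one, one_mul]
    refine pow_le_one₀ (by positivity) ?_
    rw [div_le_one hx]
    linarith
  | succ n ih =>
    cases m with
    | zero =>
      have := ih 0
      simp only [numSubsets, pow_zero, one_mul] at this ⊢
      rw [pow_succ, ← mul_assoc]
      nlinarith
    | succ m =>
      have h2 := ih (m + 1)
      have h3 := ih m
      rw [numSubsets]
      push_cast
      have h4 : ((numSubsets n (m + 1) : ℝ) + numSubsets n m)
          * ((x / (1 - x)) ^ (m + 1) * (1 - x) ^ (n + 1))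
          = (1 - x) * (numSubsets n (m + 1) * ((x / (1 - x)) ^ (m + 1) * (1 - x) ^ n))
            + x * (numSubsets n m * ((x / (1 - x)) ^ m * (1 - x) ^ n)) := by
        have h5 : x / (1 - x) * (1 - x) = x := div_mul_cancel₀ x hx.ne'
        generalize x / (1 - x) = y at h5
        linear_combination (numSubsets n m * y ^ m * (1 - x) ^ n : ℝ) * h5
      rw [h4]
      nlinarith

/-- Since `x / (1 - x) ≤ 1`, the exponent `m` may be raised to `x * n`, and then the product in
`numSubsets_mul_le` becomes `2 ^ (-entropy x * n)`. The case `x = 0` is separate because the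
quotient has no logarithm. -/
theorem numSubsets_le {x : ℝ} (h0 : 0 ≤ x) (h1 : x ≤ 1 / 2) {n m : ℕ} (hm : m ≤ x * n) :
    (numSubsets n m : ℝ) ≤ 2 ^ (entropy x * n) := by
  rcases h0.eq_or_lt with rfl | h0
  · have : m = 0 := by
      rw [zero_mul] at hm
      exact_mod_cast le_antisymm hm (Nat.cast_nonneg m)
    subst this
    have : numSubsets n 0 = 1 := by
      clear hm
      induction n with
      | zero => rfl
      | succ n ih => rw [numSubsets, ih]
    rw [this]
    simp [entropy]
  · have hx : 0 < 1 - x := by linarith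
    have h2 := numSubsets_mul_le h0 h1 n m
    have h3 : 0 < (x / (1 - x)) ^ m * (1 - x) ^ n := by positivity
    rw [← le_div_iff₀ h3] at h2
    refine h2.trans ?_
    rw [one_div, ← Real.rpow_natCast, ← Real.rpow_natCast]
    have hr : 0 < x / (1 - x) := by positivity
    have h4 : (x / (1 - x)) ^ (x * n) ≤ (x / (1 - x)) ^ (m : ℝ) :=
      Real.rpow_le_rpow_of_exponent_ge hr (by rw [div_le_one hx]; linarith) hm
    have h5 : (2 : ℝ) ^ (entropy x * n) = ((x / (1 - x)) ^ (x * n) * (1 - x) ^ (n : ℝ))⁻¹ := by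
      have e1 : x / (1 - x) = 2 ^ (Real.logb 2 x - Real.logb 2 (1 - x)) := by
        rw [← Real.logb_div h0.ne' hx.ne', Real.rpow_logb (by norm_num) (by norm_num) hr]
      have e2 : (1 - x) ^ (n : ℝ) = 2 ^ (Real.logb 2 (1 - x) * n) := by
        rw [Real.rpow_mul (by norm_num), Real.rpow_logb (by norm_num) (by norm_num) hx]
      rw [e1, e2, ← Real.rpow_mul (by norm_num), ← Real.rpow_add (by norm_num), ← Real.rpow_neg (by norm_num)]
      congr 1
      rw [entropy]
      ring
    rw [h5]
    have h6 : 0 < (1 - x) ^ (n : ℝ) := by positivity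
    have h7 : 0 < (x / (1 - x)) ^ (x * n) := by positivity
    gcongr

/-! ### Written formulas -/

section Formula

variable {n : ℕ}

/-- The clauses of a formula, with trees as literals. -/
def dataClauses (L : List (List (Literal n))) : List (List Data) := L.map fun K => K.map encLiteral

theorem code_map_encLiteral (K : List (Literal n)) :
    code (K.map encLiteral) = encList encLiteral K := by
  induction K with
  | nil => rfl
  | cons v K ih => rw [List.map_cons, code_cons, ih]; rfl

theorem code_dataClauses (L : List (List (Literal n))) : code (dataClauses L) = encFamily L := by
  induction L with
  | nil => rfl
  | cons K L ih =>
    have : dataClauses (K :: L) = K.map encLiteral :: dataClauses L := rfl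
    rw [this, code_cons, ih, code_map_encLiteral]
    rfl

theorem code_input (L : List (List (Literal n))) : code (n, dataClauses L) = encInput L := by
  rw [code_prod, code_dataClauses]
  rfl

theorem encLiteral_eq (v : Literal n) : encLiteral v = lit v.2 v.1 := rfl

theorem encLiteral_injective : Function.Injective (encLiteral : Literal n → Data) := by
  rintro ⟨i, b⟩ ⟨j, c⟩ h
  simp only [encLiteral, Data.node.injEq] at h
  have h1 := encNat_injective h.1
  have h2 := encBool_injective h.2
  rw [Fin.val_inj] at h1
  rw [h1, h2]

theorem mem_literals {x : Data} : x ∈ literals n ↔ ∃ v : Literal n, encLiteral v = x := by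
  simp only [literals, List.mem_append, List.mem_map, PolyTime.mem_countdown]
  constructor
  · rintro (⟨i, hi, rfl⟩ | ⟨i, hi, rfl⟩)
    · exact ⟨(⟨i, hi⟩, true), rfl⟩
    · exact ⟨(⟨i, hi⟩, false), rfl⟩
  · rintro ⟨⟨i, b⟩, rfl⟩
    cases b
    · exact Or.inr ⟨i, i.2, rfl⟩
    · exact Or.inl ⟨i, i.2, rfl⟩

theorem lit_injective (b : Bool) : Function.Injective (lit b) := by
  intro i j h
  simp only [lit, Data.node.injEq, and_true] at h
  exact encNat_injective h

theorem nodup_literals (n : ℕ) : (literals n).Nodup := by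
  rw [literals, List.nodup_append]
  refine ⟨(PolyTime.nodup_countdown n).map (lit_injective _),
    (PolyTime.nodup_countdown n).map (lit_injective _), ?_⟩
  intro x hx y hy h
  obtain ⟨i, -, rfl⟩ := List.mem_map.1 hx
  obtain ⟨j, -, rfl⟩ := List.mem_map.1 hy
  simp only [lit, Data.node.injEq] at h
  exact Bool.noConfusion (encBool_injective h.2)

theorem length_literals (n : ℕ) : (literals n).length = 2 * n := by
  rw [literals, List.length_append, List.length_map, List.length_map, PolyTime.length_countdown]
  omega

theorem negate_encLiteral (v : Literal n) :
    negate (encLiteral v).toList = encLiteral v.neg := by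
  obtain ⟨i, b⟩ := v
  cases b
  · simp [encLiteral, Data.toList, negate, encBool, Literal.neg, code]
  · simp [encLiteral, Data.toList, negate, encBool, Literal.neg, code]

theorem edgesOf_dataClauses (L : List (List (Literal n))) :
    edgesOf (dataClauses L) = L.map fun K => K.map fun v => encLiteral v.neg := by
  simp only [edgesOf, dataClauses, List.map_map]
  refine List.map_congr_left fun K _ => ?_
  simp only [Function.comp, List.map_map]
  exact List.map_congr_left fun v _ => negate_encLiteral v

theorem neg_injective : Function.Injective (Literal.neg : Literal n → Literal n) := by
  rintro ⟨i, b⟩ ⟨j, c⟩ h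
  simp only [Literal.neg, Prod.mk.injEq, Bool.not_inj_iff] at h
  rw [h.1, h.2]

theorem neg_neg (v : Literal n) : v.neg.neg = v := by simp [Literal.neg]

/-- The edge that belongs to a written clause. -/
def edgeOf (K : List (Literal n)) : Finset (Literal n) := K.toFinset.image Literal.neg

theorem mem_edgeOf {K : List (Literal n)} {v : Literal n} : v ∈ edgeOf K ↔ v.neg ∈ K := by
  simp only [edgeOf, Finset.mem_image, List.mem_toFinset]
  constructor
  · rintro ⟨u, hu, rfl⟩
    rwa [neg_neg]
  · intro h
    exact ⟨_, h, neg_neg v⟩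

variable {L : List (List (Literal n))} {φ : Formula n}

theorem hypergraph_eq (hL : Writes L φ) : φ.hypergraph = (L.map edgeOf).toFinset := by
  rw [Formula.hypergraph, ← hL.2.2, familyOf]
  ext E
  simp [edgeOf]

theorem nodup_map_edgeOf (hL : Writes L φ) : (L.map edgeOf).Nodup := by
  have : L.map edgeOf = (L.map List.toFinset).map fun K => K.image Literal.neg := by
    rw [List.map_map]
    rfl
  rw [this]
  exact hL.2.1.map (Finset.image_injective neg_injective)

theorem card_edgeOf {K : List (Literal n)} (hK : K.Nodup) : (edgeOf K).card = K.length := by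
  rw [edgeOf, Finset.card_image_of_injective _ neg_injective, List.toFinset_card_of_nodup hK]

theorem edgeOf_mem (hL : Writes L φ) {K : List (Literal n)} (hK : K ∈ L) :
    edgeOf K ∈ φ.hypergraph := by
  rw [hypergraph_eq hL, List.mem_toFinset]
  exact List.mem_map_of_mem hK

theorem length_le (hL : Writes L φ) {k : ℕ} (hk : ∀ E ∈ φ.hypergraph, E.card ≤ k)
    {K : List (Literal n)} (hK : K ∈ L) : K.length ≤ k := by
  rw [← card_edgeOf (hL.1 K hK)]
  exact hk _ (edgeOf_mem hL hK)

/-- Masses of lists of edges are weights. -/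
theorem mass_filter_eq_weight (hL : Writes L φ) {k : ℕ} (hk : ∀ E ∈ φ.hypergraph, E.card ≤ k)
    (p : ℝ) (q : List Data → Bool) (r : Finset (Literal n) → Prop) [DecidablePred r]
    (h : ∀ K ∈ L, q (K.map fun v => encLiteral v.neg) = true ↔ r (edgeOf K)) :
    mass (cappedPow p k) ((edgesOf (dataClauses L)).filter q) = weight p (φ.hypergraph.filter r) := by
  have h1 : weight p (φ.hypergraph.filter r)
      = (((L.map edgeOf).filter fun E => decide (r E)).map fun E => p ^ E.card).sum := by
    rw [weight, hypergraph_eq hL, ← List.sum_toFinset _ ((nodup_map_edgeOf hL).filter _)]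
    congr 1
    ext E
    simp
  rw [h1, edgesOf_dataClauses, mass, List.filter_map, List.filter_map, List.map_map, List.map_map]
  have h2 : L.filter (q ∘ fun K => K.map fun v => encLiteral v.neg)
      = L.filter ((fun E => decide (r E)) ∘ edgeOf) := by
    refine List.filter_congr fun K hK => ?_
    rw [Bool.eq_iff_iff]
    simpa using h K hK
  rw [h2]
  congr 1
  refine List.map_congr_left fun K hK => ?_
  have hK := List.mem_of_mem_filter hK
  simp only [Function.comp, cappedPow, List.length_map, card_edgeOf (hL.1 K hK),
    if_pos (length_le hL hk hK)]

/-- The input is of polynomial size. -/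
theorem csize_input_le (hL : Writes L φ) {k : ℕ} (hk : ∀ E ∈ φ.hypergraph, E.card ≤ k) :
    csize (n, dataClauses L) ≤ 2 * n + 3 +
      (k + 1) * (2 * n + 1) ^ k * (k * (2 * n + 6) + 2) := by
  have h1 : L.length ≤ (k + 1) * (2 * n + 1) ^ k := by
    have h2 : L.length = φ.hypergraph.card := by
      rw [hypergraph_eq hL, List.toFinset_card_of_nodup (nodup_map_edgeOf hL), List.length_map]
    have h3 : φ.hypergraph ⊆ (Finset.range (k + 1)).biUnion fun i =>
        Finset.powersetCard i Finset.univ := by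
      intro E hE
      rw [Finset.mem_biUnion]
      exact ⟨E.card, Finset.mem_range.2 (Nat.lt_succ_of_le (hk E hE)),
        Finset.mem_powersetCard.2 ⟨Finset.subset_univ _, rfl⟩⟩
    rw [h2]
    refine (Finset.card_le_card h3).trans (Finset.card_biUnion_le.trans ?_)
    have h4 : ∀ i ∈ Finset.range (k + 1),
        (Finset.powersetCard i (Finset.univ : Finset (Literal n))).card ≤ (2 * n + 1) ^ k := by
      intro i hi
      have hcard : (Finset.univ : Finset (Literal n)).card = 2 * n := by
        simp [mul_comm]
      rw [Finset.card_powersetCard, hcard]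
      calc (2 * n).choose i ≤ (2 * n) ^ i := Nat.choose_le_pow _ _
        _ ≤ (2 * n + 1) ^ i := Nat.pow_le_pow_left (by omega) i
        _ ≤ (2 * n + 1) ^ k := Nat.pow_le_pow_right (by omega)
          (Nat.le_of_lt_succ (Finset.mem_range.1 hi))
    refine (Finset.sum_le_card_nsmul _ _ _ h4).trans ?_
    simp
  have h2 : ∀ K ∈ dataClauses L, csize K ≤ k * (2 * n + 6) + 1 := by
    intro K hK
    obtain ⟨K, hK', rfl⟩ := List.mem_map.1 hK
    refine (csize_le_mul (m := 2 * n + 5) ?_).trans ?_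
    · intro x hx
      obtain ⟨v, -, rfl⟩ := List.mem_map.1 hx
      have e1 : csize (encLiteral v) = csize (v.1 : ℕ) + csize v.2 + 1 := rfl
      have e2 := csize_nat (v.1 : ℕ)
      have e3 := csize_bool v.2
      have e4 := v.1.2
      omega
    · rw [List.length_map]
      have := length_le hL hk hK'
      gcongr
  have h3 := csize_le_mul h2
  rw [csize_prod, csize_nat]
  dsimp only
  have h4 : (dataClauses L).length * (k * (2 * n + 6) + 1 + 1)
      ≤ (k + 1) * (2 * n + 1) ^ k * (k * (2 * n + 6) + 2) := by
    rw [dataClauses, List.length_map]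
    gcongr
  omega

end Formula

/-! ### The constants of the algorithm -/

/-- The reciprocals of the fractions of the mass that are traced through the passes. -/
def slack (k m D t : ℕ) : ℕ := m * D * (8 * k) ^ t

/-- The number of rounds. -/
def numRounds (k m D : ℕ) : ℕ := 8 * k * slack k m D k + 1

/-- The thresholds for marking vertices in the passes. -/
def markThreshold (k m D : ℕ) : ℕ → ℕ
  | 0 => 4 * m
  | t + 1 => 4 * numRounds k m D * markThreshold k m D t * slack k m D (t + 1)

/-- The bounds for the degrees of derived sets. -/
noncomputable def degreeBound (k m D : ℕ) (W : ℝ) : ℕ → ℝ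
  | 0 => D * W
  | t + 1 => W / (numRounds k m D * markThreshold k m D t)

theorem slack_pos {k m D : ℕ} (hk : 0 < k) (hm : 0 < m) (hD : 0 < D) (t : ℕ) :
    0 < slack k m D t := by
  unfold slack
  positivity

theorem markThreshold_pos {k m D : ℕ} (hk : 0 < k) (hm : 0 < m) (hD : 0 < D) (t : ℕ) :
    0 < markThreshold k m D t := by
  induction t with
  | zero => unfold markThreshold; positivity
  | succ t ih =>
    have h1 := slack_pos hk hm hD (t + 1)
    have h2 : 0 < numRounds k m D := Nat.succ_pos _
    unfold markThreshold
    positivity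

/-- The recursion for `markThreshold` is chosen so that `threshold` holds with equality at every
level. Only `small` needs `p` to be small. -/
theorem calibrated {k m D : ℕ} (hk : 0 < k) (hm : 0 < m) (hD : 0 < D) {p W N : ℝ} (hp : 0 < p)
    (hp1 : p ≤ 1) (hW : 0 < W) (hN : 0 < N)
    (hsmall : ∀ t < k, (2 * numRounds k m D * markThreshold k m D t * (k ^ k * D) : ℝ) * p ≤ 1)
    {light : ℕ → List (List Data) → Bool}
    (hlight : ∀ c L, light c L = true ↔ c * mass (cappedPow p k) L ≤ W) :
    Calibrated light k (numRounds k m D) (markThreshold k m D) (cappedPow p k) p W (D * W * p ^ k) N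
      (degreeBound k m D W) (slack k m D) := by
  have hR : 0 < numRounds k m D := Nat.succ_pos _
  have hR' : (0 : ℝ) < numRounds k m D := by exact_mod_cast hR
  have hl := markThreshold_pos hk hm hD
  have hl' : ∀ t, (0 : ℝ) < markThreshold k m D t := fun t => by exact_mod_cast hl t
  have hρ := slack_pos hk hm hD
  have hD' : (0 : ℝ) < D := by exact_mod_cast hD
  have hk' : (1 : ℝ) ≤ k := by exact_mod_cast hk
  have hM : ∀ t, degreeBound k m D W (t + 1) * (numRounds k m D * markThreshold k m D t) = W := by
    intro t
    have := hl' t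
    rw [degreeBound]
    field_simp
  refine ⟨fun A => ?_, hp, fun A v hA hlen hv => ?_, hlight, hW, by positivity, hN, hk, hR, hl,
    fun t => ?_, hM, fun t ht => ?_, hρ, fun t => ?_, fun t => ?_, fun t ht => ?_⟩
  · unfold cappedPow
    split <;> positivity
  · have := length_remove hA hv
    have h1 : (remove v A).length ≤ k := by omega
    rw [cappedPow, cappedPow, if_pos hlen, if_pos h1, ← this, pow_succ, mul_comm]
  · cases t with
    | zero => unfold degreeBound; positivity
    | succ t => have := hl' t; unfold degreeBound; positivity
  -- The codegree bound has the factor `p ^ k`, while `t` passes and one link lose only `p ^ (t +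
  -- 1)`. Since `t + 2 ≤ k`, a factor `p` is left over.
  · obtain ⟨d, hd⟩ := Nat.exists_eq_add_of_le ht
    have h1 : (k / p : ℝ) ^ t * (D * W * p ^ k) / p ≤ k ^ k * D * p * W := by
      have e1 : p ^ k = p ^ t * p * p * p ^ d := by
        rw [hd]; ring
      have e2 : (k / p : ℝ) ^ t * (D * W * p ^ k) / p = k ^ t * p ^ d * (D * p * W) := by
        rw [e1, div_pow]
        field_simp
      have e3 : (k : ℝ) ^ t * p ^ d ≤ k ^ k * 1 := by
        refine mul_le_mul (pow_le_pow_right₀ hk' (by omega)) (pow_le_one₀ hp.le hp1)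
          (by positivity) (by positivity)
      rw [e2]
      calc (k : ℝ) ^ t * p ^ d * (D * p * W) ≤ k ^ k * 1 * (D * p * W) := by gcongr
        _ = _ := by ring
    have h2 := hsmall t (by omega)
    have h3 : (0 : ℝ) ≤ 2 * numRounds k m D * markThreshold k m D t := by
      have := hl' t
      positivity
    calc (2 * numRounds k m D * markThreshold k m D t : ℝ) * ((k / p : ℝ) ^ t * (D * W * p ^ k) / p)
        ≤ (2 * numRounds k m D * markThreshold k m D t) * (k ^ k * D * p * W) := by gcongr
      _ = (2 * numRounds k m D * markThreshold k m D t * (k ^ k * D)) * p * W := by ring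
      _ ≤ 1 * W := by gcongr
      _ = W := one_mul W
  · simp only [slack, pow_succ]
    ring
  · cases t with
    | zero =>
      simp only [slack, markThreshold, degreeBound, pow_zero, mul_one]
      push_cast
      exact le_of_eq (by ring)
    | succ t =>
      have h1 := hM t
      rw [markThreshold]
      push_cast
      refine le_of_eq ?_
      linear_combination (-4 * (slack k m D (t + 1) : ℝ)) * h1
  · have h1 : slack k m D t ≤ slack k m D k :=
      Nat.mul_le_mul_left _ (Nat.pow_le_pow_right (by omega) ht)
    have h2 : 4 * slack k m D t ≤ numRounds k m D := by
      unfold numRounds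
      nlinarith [hρ k]
    have h3 : (4 * slack k m D t : ℝ) ≤ numRounds k m D := by exact_mod_cast h2
    have h4 : (0 : ℝ) ≤ slack k m D t := Nat.cast_nonneg _
    nlinarith

/-! ### Structures with a satisfying assignment -/

section Spread

theorem weight_nonneg {V : Type*} {p : ℝ} (hp : 0 ≤ p) (H : HGraph V) : 0 ≤ weight p H :=
  Finset.sum_nonneg fun _ _ => by positivity

variable {V : Type*} [Fintype V] [DecidableEq V] {H : HGraph V} {lam p : ℝ} {k : ℕ}

theorem weight_le_codegree (p : ℝ) (H : HGraph V) (S : Finset V) :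
    weight p (H.filter fun E => S ⊆ E) ≤ codegree S.card p H :=
  le_ciSup (f := fun L : {L : Finset V // L.card = S.card} =>
    weight p (H.filter fun E => L.1 ⊆ E)) (Set.finite_range _).bddAbove ⟨S, rfl⟩

theorem IsSpread.card_pos (hH : IsSpread lam p k H) (hp : 0 < p) : 0 < Fintype.card V := by
  by_contra h
  have h1 : Fintype.card V = 0 := by omega
  have := hH.avg
  rw [avgWeight, h1, Nat.cast_zero, div_zero] at this
  linarith

theorem IsSpread.le_weight (hH : IsSpread lam p k H) (hp : 0 < p) :
    p * Fintype.card V ≤ weight p H := by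
  have h := hH.avg
  rwa [avgWeight, le_div_iff₀ (by exact_mod_cast hH.card_pos hp)] at h

/-- Nearly independent sets are small. -/
theorem IsSpread.card_le (hH : IsSpread lam p k H) (hp : 0 < p) (hlam : 0 < lam) {δ : ℝ}
    (hδ : δ ≤ 1 / 2) {C : Finset V} (hC : weight p (inducedOn H C) ≤ δ * weight p H) :
    (C.card : ℝ) ≤ (1 - 1 / (2 * lam)) * Fintype.card V := by
  have hV : (0 : ℝ) < Fintype.card V := by exact_mod_cast hH.card_pos hp
  have hw : 0 < weight p H := lt_of_lt_of_le (by positivity) (hH.le_weight hp)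
  have h1 : weight p H ≤ weight p (inducedOn H C)
      + ∑ u ∈ Cᶜ, weight p (H.filter fun E => {u} ⊆ E) := by
    have h2 : ∀ E ∈ H, p ^ E.card ≤ (if E ⊆ C then p ^ E.card else 0)
        + ∑ u ∈ Cᶜ, if {u} ⊆ E then p ^ E.card else 0 := by
      intro E _
      have hpos : ∀ u ∈ Cᶜ, 0 ≤ if {u} ⊆ E then p ^ E.card else 0 := fun u _ => by
        split <;> positivity
      by_cases hE : E ⊆ C
      · rw [if_pos hE]
        linarith [Finset.sum_nonneg hpos]
      · rw [if_neg hE, zero_add]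
        obtain ⟨u, hu, huC⟩ := Finset.not_subset.1 hE
        refine le_trans ?_ (Finset.single_le_sum hpos (Finset.mem_compl.2 huC))
        rw [if_pos (Finset.singleton_subset_iff.2 hu)]
    have h3 := Finset.sum_le_sum h2
    rw [Finset.sum_add_distrib, Finset.sum_comm] at h3
    simpa only [weight, inducedOn, Finset.sum_filter] using h3
  have h2 : ∑ u ∈ Cᶜ, weight p (H.filter fun E => {u} ⊆ E)
      ≤ (Fintype.card V - C.card) * (lam * avgWeight p H) := by
    refine (Finset.sum_le_card_nsmul _ _ (lam * avgWeight p H) fun u _ => ?_).trans ?_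
    · have := weight_le_codegree p H {u}
      rw [Finset.card_singleton] at this
      exact this.trans hH.codegree_one
    · rw [Finset.card_compl, nsmul_eq_mul, Nat.cast_sub (Finset.card_le_univ C)]
  rw [avgWeight] at h2
  -- At least half of the weight lies on edges that leave `C`, and each vertex outside `C` accounts
  -- for at most `lam` times the average.
  have h3 : weight p H * (1 / 2) ≤ (Fintype.card V - C.card) * (lam * (weight p H / Fintype.card V)) := by
    nlinarith
  have h4 : (Fintype.card V - C.card : ℝ) * (lam * (weight p H / Fintype.card V))
      = weight p H * ((Fintype.card V - C.card) * lam / Fintype.card V) := by ring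
  rw [h4] at h3
  have h5 := le_of_mul_le_mul_left h3 hw
  rw [le_div_iff₀ hV] at h5
  have h6 : (Fintype.card V : ℝ) / (2 * lam) ≤ Fintype.card V - C.card := by
    rw [div_le_iff₀ (by positivity)]
    linarith
  have h7 : (1 - 1 / (2 * lam)) * (Fintype.card V : ℝ) = Fintype.card V - Fintype.card V / (2 * lam) := by
    ring
  rw [h7]
  linarith

/-- If there are no empty edges and some vertex is in no singleton, then there are large edges, so
that the average weight is bounded below. -/
theorem IsSpread.one_le (hH : IsSpread lam p k H) (hp : 0 < p) (hp1 : p ≤ 1)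
    (hne : ∀ E ∈ H, E.Nonempty) {v : V} (hv : {v} ∉ H) : 2 ≤ k ∧ 1 ≤ lam * avgWeight p H := by
  -- Otherwise all edges are singletons other than `{v}`, and the total weight is at most `(|V| - 1)
  -- * p`, contrary to the lower bound on the average.
  obtain ⟨E, hE, hcard⟩ : ∃ E ∈ H, 2 ≤ E.card := by
    by_contra! hcon
    have h1 : H ⊆ (Finset.univ.erase v).image fun u => {u} := by
      intro E hE
      have h2 : E.card = 1 := by
        have := (hne E hE).card_pos
        have := hcon E hE
        omega
      obtain ⟨u, rfl⟩ := Finset.card_eq_one.1 h2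
      refine Finset.mem_image.2 ⟨u, Finset.mem_erase.2 ⟨?_, Finset.mem_univ u⟩, rfl⟩
      rintro rfl
      exact hv hE
    have h2 : H.card < Fintype.card V := by
      refine (Finset.card_le_card h1).trans_lt (Finset.card_image_le.trans_lt ?_)
      exact Finset.card_lt_card (Finset.erase_ssubset (Finset.mem_univ v))
    have h3 : weight p H ≤ H.card * p := by
      rw [weight, ← nsmul_eq_mul]
      refine Finset.sum_le_card_nsmul _ _ _ fun E hE => ?_
      have := (hne E hE).card_pos
      have := hcon E hE
      have : E.card = 1 := by omega
      rw [this, pow_one]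
    have h4 := hH.le_weight hp
    have h5 : (H.card : ℝ) < Fintype.card V := by exact_mod_cast h2
    nlinarith
  have hEk := hH.bounded E hE
  refine ⟨hcard.trans hEk, ?_⟩
  obtain ⟨S, hSE, hS⟩ := Finset.exists_subset_card_eq hcard
  -- A pair inside `E` has codegree at least `p ^ k`, and this power cancels in the bound on
  -- `2`-codegrees.
  have h1 : p ^ k ≤ p ^ E.card := pow_le_pow_of_le_one hp.le hp1 hEk
  have h2 : p ^ E.card ≤ weight p (H.filter fun E => S ⊆ E) := by
    rw [weight]
    exact Finset.single_le_sum (f := fun E : Finset V => p ^ E.card) (fun _ _ => by positivity)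
      (Finset.mem_filter.2 ⟨hE, hSE⟩)
  have h3 := (h1.trans h2).trans (weight_le_codegree p H S)
  rw [hS] at h3
  have h4 := h3.trans hH.codegree_two
  have h5 : 0 < p ^ k := by positivity
  nlinarith

/-- If moreover `p` is small, then the total weight is large. -/
theorem IsSpread.one_lt_weight (hH : IsSpread lam p k H) (hp : 0 < p) (hlam : 0 < lam)
    (hsmall : p * (lam * 2 ^ ⌈lam⌉₊) < 1) (hp1 : p ≤ 1) (hne : ∀ E ∈ H, E.Nonempty)
    (h1 : 1 ≤ lam * avgWeight p H) : 1 < weight p H := by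
  have hV := hH.card_pos hp
  have hV' : (1 : ℝ) ≤ Fintype.card V := by exact_mod_cast hV
  rw [avgWeight, ← mul_div_assoc, le_div_iff₀ (by linarith), one_mul] at h1
  -- With at most `lam` vertices there are at most `2 ^ ⌈lam⌉₊` edges, each of weight at most `p`,
  -- which is too little for small `p`.
  have h2 : lam < Fintype.card V := by
    by_contra! hcon
    have h3 : weight p H ≤ 2 ^ ⌈lam⌉₊ * p := by
      have h4 : weight p H ≤ H.card * p := by
        rw [weight, ← nsmul_eq_mul]
        refine Finset.sum_le_card_nsmul _ _ _ fun E hE => ?_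
        exact pow_le_of_le_one hp.le hp1 (hne E hE).card_pos.ne'
      have h5 : H.card ≤ 2 ^ ⌈lam⌉₊ := by
        have h6 : H.card ≤ 2 ^ Fintype.card V := by
          have := Finset.card_le_univ H
          rwa [Fintype.card_finset] at this
        refine h6.trans (Nat.pow_le_pow_right (by norm_num) ?_)
        exact_mod_cast hcon.trans (Nat.le_ceil lam)
      have h6 : (H.card : ℝ) ≤ 2 ^ ⌈lam⌉₊ := by exact_mod_cast h5
      nlinarith
    nlinarith
  by_contra! hcon
  nlinarith

end Spread

section Assignment

variable {n k : ℕ} {lam p : ℝ} {L : List (List (Literal n))} {φ : Formula n} {α : Fin n → Bool}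

theorem mem_trueLiterals {v : Literal n} : v ∈ trueLiterals α ↔ α v.1 = v.2 := by
  simp [trueLiterals]

/-- A true literal of the clause has its negation in the edge, and that negation is false. -/
theorem Formula.SatisfiedBy.not_subset (hα : φ.SatisfiedBy α) {E : Finset (Literal n)}
    (hE : E ∈ φ.hypergraph) : ∃ v ∈ E, v ∉ trueLiterals α := by
  obtain ⟨K, hK, rfl⟩ := Finset.mem_image.1 hE
  obtain ⟨v, hv, hvα⟩ := hα K hK
  refine ⟨v.neg, Finset.mem_image_of_mem _ hv, ?_⟩
  simp [mem_trueLiterals, Literal.neg, hvα]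

theorem singleton_notMem (hα : φ.SatisfiedBy α) {v : Literal n} (hv : v ∈ trueLiterals α) :
    {v} ∉ φ.hypergraph := by
  intro h
  obtain ⟨u, hu, hu'⟩ := hα.not_subset h
  rw [Finset.mem_singleton] at hu
  subst hu
  exact hu' hv

theorem mass_through_edges_le (hL : Writes L φ) (hH : IsSpread lam p k φ.hypergraph) (hp : 0 < p)
    (hlam : 0 < lam) (u : Data) :
    mass (cappedPow p k) (through u (edgesOf (dataClauses L)))
      ≤ lam * avgWeight p φ.hypergraph := by
  by_cases hu : ∃ v : Literal n, encLiteral v = u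
  · obtain ⟨v, rfl⟩ := hu
    rw [through, mass_filter_eq_weight hL hH.bounded p _ (fun E => {v} ⊆ E)]
    · have := weight_le_codegree p φ.hypergraph {v}
      rw [Finset.card_singleton] at this
      exact this.trans hH.codegree_one
    · intro K _
      rw [decide_eq_true_eq, List.mem_map, Finset.singleton_subset_iff, mem_edgeOf]
      constructor
      · rintro ⟨w, hw, h⟩
        rw [← encLiteral_injective h, neg_neg]
        exact hw
      · intro h
        exact ⟨_, h, by rw [neg_neg]⟩
  · have : through u (edgesOf (dataClauses L)) = [] := by
      rw [through, List.filter_eq_nil_iff, edgesOf_dataClauses]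
      intro A hA h
      obtain ⟨K, -, rfl⟩ := List.mem_map.1 hA
      obtain ⟨w, -, rfl⟩ := List.mem_map.1 (of_decide_eq_true h)
      exact hu ⟨_, rfl⟩
    rw [this, mass_nil]
    have := hH.avg
    have : 0 ≤ avgWeight p φ.hypergraph := by linarith
    positivity

theorem mass_through_through_edges_le (hL : Writes L φ) (hH : IsSpread lam p k φ.hypergraph)
    (hp : 0 < p) (hlam : 0 < lam) (u w : Data) (huw : u ≠ w) :
    mass (cappedPow p k) (through u (through w (edgesOf (dataClauses L))))
      ≤ lam * avgWeight p φ.hypergraph * p ^ k := by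
  rw [through, through, List.filter_filter]
  by_cases hu : (∃ v : Literal n, encLiteral v = u) ∧ ∃ v : Literal n, encLiteral v = w
  · obtain ⟨⟨v, rfl⟩, v', rfl⟩ := hu
    rw [mass_filter_eq_weight hL hH.bounded p _ (fun E => {v, v'} ⊆ E)]
    · have := weight_le_codegree p φ.hypergraph {v, v'}
      rw [Finset.card_pair (fun h => huw (by rw [h]))] at this
      exact this.trans hH.codegree_two
    · intro K _
      have key : ∀ v : Literal n, encLiteral v ∈ K.map (fun v => encLiteral v.neg) ↔ v.neg ∈ K := by
        intro v
        rw [List.mem_map]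
        constructor
        · rintro ⟨w, hw, h⟩
          rw [← encLiteral_injective h, neg_neg]
          exact hw
        · intro h
          exact ⟨_, h, by rw [neg_neg]⟩
      rw [Bool.and_eq_true, decide_eq_true_eq, decide_eq_true_eq, key, key,
        Finset.insert_subset_iff, Finset.singleton_subset_iff, mem_edgeOf, mem_edgeOf]
  · have : (edgesOf (dataClauses L)).filter (fun A => decide (u ∈ A) && decide (w ∈ A)) = [] := by
      rw [List.filter_eq_nil_iff, edgesOf_dataClauses]
      intro A hA h
      obtain ⟨K, -, rfl⟩ := List.mem_map.1 hA
      rw [Bool.and_eq_true, decide_eq_true_eq, decide_eq_true_eq] at h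
      obtain ⟨a, -, ha⟩ := List.mem_map.1 h.1
      obtain ⟨b, -, hb⟩ := List.mem_map.1 h.2
      exact hu ⟨⟨_, ha⟩, _, hb⟩
    rw [this, mass_nil]
    have := hH.avg
    have : 0 ≤ avgWeight p φ.hypergraph := by linarith
    positivity

open Classical in
/-- The written edges of a satisfiable formula satisfy the assumptions of the analysis. -/
theorem controlled_edges (hL : Writes L φ) (hH : IsSpread lam p k φ.hypergraph) (hp : 0 < p)
    (hlam : 0 < lam) (hα : φ.SatisfiedBy α) {m D : ℕ} {W : ℝ}
    (hW : lam * avgWeight p φ.hypergraph ≤ D * W) :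
    Controlled (fun x => decide (∃ v ∈ trueLiterals α, encLiteral v = x)) k (cappedPow p k) p
      (D * W * p ^ k) (degreeBound k m D W) (literals n) 0 (edgesOf (dataClauses L)) := by
  have hmem : ∀ A ∈ edgesOf (dataClauses L), ∃ K ∈ L, A = K.map fun v => encLiteral v.neg := by
    intro A hA
    rw [edgesOf_dataClauses] at hA
    obtain ⟨K, hK, rfl⟩ := List.mem_map.1 hA
    exact ⟨K, hK, rfl⟩
  refine ⟨fun A hA => ?_, fun A hA => ?_, fun A hA u hu => ?_, fun A hA => ?_, fun u => ?_,
    fun u v huv => ?_⟩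
  · obtain ⟨K, hK, rfl⟩ := hmem A hA
    exact (hL.1 K hK).map (encLiteral_injective.comp neg_injective)
  · obtain ⟨K, hK, rfl⟩ := hmem A hA
    rw [List.length_map]
    exact length_le hL hH.bounded hK
  · obtain ⟨K, hK, rfl⟩ := hmem A hA
    obtain ⟨v, -, rfl⟩ := List.mem_map.1 hu
    exact mem_literals.2 ⟨_, rfl⟩
  · obtain ⟨K, hK, rfl⟩ := hmem A hA
    obtain ⟨v, hv, hv'⟩ := hα.not_subset (edgeOf_mem hL hK)
    rw [mem_edgeOf] at hv
    refine ⟨encLiteral v, List.mem_map.2 ⟨_, hv, by rw [neg_neg]⟩, ?_⟩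
    rw [decide_eq_false_iff_not]
    rintro ⟨w, hw, h⟩
    rw [encLiteral_injective h] at hw
    exact hv' hw
  · exact (mass_through_edges_le hL hH hp hlam u).trans hW
  · rw [pow_zero, one_mul]
    refine (mass_through_through_edges_le hL hH hp hlam u v huv).trans ?_
    gcongr

end Assignment

/-! ### Correctness of the search for containers -/

theorem search_mul_le {p δ : ℝ} (hp : 0 ≤ p) (a : List ℕ) (fuel : List Unit) :
    search (weightOracle p δ) a fuel * δ ≤ ∑ s : Fin a.length, (a.get s : ℝ) * p ^ (s : ℕ) := by
  rcases (search_spec (p := p) (δ := δ) a fuel).1 with h | h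
  · rw [h, Nat.cast_zero, zero_mul]
    exact Finset.sum_nonneg fun _ _ => by positivity
  · exact h.le

theorem sum_linear (a : ℕ) (p : ℝ) :
    ∑ s : Fin [0, a].length, ([0, a].get s : ℝ) * p ^ (s : ℕ) = a * p := by
  simp [Fin.sum_univ_succ]

section Run

variable {n : ℕ}

/-- The set of the literals that are written in a list. -/
noncomputable def decodeSet (n : ℕ) (C : List Data) : Finset (Literal n) :=
  Finset.univ.filter fun v => encLiteral v ∈ C

theorem mem_decodeSet {C : List Data} {v : Literal n} : v ∈ decodeSet n C ↔ encLiteral v ∈ C := by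
  simp [decodeSet]

theorem toFinset_eq_decodeSet (C : List (Literal n)) :
    C.toFinset = decodeSet n (C.map encLiteral) := by
  ext v
  rw [List.mem_toFinset, mem_decodeSet, List.mem_map_of_injective encLiteral_injective]

theorem exists_map_encLiteral {C : List Data} (h : ∀ x ∈ C, x ∈ literals n) :
    ∃ C' : List (Literal n), C'.map encLiteral = C := by
  have : C ∈ Set.range (List.map (encLiteral : Literal n → Data)) := by
    rw [Set.range_list_map]
    intro x hx
    obtain ⟨v, hv⟩ := mem_literals.1 (h x hx)
    exact ⟨v, hv⟩
  exact this

/-- The context of the run on a formula. -/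
noncomputable def contextOf (k m : ℕ) (p δ : ℝ) (L : List (List (Literal n))) : Context :=
  (prepare k m (weightOracle p δ) (n, dataClauses L)).1

/-- The bound for the size of fingerprints that is used in the run. -/
noncomputable def sizeBound (k n : ℕ) (p δ : ℝ) : ℕ :=
  search (weightOracle p δ) [0, 4 * k ^ 2 * n] (List.replicate (literals n).length ())

theorem sizeBound_le {k : ℕ} {p δ : ℝ} (hp : 0 < p) (hδ : 0 < δ) :
    (sizeBound k n p δ : ℝ) ≤ 4 * k ^ 2 * p * n / δ := by
  rw [le_div_iff₀ hδ]
  refine (search_mul_le hp.le _ _).trans ?_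
  rw [sum_linear]
  push_cast
  exact le_of_eq (by ring)

/-- The gap between `(k - 1) * p * 2n` and `4 * k ^ 2 * p * n / δ` absorbs the rounding of the
search; the cap at the number of literals is harmless. -/
theorem le_sizeBound {k : ℕ} {p δ : ℝ} (hp : 0 < p) (hδ : 0 < δ) (hδ4 : δ < 1 / 4) {a : ℕ}
    (ha : a ≤ 2 * n) (ha' : (a : ℝ) ≤ (k - 1 : ℕ) * (p * (2 * n : ℕ))) : a ≤ sizeBound k n p δ := by
  rcases (search_spec (p := p) (δ := δ) [0, 4 * k ^ 2 * n]
    (List.replicate (literals n).length ())).2 with h | h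
  · change sizeBound k n p δ = _ at h
    rw [h, List.length_replicate, length_literals]
    exact ha
  · rw [sum_linear] at h
    change _ ≤ ((sizeBound k n p δ : ℝ) + 1) * δ at h
    rcases Nat.eq_zero_or_pos a with rfl | h0
    · exact Nat.zero_le _
    have h1 : (1 : ℝ) ≤ a := by exact_mod_cast h0
    have h2 : ((k - 1 : ℕ) : ℝ) ≤ (k : ℝ) ^ 2 := by
      have : k - 1 ≤ k ^ 2 := (Nat.sub_le k 1).trans (Nat.le_self_pow two_ne_zero k)
      exact_mod_cast this
    have h3 : ((k - 1 : ℕ) : ℝ) * (p * (2 * n : ℕ)) ≤ k ^ 2 * (p * (2 * n : ℕ)) := by gcongr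
    push_cast at h h3 ha'
    have h4 : (0 : ℝ) ≤ sizeBound k n p δ := Nat.cast_nonneg _
    have h5 : ((a : ℝ) + 1) * (1 / 4) ≤ (sizeBound k n p δ + 1) * (1 / 4) := by nlinarith
    have h6 : (a : ℝ) ≤ sizeBound k n p δ := by linarith
    exact_mod_cast h6

variable {k m : ℕ} {p δ lam : ℝ} {L : List (List (Literal n))} {φ : Formula n}

theorem mass_within_edges (hL : Writes L φ) (hk : ∀ E ∈ φ.hypergraph, E.card ≤ k) (p : ℝ)
    (C : List Data) : mass (cappedPow p k) (within C (edgesOf (dataClauses L)))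
      = weight p (inducedOn φ.hypergraph (decodeSet n C)) := by
  rw [within, mass_filter_eq_weight hL hk p _ (fun E => E ⊆ decodeSet n C)]
  · rfl
  · intro K _
    simp only [List.all_map, List.all_eq_true, Function.comp, decide_eq_true_eq]
    constructor
    · intro h v hv
      rw [mem_edgeOf] at hv
      rw [mem_decodeSet]
      simpa only [neg_neg] using h _ hv
    · intro h v hv
      exact mem_decodeSet.1 (h (mem_edgeOf.2 (by rwa [neg_neg])))

theorem mass_edges (hL : Writes L φ) (hk : ∀ E ∈ φ.hypergraph, E.card ≤ k) (p : ℝ) :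
    mass (cappedPow p k) (edgesOf (dataClauses L)) = weight p φ.hypergraph := by
  have := mass_filter_eq_weight hL hk p (fun _ => true) (fun _ => True) (fun _ _ => by simp)
  simpa using this

theorem accepted_iff (hL : Writes L φ) (hk : ∀ E ∈ φ.hypergraph, E.card ≤ k) (C : List Data) :
    accepted k m (weightOracle p δ) (contextOf k m p δ L) C = true ↔
      m * weight p (inducedOn φ.hypergraph (decodeSet n C)) ≤ (contextOf k m p δ L).2.2.1 * δ ∧
        ∀ i : Fin n, (i, true) ∈ decodeSet n C ∨ (i, false) ∈ decodeSet n C := by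
  have h : (contextOf k m p δ L).2.1 = edgesOf (dataClauses L) := rfl
  rw [accepted, Bool.and_eq_true, atMost_profile, h, mass_within_edges hL hk]
  refine and_congr_right fun _ => ?_
  have h' : (contextOf k m p δ L).2.2.2 = PolyTime.countdown n := rfl
  simp only [h', List.all_eq_true, PolyTime.mem_countdown, Bool.or_eq_true, decide_eq_true_eq,
    mem_decodeSet, encLiteral_eq]
  exact ⟨fun h i => h i i.2, fun h i hi => h ⟨i, hi⟩⟩

theorem contextOf_mul_le (hL : Writes L φ) (hk : ∀ E ∈ φ.hypergraph, E.card ≤ k) (hp : 0 ≤ p) :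
    (contextOf k m p δ L).2.2.1 * δ ≤ weight p φ.hypergraph := by
  refine (search_mul_le hp _ _).trans ?_
  rw [sum_profile, Nat.cast_one, one_mul, mass_edges hL hk]

/-- If the search stops, its error is at most `δ < 1 / 4`, which is less than half the weight
because the weight exceeds 1. If it exhausts its fuel of `m` times the number of edges, then `m * δ
≥ 1` makes the result at least the number of edges, hence at least the weight. -/
theorem le_contextOf_mul (hL : Writes L φ) (hk : ∀ E ∈ φ.hypergraph, E.card ≤ k) (hp : 0 ≤ p)
    (hp1 : p ≤ 1) (hδ : δ < 1 / 4) (hm : 1 ≤ m * δ) (hw : 1 < weight p φ.hypergraph) :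
    weight p φ.hypergraph / 2 ≤ (contextOf k m p δ L).2.2.1 * δ := by
  rcases (search_spec (p := p) (δ := δ) (profile k 1 (edgesOf (dataClauses L)))
    (List.replicate (m * (edgesOf (dataClauses L)).length) ())).2 with h | h
  · have h1 : (contextOf k m p δ L).2.2.1 = m * (edgesOf (dataClauses L)).length := by
      rw [List.length_replicate] at h
      exact h
    have h2 : weight p φ.hypergraph ≤ (edgesOf (dataClauses L)).length := by
      rw [← mass_edges hL hk, mass, ← mul_one (((edgesOf (dataClauses L)).length : ℝ))]
      refine sum_map_le_length_mul fun A _ => ?_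
      unfold cappedPow
      split
      · exact pow_le_one₀ hp hp1
      · exact zero_le_one
    rw [h1]
    push_cast
    nlinarith
  · rw [sum_profile, Nat.cast_one, one_mul, mass_edges hL hk] at h
    change _ ≤ (((contextOf k m p δ L).2.2.1 : ℝ) + 1) * δ at h
    linarith

/-- Accepted lists are nearly independent. -/
theorem weight_le_of_accepted (hL : Writes L φ) (hk : ∀ E ∈ φ.hypergraph, E.card ≤ k) (hp : 0 ≤ p)
    (hm : 1 ≤ m * δ) (hδ : 0 < δ) {C : List Data}
    (hC : accepted k m (weightOracle p δ) (contextOf k m p δ L) C = true) :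
    weight p (inducedOn φ.hypergraph (decodeSet n C)) ≤ δ * weight p φ.hypergraph := by
  have h1 := ((accepted_iff hL hk C).1 hC).1.trans (contextOf_mul_le hL hk hp)
  have h2 := weight_nonneg hp (inducedOn φ.hypergraph (decodeSet n C))
  have h3 := mul_le_mul_of_nonneg_left h1 hδ.le
  nlinarith

open Classical in
/-- The true literals of a satisfying assignment have an accepted container. -/
theorem exists_accepted {D : ℕ} (hL : Writes L φ) (hH : IsSpread lam p k φ.hypergraph)
    (hp : 0 < p) (hp1 : p ≤ 1) (hlam : 0 < lam) (hδ0 : 0 < δ) (hδ : δ < 1 / 4) (hm : 1 ≤ m * δ)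
    (hD : 2 * lam ≤ D) (hpl : p * (lam * 2 ^ ⌈lam⌉₊) < 1)
    (hsmall : ∀ t < k, (2 * numRounds k m D * markThreshold k m D t * (k ^ k * D) : ℝ) * p ≤ 1)
    {α : Fin n → Bool} (hα : φ.SatisfiedBy α) :
    ∃ S : List Data, S.Sublist (literals n) ∧ S.length ≤ sizeBound k n p δ ∧
      (∀ x ∈ S, ∃ v ∈ trueLiterals α, encLiteral v = x) ∧
      accepted k m (weightOracle p δ) (contextOf k m p δ L)
        (container k (markThreshold k m D) (numRounds k m D) (weightOracle p δ)
          (contextOf k m p δ L) fun x => decide (x ∈ S)) = true ∧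
      ∀ v ∈ trueLiterals α, encLiteral v ∈ container k (markThreshold k m D) (numRounds k m D)
          (weightOracle p δ) (contextOf k m p δ L) fun x => decide (x ∈ S) := by
  have hV : Fintype.card (Literal n) = 2 * n := by simp [mul_comm]
  have hn : 0 < n := by
    have := hH.card_pos hp
    omega
  have hn' : (0 : ℝ) < (2 * n : ℕ) := by exact_mod_cast (by omega : 0 < 2 * n)
  have hne : ∀ E ∈ φ.hypergraph, E.Nonempty := fun E hE => by
    obtain ⟨v, hv, -⟩ := hα.not_subset hE
    exact ⟨v, hv⟩
  obtain ⟨hk, havg⟩ := hH.one_le hp hp1 hne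
    (singleton_notMem hα (v := (⟨0, hn⟩, α ⟨0, hn⟩)) (mem_trueLiterals.2 rfl))
  have hw := hH.one_lt_weight hp hlam hpl hp1 hne havg
  have hb := le_contextOf_mul (m := m) hL hH.bounded hp.le hp1 hδ hm hw
  set z := contextOf k m p δ L with hz
  have hz1 : z.1 = literals n := rfl
  have hz2 : z.2.1 = edgesOf (dataClauses L) := rfl
  have hlen : z.1.length = 2 * n := length_literals n
  set W : ℝ := z.2.2.1 * δ / (2 * n : ℕ) with hW
  have hWpos : 0 < W := by
    have : 0 < (z.2.2.1 : ℝ) * δ := by linarith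
    positivity
  have hD0 : 0 < D := by
    have : (0 : ℝ) < D := by linarith
    exact_mod_cast this
  have hm0 : 0 < m := by
    rcases Nat.eq_zero_or_pos m with rfl | h
    · rw [Nat.cast_zero, zero_mul] at hm
      linarith
    · exact h
  -- Here `D ≥ 2 * lam` makes up for `b * δ` being possibly only half the weight.
  have hDW : lam * avgWeight p φ.hypergraph ≤ D * W := by
    rw [avgWeight, hV, hW, ← mul_div_assoc, ← mul_div_assoc]
    refine div_le_div_of_nonneg_right ?_ hn'.le
    have h1 : 0 ≤ (z.2.2.1 : ℝ) * δ := by linarith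
    nlinarith
  have hc := calibrated (light := lightTest k (weightOracle p δ) z) (N := (2 * n : ℕ))
    (by omega : 0 < k) hm0 hD0 hp hp1 hWpos hn' hsmall (fun c Q => by
      rw [lightTest_iff (by rw [hlen]; omega), hlen])
  have hco := controlled_edges (m := m) hL hH hp hlam hα hDW
  obtain ⟨S, hS, hSα, hSlen, hcov, hmass⟩ := exists_fingerprint hc (j := k - 1) (by omega)
    (nodup_literals n) hco (by rw [length_literals]) rfl
  have hcont : rounds (lightTest k (weightOracle p δ) z) (fun x => decide (x ∈ S))
      (markThreshold k m D) (numRounds k m D) (k - 1) (edgesOf (dataClauses L))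
      (numRounds k m D) (literals n) = container k (markThreshold k m D) (numRounds k m D)
        (weightOracle p δ) z fun x => decide (x ∈ S) := rfl
  rw [hcont] at hmass hcov
  have hcov' : ∀ v ∈ trueLiterals α, encLiteral v ∈ container k (markThreshold k m D)
      (numRounds k m D) (weightOracle p δ) z fun x => decide (x ∈ S) := fun v hv =>
    hcov _ (mem_literals.2 ⟨v, rfl⟩) (decide_eq_true ⟨v, hv, rfl⟩)
  refine ⟨S, hS, le_sizeBound hp hδ0 hδ ?_ hSlen, fun x hx => of_decide_eq_true (hSα x hx),
    (accepted_iff hL hH.bounded _).2 ⟨?_, fun i => ?_⟩, hcov'⟩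
  · rw [← length_literals]
    exact hS.length_le
  -- At level 0 the mass estimate reads `m * D * mass ≤ D * (b * δ)`; cancelling `D` gives the
  -- acceptance test.
  · rw [mass_within_edges hL hH.bounded] at hmass
    have e1 : slack k m D 0 = m * D := by simp [slack]
    have e2 : degreeBound k m D W 0 * (2 * n : ℕ) = D * (z.2.2.1 * δ) := by
      rw [degreeBound, hW]
      field_simp
    rw [e1, e2] at hmass
    push_cast at hmass
    have hD' : (0 : ℝ) < D := by exact_mod_cast hD0
    refine le_of_mul_le_mul_left ?_ hD'
    calc _ = _ := by ring
      _ ≤ _ := hmass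
  · have h1 := hcov' (i, α i) (mem_trueLiterals.2 rfl)
    cases h : α i
    · rw [h] at h1
      exact Or.inr (mem_decodeSet.2 h1)
    · rw [h] at h1
      exact Or.inl (mem_decodeSet.2 h1)

/-- The container that belongs to a set of literals. -/
noncomputable def containerOf (k : ℕ) (l : ℕ → ℕ) (R : ℕ) (O : Oracle) (z : Context)
    (F : Finset (Literal n)) : Finset (Literal n) :=
  decodeSet n (container k l R O z fun x => decide (x ∈ F.toList.map encLiteral))

/-- The procedure uses the fingerprint only through membership, so order and repetitions do not
matter and the container is a function of a set. -/
theorem containerOf_toFinset (k : ℕ) (l : ℕ → ℕ) (R : ℕ) (O : Oracle) (z : Context)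
    (S : List (Literal n)) : containerOf k l R O z S.toFinset
      = decodeSet n (container k l R O z fun x => decide (x ∈ S.map encLiteral)) := by
  rw [containerOf]
  congr 2
  funext x
  rw [Bool.eq_iff_iff]
  simp

end Run

/-! ### The constants of the theorem -/

/-- Polynomially many steps for each fingerprint. -/
theorem exists_time_bound {G : ℕ → ℕ} (hG : PolyGrowth G) (k : ℕ) : ∃ c : ℕ,
    ∀ (n : ℕ) (φ : Formula n) (L : List (List (Literal n))), Writes L φ →
      (∀ E ∈ φ.hypergraph, E.card ≤ k) → G (csize (n, dataClauses L)) ≤ c * (n + 1) ^ c := by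
  obtain ⟨-, d, hd⟩ := hG
  set A := 5 + (k + 1) * 2 ^ k * (6 * k + 2) with hA
  refine ⟨A ^ d + (k + 1) * d, fun n φ L hL hk => (hd _).trans ?_⟩
  have h1 : csize (n, dataClauses L) + 2 ≤ A * (n + 1) ^ (k + 1) := by
    have h2 := csize_input_le hL hk
    have h3 : (2 * n + 1) ^ k ≤ 2 ^ k * (n + 1) ^ k := by
      rw [← mul_pow]
      exact Nat.pow_le_pow_left (by omega) k
    have h4 : k * (2 * n + 6) + 2 ≤ (6 * k + 2) * (n + 1) := by nlinarith
    have h5 : (k + 1) * (2 * n + 1) ^ k * (k * (2 * n + 6) + 2)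
        ≤ (k + 1) * (2 ^ k * (n + 1) ^ k) * ((6 * k + 2) * (n + 1)) := by gcongr
    have h6 : n + 1 ≤ (n + 1) ^ (k + 1) := Nat.le_self_pow (Nat.succ_ne_zero k) _
    have h7 : A * (n + 1) ^ (k + 1) = 5 * (n + 1) ^ (k + 1)
        + (k + 1) * (2 ^ k * (n + 1) ^ k) * ((6 * k + 2) * (n + 1)) := by
      rw [hA]
      ring
    omega
  calc (csize (n, dataClauses L) + 2) ^ d ≤ (A * (n + 1) ^ (k + 1)) ^ d :=
        Nat.pow_le_pow_left h1 d
    _ = A ^ d * (n + 1) ^ ((k + 1) * d) := by rw [mul_pow, ← pow_mul]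
    _ ≤ (A ^ d + (k + 1) * d) * (n + 1) ^ (A ^ d + (k + 1) * d) := by
      refine Nat.mul_le_mul (Nat.le_add_right _ _) (Nat.pow_le_pow_right (by omega) ?_)
      exact Nat.le_add_left _ _

/-- All smallness conditions hold for small `p`. -/
theorem exists_threshold (k m D : ℕ) {lam δ : ℝ} (hlam : 0 < lam) (hδ : 0 < δ) :
    ∃ p' : ℝ, 0 < p' ∧ ∀ p : ℝ, 0 < p → p < p' → p ≤ 1 ∧ 2 * k ^ 2 * p / δ ≤ 1 / 2 ∧
      p * (lam * 2 ^ ⌈lam⌉₊) < 1 ∧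
      ∀ t < k, (2 * numRounds k m D * markThreshold k m D t * (k ^ k * D) : ℝ) * p ≤ 1 := by
  set B : ℝ := 1 + 4 * k ^ 2 / δ + lam * 2 ^ ⌈lam⌉₊
    + ∑ t ∈ Finset.range k, (2 * numRounds k m D * markThreshold k m D t * (k ^ k * D) : ℝ) with hB
  have h1 : (0 : ℝ) ≤ 4 * k ^ 2 / δ := by positivity
  have h2 : (0 : ℝ) < lam * 2 ^ ⌈lam⌉₊ := by positivity
  have h3 : ∀ t ∈ Finset.range k,
      (0 : ℝ) ≤ 2 * numRounds k m D * markThreshold k m D t * (k ^ k * D) := fun t _ => by positivity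
  have h4 := Finset.sum_nonneg h3
  have hB0 : 0 < B := by linarith
  refine ⟨1 / B, by positivity, fun p hp hpB => ?_⟩
  rw [lt_div_iff₀ hB0] at hpB
  have key : ∀ x, x ≤ B → x * p < 1 := fun x hx => by nlinarith
  refine ⟨?_, ?_, ?_, fun t ht => ?_⟩
  · have := key 1 (by linarith)
    linarith
  · have := key (4 * k ^ 2 / δ) (by linarith)
    have e : 2 * (k : ℝ) ^ 2 * p / δ = 4 * k ^ 2 / δ * p / 2 := by ring
    rw [e]
    linarith
  · have := key _ (show lam * 2 ^ ⌈lam⌉₊ ≤ B by linarith)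
    linarith
  · have := Finset.single_le_sum h3 (Finset.mem_range.2 ht)
    exact (key _ (by linarith)).le

/-- What the enumeration outputs for a written formula. -/
theorem exists_output {k m R : ℕ} {l : ℕ → ℕ} {p δ : ℝ} {n : ℕ} (L : List (List (Literal n))) :
    ∃ E : List (List (Literal n) × List (Literal n)),
      code (enumerate (fun S => leafResult k m l R (weightOracle p δ) (contextOf k m p δ L, S))
        (literals n) (sizeBound k n p δ) [] ([], []))
        = .node (encFamily (E.map Prod.fst)) (encFamily (E.map Prod.snd)) ∧
      E.length ≤ numSubsets (2 * n) (sizeBound k n p δ) ∧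
      (∀ q ∈ E, q.1.length ≤ sizeBound k n p δ ∧
        q.2.toFinset = containerOf k l R (weightOracle p δ) (contextOf k m p δ L) q.1.toFinset ∧
        accepted k m (weightOracle p δ) (contextOf k m p δ L) (q.2.map encLiteral) = true) ∧
      ∀ S : List (Literal n), (S.map encLiteral).Sublist (literals n) →
        S.length ≤ sizeBound k n p δ →
        accepted k m (weightOracle p δ) (contextOf k m p δ L)
          (container k l R (weightOracle p δ) (contextOf k m p δ L)
            fun x => decide (x ∈ S.map encLiteral)) = true →
        ∃ q ∈ E, q.1.toFinset = S.toFinset := by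
  set O := weightOracle p δ with hO
  set z := contextOf k m p δ L with hz
  set B := sizeBound k n p δ with hB
  obtain ⟨E, hE, hlen, hmem⟩ := enumerate_spec (fun S => leafResult k m l R O (z, S))
    (literals n) B [] ([], [])
  rw [length_literals] at hlen
  have hleaf : ∀ (q : List Data × List Data) (S : List Data),
      (leafResult k m l R O (z, S)).head? = some q ↔
        accepted k m O z (container k l R O z fun x => decide (x ∈ S)) = true ∧
          q = (S, container k l R O z fun x => decide (x ∈ S)) := by
    intro q S
    rw [leafResult]
    split
    · rename_i h
      simp only [h, true_and, List.head?_cons, Option.some.injEq]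
      exact eq_comm
    · rename_i h
      simp only [h, false_and, List.head?_nil, reduceCtorEq]
  have hlit : ∀ s : Data → Bool, ∀ x ∈ container k l R O z s, x ∈ literals n :=
    fun s x hx => (rounds_sublist _ _).subset hx
  -- Everything in the output is built from written literals, so it is the encoding of lists of
  -- actual literals.
  have hE' : E ∈ Set.range (List.map (Prod.map (List.map (encLiteral : Literal n → Data))
      (List.map (encLiteral : Literal n → Data)))) := by
    rw [Set.range_list_map]
    intro q hq
    obtain ⟨T, hT, -, hq⟩ := (hmem q).1 hq
    obtain ⟨-, rfl⟩ := (hleaf _ _).1 hq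
    rw [List.append_nil]
    obtain ⟨S', hS'⟩ := exists_map_encLiteral (n := n) (C := T.reverse) fun x hx =>
      hT.subset (List.mem_reverse.1 hx)
    obtain ⟨C', hC'⟩ := exists_map_encLiteral (hlit fun x => decide (x ∈ T.reverse))
    exact ⟨(S', C'), by rw [Prod.map_apply, hS', hC']⟩
  obtain ⟨E', rfl⟩ := hE'
  refine ⟨E', ?_, by simpa using hlen, fun q hq => ?_, fun S hS hSlen hacc => ?_⟩
  · rw [hE, List.append_nil, List.append_nil, code_prod, ← code_dataClauses, ← code_dataClauses]
    simp only [dataClauses, List.map_map]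
    rfl
  · obtain ⟨T, hT, hTlen, hq'⟩ := (hmem _).1 (List.mem_map_of_mem (f := Prod.map _ _) hq)
    obtain ⟨hacc, heq⟩ := (hleaf _ _).1 hq'
    rw [List.append_nil] at hacc heq
    have h1 : q.1.map encLiteral = T.reverse := congrArg Prod.fst heq
    have h2 : q.2.map encLiteral = container k l R O z fun x => decide (x ∈ T.reverse) :=
      congrArg Prod.snd heq
    refine ⟨?_, ?_, ?_⟩
    · have := congrArg List.length h1
      rw [List.length_map, List.length_reverse] at this
      omega
    · rw [containerOf_toFinset, toFinset_eq_decodeSet, h2, h1]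
    · rw [h2]
      exact hacc
  · have hrev : (fun x => decide (x ∈ (S.map encLiteral).reverse))
        = fun x => decide (x ∈ S.map encLiteral) := by
      funext x
      rw [Bool.eq_iff_iff]
      simp
    have hq := (hmem ((S.map encLiteral).reverse, container k l R O z fun x =>
      decide (x ∈ S.map encLiteral))).2 ⟨_, hS, by rwa [List.length_map], by
        rw [hleaf, List.append_nil, hrev]
        exact ⟨hacc, rfl⟩⟩
    obtain ⟨q, hq, hq'⟩ := List.mem_map.1 hq
    refine ⟨q, hq, ?_⟩
    rw [toFinset_eq_decodeSet, toFinset_eq_decodeSet]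
    have h1 : q.1.map encLiteral = (S.map encLiteral).reverse := congrArg Prod.fst hq'
    rw [h1]
    ext v
    simp [mem_decodeSet]

end SatContainer

/-! ### Proof of the theorem -/

open SatContainer

theorem theorem1p2 (k : ℕ) (lam δ : ℝ) (hlam : 1 < lam) (hδ0 : 0 < δ) (hδ : δ < 1 / 4) :
    ∃ p' : ℝ, 0 < p' ∧ ∃ (P : Program) (c : ℕ),
      ∀ p : ℝ, 0 < p → p < p' → ∀ (n : ℕ) (φ : Formula n), IsSpread lam p k φ.hypergraph →
      ∀ L : List (List (Literal n)), Writes L φ →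
      ∃ (LS LC : List (List (Literal n))) (t : ℕ),
        -- the algorithm outputs the fingerprints and the containers, within the time bound
        P.Runs (weightOracle p δ) (encInput L) (.node (encFamily LS) (encFamily LC)) t ∧
        (t : ℝ) ≤ c * ((n : ℝ) + 1) ^ c * (2 : ℝ) ^ (2 * entropy (2 * k ^ 2 * p / δ) * n) ∧
        -- every fingerprint determines a container, and every container arises in this way
        ∃ g : Finset (Literal n) → Finset (Literal n), familyOf LC = (familyOf LS).image g ∧
        -- every satisfying assignment lies in a container
        (∀ α : Fin n → Bool, φ.SatisfiedBy α →
          ∃ S ∈ familyOf LS, S ⊆ trueLiterals α ∧ trueLiterals α ⊆ g S) ∧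
        -- fingerprints are small, and there are few containers
        (∀ S ∈ familyOf LS, (S.card : ℝ) ≤ 4 * k ^ 2 * p * n / δ) ∧
        ((familyOf LC).card : ℝ) ≤ (2 : ℝ) ^ (2 * entropy (2 * k ^ 2 * p / δ) * n) ∧
        -- every container meets every pair of complementary literals
        (∀ C ∈ familyOf LC, ∀ i : Fin n, (i, true) ∈ C ∨ (i, false) ∈ C) ∧
        -- every container is small and nearly independent
        (∀ C ∈ familyOf LC, (C.card : ℝ) ≤ (2 - 1 / lam) * n ∧
          weight p (inducedOn φ.hypergraph C) ≤ δ * weight p φ.hypergraph) := by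

  -- Oracle questions have natural coefficients, so `1 / δ` and `2 * lam` are rounded up to
  -- constants of the program.
  set m := ⌈1 / δ⌉₊ with hm
  set D := ⌈2 * lam⌉₊ with hD
  have hlam0 : 0 < lam := by linarith
  have hmδ : 1 ≤ m * δ := by
    rw [← div_le_iff₀ hδ0]
    exact Nat.le_ceil _
  have hD2 : 2 * lam ≤ D := Nat.le_ceil _
  set R := numRounds k m D with hR
  set l := markThreshold k m D with hl
  obtain ⟨P, G, hG, hP⟩ := exists_program (PolyTime.prepare k m) (PolyTime.leafResult k m l R)
  obtain ⟨c, hc⟩ := exists_time_bound hG k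
  obtain ⟨p', hp', hsmall⟩ := exists_threshold k m D hlam0 hδ0
  refine ⟨p', hp', P, c, fun p hp hpp n φ hH L hL => ?_⟩
  obtain ⟨hp1, hx, hpl, hcal⟩ := hsmall p hp hpp
  obtain ⟨E, hcode, hlen, hsound, hcomplete⟩ :=
    exists_output (k := k) (m := m) (R := R) (l := l) (p := p) (δ := δ) L
  obtain ⟨t, hrun, ht⟩ := hP (weightOracle p δ) (n, dataClauses L)
  rw [code_input] at hrun
  change P.Runs _ _ (Coded.code (enumerate (fun S => leafResult k m l R (weightOracle p δ)
    (contextOf k m p δ L, S)) (literals n) (sizeBound k n p δ) [] ([], []))) t at hrun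
  rw [hcode] at hrun
  change t ≤ numSubsets (literals n).length (sizeBound k n p δ) * _ at ht
  rw [length_literals] at ht
  have hcount : (numSubsets (2 * n) (sizeBound k n p δ) : ℝ)
      ≤ 2 ^ (2 * entropy (2 * k ^ 2 * p / δ) * n) := by
    -- The size bound `4 * k ^ 2 * p * n / δ` is the fraction `2 * k ^ 2 * p / δ` of the `2 * n`
    -- literals.
    refine (numSubsets_le (x := 2 * k ^ 2 * p / δ) (by positivity) hx ?_).trans (le_of_eq ?_)
    · refine (sizeBound_le hp hδ0).trans (le_of_eq ?_)
      push_cast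
      ring
    · congr 1
      push_cast
      ring
  have hcard : Fintype.card (Literal n) = 2 * n := by simp [mul_comm]
  have hC : ∀ C ∈ familyOf (E.map Prod.snd), ∃ q ∈ E, C = decodeSet n (q.2.map encLiteral) := by
    intro C hC
    simp only [familyOf, List.map_map, List.mem_toFinset, List.mem_map, Function.comp] at hC
    obtain ⟨q, hq, rfl⟩ := hC
    exact ⟨q, hq, toFinset_eq_decodeSet _⟩
  refine ⟨E.map Prod.fst, E.map Prod.snd, t, hrun, ?_,
    containerOf k l R (weightOracle p δ) (contextOf k m p δ L), ?_, fun α hα => ?_,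
    fun S hS => ?_, ?_, fun C hCE i => ?_, fun C hCE => ?_⟩
  · have h1 : (t : ℝ) ≤ numSubsets (2 * n) (sizeBound k n p δ) * (c * (n + 1) ^ c) := by
      exact_mod_cast ht.trans (Nat.mul_le_mul_left _ (hc n φ L hL hH.bounded))
    refine h1.trans ?_
    rw [mul_comm]
    gcongr
  · ext C
    simp only [familyOf, List.map_map, List.mem_toFinset, List.mem_map, Function.comp,
      Finset.mem_image, exists_exists_and_eq_and]
    refine exists_congr fun q => and_congr_right fun hq => ?_
    rw [(hsound q hq).2.1]
  · obtain ⟨S, hS, hSlen, hSα, hacc, hcov⟩ := exists_accepted hL hH hp hp1 hlam0 hδ0 hδ hmδ hD2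
      hpl hcal hα
    obtain ⟨S', rfl⟩ := exists_map_encLiteral (n := n) fun x hx => hS.subset hx
    obtain ⟨q, hq, hqS⟩ := hcomplete S' hS (by rwa [List.length_map] at hSlen) hacc
    refine ⟨S'.toFinset, ?_, fun v hv => ?_, fun v hv => ?_⟩
    · simp only [familyOf, List.map_map, List.mem_toFinset, List.mem_map, Function.comp]
      exact ⟨q, hq, hqS⟩
    · obtain ⟨u, hu, hu'⟩ := hSα _ (List.mem_map_of_mem (List.mem_toFinset.1 hv))
      rwa [← encLiteral_injective hu']
    · rw [containerOf_toFinset, mem_decodeSet]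
      exact hcov v hv
  · simp only [familyOf, List.map_map, List.mem_toFinset, List.mem_map, Function.comp] at hS
    obtain ⟨q, hq, rfl⟩ := hS
    refine le_trans ?_ (sizeBound_le hp hδ0)
    exact_mod_cast (List.toFinset_card_le _).trans (hsound q hq).1
  · refine le_trans ?_ hcount
    have h1 : (familyOf (E.map Prod.snd)).card ≤ E.length := by
      refine (List.toFinset_card_le _).trans (le_of_eq ?_)
      simp
    exact_mod_cast h1.trans hlen
  · obtain ⟨q, hq, rfl⟩ := hC C hCE
    -- The remaining properties hold for every listed container because it passed the acceptance
    -- test, whether or not its fingerprint comes from a satisfying assignment.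
    exact ((accepted_iff hL hH.bounded _).1 (hsound q hq).2.2).2 i
  · obtain ⟨q, hq, rfl⟩ := hC C hCE
    have h1 := weight_le_of_accepted hL hH.bounded hp.le hmδ hδ0 (hsound q hq).2.2
    refine ⟨(hH.card_le hp hlam0 (by linarith) h1).trans (le_of_eq ?_), h1⟩
    rw [hcard]
    push_cast
    field_simp
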